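/- Enumerate the zeros of $\zeta$ on the critical line with positive ordinates, with multiplicity, as $\tfrac12+i\gamma_j$. For $n\ge 2$, say that the $n$-correlations of the zeros agree with GUE if, writing $L=\log T$, $$\lim_{T\to\infty}\frac{2\pi}{T L}\sum_{\substack{j_1,\dots,j_n \text{ distinct}\\ 0<\gamma_{j_1},\dots,\gamma_{j_n}<T}} f\Bigl(\tfrac{L}{2\pi}\gamma_{j_1},\dots,\tfrac{L}{2\pi}\gamma_{j_n}\Bigr)=\int_{\mathbb R^n} f(x)\,W_n(x)\,\delta\Bigl(\tfrac{x_1+\cdots+x_n}{n}\Bigr)\,dx$$ for every smooth function $f:\mathbb R^n\to\mathbb R$ that is symmetric in its variables, satisfies $f(x+(t,\dots,t))=f(x)$ for all $t\in\mathbb R$, and decays faster than every power of $|x|^{-1}$ as $|x|\to\infty$ in the hyperplane $\sum_j x_j=0$. Here $W_n(x)=\det\bigl(K(x_i-x_j)\bigr)_{1\le i,j\le n}$ with $K(t)=\frac{\sin \pi t}{\pi t}$, $K(0)=1$, and $\delta$ is the Dirac delta function. Let GUE3 be the assertion that the $n$-correlations of the zeros agree with GUE for $n=2$ and $n=3$.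 **Theorem.** Assume the Riemann Hypothesis and GUE3. Let $0<c\le C$ be constants and let $a=a(T)$ be a real function with $c/\log T\le a(T)\le C/\log T$ for all sufficiently large $T$. Then, as $T\to\infty$, $$\int_{-T}^{T}\left|\frac{\zeta'}{\zeta}\bigl(\tfrac12+a+it\bigr)\right|^2\frac{\zeta'}{\zeta}\bigl(\tfrac12+a+it\bigr)\,dt\;\sim\;T\log T\;\frac{T^{-2a}}{2a^2}.$$ -/

import Mathlib

open Complex Filter Topology Asymptotics MeasureTheory
open scoped ContDiff

noncomputable section

namespace ZetaGUE

/-- Indices of the zeros `1/2 + iγ` of `ζ` with `0 < γ < T`, counted with multiplicity: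
a zero of order `m` contributes the `m` indices `(γ, 0), …, (γ, m - 1)`. -/
def zeroIndexSet (T : ℝ) : Set (ℝ × ℕ) :=
  {p | 0 < p.1 ∧ p.1 < T ∧ riemannZeta (1 / 2 + p.1 * I) = 0 ∧
    p.2 < analyticOrderNatAt riemannZeta (1 / 2 + p.1 * I)}

theorem zeroIndexSet_finite (T : ℝ) : (zeroIndexSet T).Finite := by
  have hc : Continuous fun t : ℝ => (1 / 2 + t * I : ℂ) := by fun_prop
  have hinj : Function.Injective fun t : ℝ => (1 / 2 + t * I : ℂ) := by
    intro s t h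
    simpa using h
  have h1 : (((fun t : ℝ => (1 / 2 + t * I : ℂ)) '' Set.Icc 0 T) ∩ riemannZetaZeros).Finite :=
    (isCompact_Icc.image hc).inter_riemannZetaZeros_finite
  have h2 := h1.preimage (f := fun t : ℝ => (1 / 2 + t * I : ℂ)) hinj.injOn
  refine (h2.biUnion (t := fun γ : ℝ => (fun k : ℕ => (γ, k)) ''
    Set.Iio (analyticOrderNatAt riemannZeta (1 / 2 + γ * I)))
    fun γ _ => (Set.finite_Iio _).image _).subset ?_
  rintro ⟨γ, k⟩ ⟨h0, hT, hz, hk⟩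
  refine Set.mem_biUnion (x := γ) ⟨⟨γ, ⟨h0.le, hT.le⟩, rfl⟩, ?_⟩ ⟨k, hk, rfl⟩
  simpa [riemannZetaZeros] using hz

def zeroIndex (T : ℝ) : Finset (ℝ × ℕ) := (zeroIndexSet_finite T).toFinset

/-- The sum of `f (L γ₁ / 2π, …, L γₙ / 2π)`, `L = log T`, over all `n`-tuples of zeros with
ordinates in `(0, T)` and pairwise distinct indices. -/
def zeroSum (n : ℕ) (T : ℝ) (f : (Fin n → ℝ) → ℝ) : ℝ :=
  ∑ v : Fin n ↪ zeroIndex T, f fun i => Real.log T / (2 * Real.pi) * (v i : ℝ × ℕ).1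

/-- The kernel `sin (π t) / (π t)`, equal to `1` at `t = 0`. -/
def sineKernel (t : ℝ) : ℝ := Real.sinc (Real.pi * t)

def gueDensity {n : ℕ} (x : Fin n → ℝ) : ℝ :=
  (Matrix.of fun i j => sineKernel (x i - x j)).det

/-- The integral of `F(x) δ((x₀ + ⋯ + xₙ) / (n + 1)) dx` over `ℝ^(n+1)`.  Integrating out `x₀`
puts it equal to `-(x₁ + ⋯ + xₙ)`, and the scaling of the delta function gives the factor
`n + 1`. -/
def meanZeroIntegral (n : ℕ) (F : (Fin (n + 1) → ℝ) → ℝ) : ℝ :=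
  (n + 1) * ∫ y : Fin n → ℝ, F (Matrix.vecCons (-∑ i, y i) y)

structure IsTestFunction {n : ℕ} (f : (Fin n → ℝ) → ℝ) : Prop where
  smooth : ContDiff ℝ ∞ f
  symmetric : ∀ (σ : Equiv.Perm (Fin n)) (x : Fin n → ℝ), f (x ∘ σ) = f x
  translation : ∀ (x : Fin n → ℝ) (t : ℝ), f (x + fun _ => t) = f x
  rapid_decay : ∀ k : ℕ, ∃ C : ℝ, ∀ x : Fin n → ℝ, ∑ i, x i = 0 → ‖x‖ ^ k * |f x| ≤ C

/-- The `(n+1)`-point correlations of the zeros are those of the Gaussian Unitary Ensemble.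
The asymptotic relation is written as a limit, so that it also makes sense if the limit is `0`. -/
def CorrelationAgrees (n : ℕ) : Prop :=
  ∀ f : (Fin (n + 1) → ℝ) → ℝ, IsTestFunction f →
    Tendsto (fun T : ℝ => zeroSum (n + 1) T f / (T * Real.log T / (2 * Real.pi))) atTop
      (𝓝 (meanZeroIntegral n fun x => f x * gueDensity x))

/-- The `n`-point correlations of the zeros are those of the Gaussian Unitary Ensemble for
all `2 ≤ n ≤ N`. -/
def GUE (N : ℕ) : Prop :=
  ∀ n : ℕ, 2 ≤ n + 1 → n + 1 ≤ N → CorrelationAgrees n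

end ZetaGUE

end

noncomputable section

namespace ZetaGUE

/-! Write w = ζ'/ζ(1/2 + a + it). Since |w|² Re w = (4/3)(Re w)³ − (1/3) Re w³, and since reflection
t ↦ −t cancels imaginary parts, the integral is a third moment of Re w minus the integral of the
holomorphic function w³. The latter is moved to Re s = 3, where w is bounded; it costs O(T + log⁶ T)
(`exists_norm_integral_logDeriv_pow_le`), against a main term of size T log³ T.

Under RH the partial fraction expansion of ξ'/ξ gives Re w = ∑ a/(a² + (t − γ)²) − (log t)/2 + O(1)
(`exists_abs_re_sub_sum_poisson_le`). With α = a log T, the quotient Re w / log T is therefore close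
to S(t) − 1/2, where S is the linear statistic of the kernel α/(α² + (2πx)²) over the rescaled
zeros. Powers of S split, according to coincidences of indices, into sums over single zeros and over
distinct pairs and triples. Integrating such a sum over t turns it into a correlation sum for a
translation invariant test function, so GUE evaluates it (`tendsto_integral_tupleStat`). The
one-point term needs the number of zeros, which comes from integrating the same Poisson formula
(`countAsymptotic`).

On the GUE side S has mean 1/2, so the limit of the third moment of S − 1/2 is a third cumulant. The
sine kernel is the Fourier transform of the indicator of a unit interval, so the determinantal
integrals become elementary integrals of exponentials e^{−α|·|} over the unit square and cube; the
value is 3e^{−2α}/(16α²) (`gue_cumulant_poisson`). Multiplied by 8/3 this is e^{−2α}/(2α²), and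
e^{−2α} = T^{−2a}.

Two difficulties remain. The Poisson kernel decays only quadratically, so it is truncated; the error
is at most a small multiple of the linear statistic of a slowly decaying `window`, whose third
moment is bounded by another application of GUE (`exists_integral_linStat_window_cube_le`). And a
log T is only bounded, not convergent; along an ultrafilter it has a limit α₀, and the ratio tends
to 1 whatever α₀ is (`tendsto_moment_div`). -/

/-! ### The digamma function from Euler's limit formula -/

/-- Cauchy's formula for the derivative and dominated convergence on the circle: pointwise
convergence with a uniform bound is enough, so locally uniform convergence of `GammaSeq` never has
to be shown. -/
theorem tendsto_deriv_of_tendsto_of_bounded {f : ℕ → ℂ → ℂ} {g : ℂ → ℂ} {c : ℂ} {r M : ℝ}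
    (hr : 0 < r) (hf : ∀ᶠ n in atTop, DiffContOnCl ℂ (f n) (Metric.ball c r))
    (hg : DiffContOnCl ℂ g (Metric.ball c r))
    (hM : ∀ᶠ n in atTop, ∀ z ∈ Metric.sphere c r, ‖f n z‖ ≤ M)
    (hlim : ∀ z ∈ Metric.sphere c r, Tendsto (fun n => f n z) atTop (𝓝 (g z))) :
    Tendsto (fun n => deriv (f n) c) atTop (𝓝 (deriv g c)) := by
  have key : Tendsto (fun n => (2 * Real.pi * I : ℂ)⁻¹ •
      ∮ z in C(c, r), (1 / (z - c) ^ 2) • f n z) atTop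
      (𝓝 ((2 * Real.pi * I : ℂ)⁻¹ • ∮ z in C(c, r), (1 / (z - c) ^ 2) • g z)) := by
    refine Tendsto.const_smul ?_ _
    simp only [circleIntegral]
    refine intervalIntegral.tendsto_integral_filter_of_dominated_convergence
      (fun _ => r * (1 / r ^ 2 * M)) ?_ ?_ ?_ ?_
    · filter_upwards [hf] with n hn
      have hc : ContinuousOn (f n) (Metric.sphere c r) :=
        hn.continuousOn_ball.mono Metric.sphere_subset_closedBall
      have h1 : Continuous fun θ : ℝ => f n (circleMap c r θ) :=
        hc.comp_continuous (continuous_circleMap c r) (fun θ => circleMap_mem_sphere c hr.le θ)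
      have h2 : Continuous fun θ : ℝ => 1 / (circleMap c r θ - c) ^ 2 := by
        refine Continuous.div continuous_const (by fun_prop) (fun θ => pow_ne_zero 2 ?_)
        exact sub_ne_zero.mpr (circleMap_ne_center hr.ne')
      have h3 : Continuous (deriv (circleMap c r)) := by
        have : deriv (circleMap c r) = fun θ => circleMap 0 r θ * I := by
          ext θ; simp [deriv_circleMap]
        rw [this]; fun_prop
      exact (h3.smul (h2.smul h1)).aestronglyMeasurable
    · filter_upwards [hM] with n hn
      refine Eventually.of_forall fun θ _ => ?_
      rw [norm_smul, norm_smul, norm_div, norm_one, norm_pow]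
      have e1 : ‖deriv (circleMap c r) θ‖ = r := by simp [deriv_circleMap, abs_of_pos hr]
      have e2 : ‖circleMap c r θ - c‖ = r := by simp [circleMap, abs_of_pos hr]
      rw [e1, e2]
      gcongr
      exact hn _ (circleMap_mem_sphere c hr.le θ)
    · simp
    · refine Eventually.of_forall fun θ _ => ?_
      exact ((hlim _ (circleMap_mem_sphere c hr.le θ)).const_smul _).const_smul _
  rw [hg.deriv_eq_smul_circleIntegral hr, inv_smul_smul₀ two_pi_I_ne_zero] at key
  refine key.congr' ?_
  filter_upwards [hf] with n hn
  rw [hn.deriv_eq_smul_circleIntegral hr, inv_smul_smul₀ two_pi_I_ne_zero]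

/-- In Euler's integral over (0, n) the weight (1 − x/n)^n is at most e^{−x}. This is the uniform
bound needed on circles in the right half-plane. -/
theorem norm_GammaSeq_le {s : ℂ} (hs : 0 < s.re) {n : ℕ} (hn : n ≠ 0) :
    ‖GammaSeq s n‖ ≤ Real.Gamma s.re := by
  rw [GammaSeq_eq_approx_Gamma_integral hs hn, Real.Gamma_eq_integral hs]
  have hi := Real.GammaIntegral_convergent hs
  have hn' : (0 : ℝ) ≤ n := Nat.cast_nonneg n
  rw [intervalIntegral.integral_of_le hn']
  calc ‖∫ x in Set.Ioc (0 : ℝ) n, ((1 - x / n : ℝ) ^ n : ℝ) * (x : ℂ) ^ (s - 1)‖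
      ≤ ∫ x in Set.Ioc (0 : ℝ) n, Real.exp (-x) * x ^ (s.re - 1) := by
        refine norm_integral_le_of_norm_le (hi.mono_set Set.Ioc_subset_Ioi_self) ?_
        filter_upwards [ae_restrict_mem measurableSet_Ioc] with x hx
        rw [norm_mul, norm_cpow_eq_rpow_re_of_pos hx.1]
        simp only [sub_re, one_re]
        gcongr
        · exact Real.rpow_nonneg hx.1.le _
        rw [Complex.norm_real, Real.norm_eq_abs, abs_of_nonneg
          (pow_nonneg (by rw [sub_nonneg]; exact div_le_one_of_le₀ hx.2 hn') _)]
        exact Real.one_sub_div_pow_le_exp_neg hx.2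
    _ ≤ _ := setIntegral_mono_set hi
        (by filter_upwards [ae_restrict_mem measurableSet_Ioi] with x hx
            exact mul_nonneg (Real.exp_nonneg _) (Real.rpow_nonneg (le_of_lt hx) _))
        (Eventually.of_forall Set.Ioc_subset_Ioi_self)

theorem add_natCast_ne_zero {z : ℂ} (hz : 0 < z.re) (j : ℕ) : z + j ≠ 0 := by
  intro h
  have := congrArg re h
  simp at this
  have : (0 : ℝ) ≤ j := Nat.cast_nonneg j
  linarith

theorem hasDerivAt_GammaSeq {z : ℂ} (hz : 0 < z.re) {n : ℕ} (hn : n ≠ 0) :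
    HasDerivAt (fun s => GammaSeq s n)
      (GammaSeq z n * (Real.log n - ∑ j ∈ Finset.range (n + 1), (z + j)⁻¹)) z := by
  have hn' : (n : ℂ) ≠ 0 := Nat.cast_ne_zero.mpr hn
  have hprod : ∀ j ∈ Finset.range (n + 1), z + (j : ℂ) ≠ 0 := fun j _ => add_natCast_ne_zero hz j
  have h1 : HasDerivAt (fun s : ℂ => (n : ℂ) ^ s) ((n : ℂ) ^ z * Complex.log n) z := by
    simpa using (hasDerivAt_id z).const_cpow (Or.inl hn')
  have hd : DifferentiableAt ℂ (fun s : ℂ => ∏ j ∈ Finset.range (n + 1), (s + (j : ℂ))) z := by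
    fun_prop
  have hP : (∏ j ∈ Finset.range (n + 1), (z + (j : ℂ))) ≠ 0 := Finset.prod_ne_zero_iff.mpr hprod
  have h2 : deriv (fun s : ℂ => ∏ j ∈ Finset.range (n + 1), (s + (j : ℂ))) z =
      (∏ j ∈ Finset.range (n + 1), (z + (j : ℂ))) *
        ∑ j ∈ Finset.range (n + 1), (z + j)⁻¹ := by
    have := logDeriv_prod (s := Finset.range (n + 1)) (f := fun (j : ℕ) (s : ℂ) => s + (j : ℂ)) (x := z)
      (fun j hj => hprod j hj) (fun j _ => by fun_prop)
    rw [logDeriv_apply, div_eq_iff hP] at this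
    rw [this, mul_comm]
    congr 1
    refine Finset.sum_congr rfl fun j _ => ?_
    simp [logDeriv_apply]
  have h3 := ((h1.mul_const ((n.factorial : ℂ))).div hd.hasDerivAt hP)
  refine h3.congr_deriv ?_
  rw [h2, GammaSeq]
  have : Complex.log (n : ℂ) = (Real.log n : ℂ) := by
    rw [← Complex.ofReal_natCast, ← Complex.ofReal_log (Nat.cast_nonneg n)]
  rw [this]
  field_simp

/-- The logarithmic derivative of Euler's finite product converges because both numerator and
denominator do. The circle has radius half of Re z, so that it stays where Γ is bounded. -/
theorem tendsto_digamma {z : ℂ} (hz : 0 < z.re) :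
    Tendsto (fun n : ℕ => (Real.log n : ℂ) - ∑ j ∈ Finset.range (n + 1), (z + j)⁻¹) atTop
      (𝓝 (digamma z)) := by
  set r : ℝ := z.re / 2 with hr
  have hr0 : 0 < r := by positivity
  have hre : ∀ w ∈ Metric.closedBall z r, r ≤ w.re ∧ w.re ≤ 3 * r := by
    intro w hw
    have h1 := (abs_re_le_norm (w - z)).trans (by simpa [dist_eq_norm] using hw)
    rw [sub_re, abs_le] at h1
    constructor <;> linarith
  have hcl : closure (Metric.ball z r) ⊆ Metric.closedBall z r := Metric.closure_ball_subset_closedBall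
  obtain ⟨M, hM⟩ : ∃ M, ∀ x ∈ Set.Icc r (3 * r), Real.Gamma x ≤ M := by
    have hc : ContinuousOn Real.Gamma (Set.Icc r (3 * r)) := fun x hx =>
      (Real.differentiableAt_Gamma (fun m => by
        have : (0 : ℝ) ≤ m := Nat.cast_nonneg m
        have := hx.1
        linarith)).continuousAt.continuousWithinAt
    obtain ⟨M, hM⟩ := (isCompact_Icc.image_of_continuousOn hc).bddAbove
    exact ⟨M, fun x hx => hM ⟨x, hx, rfl⟩⟩
  have key := tendsto_deriv_of_tendsto_of_bounded (f := fun n s => GammaSeq s n) (g := Gamma)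
    (c := z) (r := r) (M := M) hr0
    (by
      filter_upwards [eventually_ne_atTop 0] with n hn
      refine DifferentiableOn.diffContOnCl fun w hw => ?_
      exact (hasDerivAt_GammaSeq (hr0.trans_le (hre w (hcl hw)).1)
        hn).differentiableAt.differentiableWithinAt)
    (by
      refine DifferentiableOn.diffContOnCl fun w hw => ?_
      refine (differentiableAt_Gamma w fun m h => ?_).differentiableWithinAt
      have h1 := (hre w (hcl hw)).1
      rw [h] at h1
      simp at h1
      have : (0 : ℝ) ≤ m := Nat.cast_nonneg m
      linarith)
    (by
      filter_upwards [eventually_ne_atTop 0] with n hn w hw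
      have := hre w (Metric.sphere_subset_closedBall hw)
      exact (norm_GammaSeq_le (hr0.trans_le this.1) hn).trans (hM _ this))
    (fun w _ => GammaSeq_tendsto_Gamma w)
  have hG : Gamma z ≠ 0 := Gamma_ne_zero_of_re_pos hz
  have h2 := key.div (GammaSeq_tendsto_Gamma z) hG
  rw [digamma_def, logDeriv_apply]
  refine h2.congr' ?_
  filter_upwards [eventually_ne_atTop 0] with n hn
  rw [Pi.div_apply, (hasDerivAt_GammaSeq hz hn).deriv]
  refine mul_div_cancel_left₀ _ ?_
  rw [GammaSeq]
  refine div_ne_zero (mul_ne_zero ?_ (Nat.cast_ne_zero.mpr n.factorial_ne_zero))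
    (Finset.prod_ne_zero_iff.mpr fun j _ => add_natCast_ne_zero hz j)
  simp [cpow_eq_zero_iff, hn]

/-- Mean value inequality for x ↦ log(z + x) − x/z on [0, 1], whose derivative is 1/(z + x) − 1/z.
-/
theorem norm_log_add_one_sub_log_sub_inv_le {z : ℂ} (hz : 0 < z.re) :
    ‖log (z + 1) - log z - z⁻¹‖ ≤ 1 / z.re ^ 2 := by
  have hpos : ∀ x ∈ Set.Icc (0 : ℝ) 1, 0 < (z + x).re := fun x hx => by
    simp; linarith [hx.1]
  have hne : ∀ x ∈ Set.Icc (0 : ℝ) 1, z + x ≠ 0 := fun x hx h => by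
    have := hpos x hx; rw [h] at this; simp at this
  have hz0 : z ≠ 0 := by simpa using hne 0 (by simp)
  have hder : ∀ x ∈ Set.Icc (0 : ℝ) 1, HasDerivWithinAt (fun x : ℝ => log (z + x) - x * z⁻¹)
      ((z + x)⁻¹ - z⁻¹) (Set.Icc 0 1) x := by
    intro x hx
    have h1 : HasDerivAt (fun x : ℝ => z + (x : ℂ)) 1 x := by
      exact ((hasDerivAt_id (x : ℂ)).const_add z).comp_ofReal
    have h2 := h1.clog_real (Or.inl (hpos x hx))
    have h3 : HasDerivAt (fun x : ℝ => (x : ℂ) * z⁻¹) (1 * z⁻¹) x := by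
      exact ((hasDerivAt_id (x : ℂ)).comp_ofReal).mul_const _
    exact ((h2.sub h3).congr_deriv (by simp)).hasDerivWithinAt
  have hb : ∀ x ∈ Set.Ico (0 : ℝ) 1, ‖(z + x)⁻¹ - z⁻¹‖ ≤ 1 / z.re ^ 2 := by
    intro x hx
    have hx' : x ∈ Set.Icc (0 : ℝ) 1 := ⟨hx.1, hx.2.le⟩
    rw [inv_sub_inv (hne x hx') hz0, norm_div, norm_mul]
    have e1 : ‖z - (z + x)‖ ≤ 1 := by
      simp [abs_of_nonneg hx.1, hx.2.le]
    have e2 : z.re ≤ ‖z‖ := re_le_norm z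
    have e3 : z.re ≤ ‖z + x‖ := by
      refine le_trans ?_ (re_le_norm _)
      simp [hx.1]
    rw [sq]
    gcongr
  have := norm_image_sub_le_of_norm_deriv_le_segment' hder hb 1 (by simp)
  simp at this
  simpa [sub_right_comm] using this

/-- `ψ(z) = log z + O(1)` in a right half-plane. -/
theorem norm_digamma_sub_log_le {z : ℂ} (hz : 1 / 4 ≤ z.re) : ‖digamma z - log z‖ ≤ 32 := by
  have hz0 : 0 < z.re := by linarith
  have htel : ∀ n : ℕ, ∑ j ∈ Finset.range n, (log (z + j + 1) - log (z + j)) =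
      log (z + n) - log z := by
    intro n
    have := Finset.sum_range_sub (fun j : ℕ => log (z + j)) n
    simpa [add_assoc] using this
  have hbound : ∀ n : ℕ, ‖log (z + n) - log z - ∑ j ∈ Finset.range n, (z + j)⁻¹‖ ≤ 32 := by
    intro n
    rw [← htel, ← Finset.sum_sub_distrib]
    refine (norm_sum_le _ _).trans ?_
    have h1 : ∀ j ∈ Finset.range n, ‖log (z + j + 1) - log (z + j) - (z + j)⁻¹‖ ≤
        1 / (z.re + j) ^ 2 := by
      intro j _
      have : 0 < (z + j).re := by simp; positivity
      simpa using norm_log_add_one_sub_log_sub_inv_le this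
    refine (Finset.sum_le_sum h1).trans ?_
    -- For v ≥ 1/4 one has v + 1 ≤ 5v, hence 1/v² ≤ 5(1/v − 1/(v + 1)), which telescopes. The total
    -- is at most 5 · 4 = 20, within the stated 32.
    have h2 : ∀ n : ℕ, ∑ j ∈ Finset.range n, 1 / (z.re + j) ^ 2 ≤
        5 * (1 / z.re - 1 / (z.re + n)) := by
      intro n
      induction n with
      | zero => simp
      | succ n ih =>
        rw [Finset.sum_range_succ]
        have hn : (0 : ℝ) ≤ n := Nat.cast_nonneg n
        have hv : 0 < z.re + n := by positivity
        have : 1 / (z.re + n) ^ 2 ≤ 5 * (1 / (z.re + n) - 1 / (z.re + n + 1)) := by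
          rw [div_sub_div _ _ hv.ne' (by positivity), ← mul_div_assoc,
            div_le_div_iff₀ (by positivity) (by positivity)]
          nlinarith
        push_cast
        rw [← add_assoc]
        linarith
    refine (h2 n).trans ?_
    have h3 : 0 ≤ 1 / (z.re + n) := by positivity
    have h4 : 1 / z.re ≤ 1 / (1 / 4) := one_div_le_one_div_of_le (by norm_num) hz
    norm_num1 at h4
    linarith
  -- The telescoped sum ends at log(z + n + 1), while Euler's formula has log n; the difference
  -- vanishes in the limit.
  have hlog : Tendsto (fun n : ℕ => (Real.log n : ℂ) - log (z + (n + 1 : ℕ))) atTop (𝓝 0) := by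
    have h1 : Tendsto (fun n : ℕ => (1 + (z + 1) / n : ℂ)) atTop (𝓝 (1 + 0)) :=
      tendsto_const_nhds.add (tendsto_const_div_atTop_nhds_zero_nat (z + 1))
    rw [add_zero] at h1
    have h2 := (continuousAt_clog (by simp : (1 : ℂ) ∈ slitPlane)).tendsto.comp h1
    rw [log_one] at h2
    rw [← neg_zero]
    refine h2.neg.congr' ?_
    filter_upwards [eventually_gt_atTop 0] with n hn
    have hn' : (n : ℂ) ≠ 0 := Nat.cast_ne_zero.mpr hn.ne'
    have e : z + ((n + 1 : ℕ) : ℂ) = ((n : ℝ) : ℂ) * (1 + (z + 1) / n) := by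
      push_cast; field_simp; ring
    have hne : (1 + (z + 1) / n : ℂ) ≠ 0 := by
      intro h
      rw [h, mul_zero] at e
      exact add_natCast_ne_zero hz0 (n + 1) e
    rw [e, log_ofReal_mul (by positivity) hne]
    simp
  have hlim := ((tendsto_digamma hz0).sub_const (log z)).sub hlog
  rw [sub_zero] at hlim
  refine le_of_tendsto hlim.norm (Eventually.of_forall fun n => ?_)
  refine (le_of_eq ?_).trans (hbound (n + 1))
  congr 1
  ring

/-! ### Partial fractions for entire functions -/

/-- The singularity of f/(z − ρ)^n is removable: near ρ the quotient agrees with the analytic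
cofactor supplied by the order of vanishing, so redefining it at the single point ρ makes it entire.
-/
theorem exists_entire_eq_pow_mul {f : ℂ → ℂ} (hf : Differentiable ℂ f) {ρ : ℂ}
    (h : analyticOrderAt f ρ ≠ ⊤) :
    ∃ g : ℂ → ℂ, Differentiable ℂ g ∧ g ρ ≠ 0 ∧
      ∀ z, f z = (z - ρ) ^ analyticOrderNatAt f ρ * g z := by
  set n := analyticOrderNatAt f ρ with hn
  have h1 : analyticOrderAt f ρ = n := by
    rw [hn, analyticOrderNatAt, ENat.natCast_toNat h]
  obtain ⟨g, hg, hg0, hfg⟩ := ((hf.analyticAt ρ).analyticOrderAt_eq_natCast).mp h1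
  have heq : Function.update (fun z => f z / (z - ρ) ^ n) ρ (g ρ) =ᶠ[𝓝 ρ] g := by
    filter_upwards [hfg] with z hz
    by_cases hzρ : z = ρ
    · subst hzρ; simp
    · have : (z - ρ) ^ n ≠ 0 := pow_ne_zero _ (sub_ne_zero.mpr hzρ)
      rw [Function.update_of_ne hzρ, hz, smul_eq_mul]
      field_simp
  refine ⟨Function.update (fun z => f z / (z - ρ) ^ n) ρ (g ρ), fun z => ?_, ?_, fun z => ?_⟩
  · by_cases hzρ : z = ρ
    · subst hzρ
      exact hg.differentiableAt.congr_of_eventuallyEq heq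
    · have hz : (z - ρ) ^ n ≠ 0 := pow_ne_zero _ (sub_ne_zero.mpr hzρ)
      have : DifferentiableAt ℂ (fun z => f z / (z - ρ) ^ n) z :=
        (hf z).div (by fun_prop) hz
      refine this.congr_of_eventuallyEq ?_
      filter_upwards [isOpen_compl_singleton.mem_nhds hzρ] with w hw
      exact Function.update_of_ne hw _ _
  · simpa using hg0
  · by_cases hzρ : z = ρ
    · subst hzρ
      simpa using hfg.self_of_nhds
    · have : (z - ρ) ^ n ≠ 0 := pow_ne_zero _ (sub_ne_zero.mpr hzρ)
      rw [Function.update_of_ne hzρ]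
      field_simp

theorem exists_entire_eq_prod_mul {f : ℂ → ℂ} (hf : Differentiable ℂ f)
    (h : ∀ ρ, analyticOrderAt f ρ ≠ ⊤) (S : Finset ℂ) :
    ∃ g : ℂ → ℂ, Differentiable ℂ g ∧ (∀ ρ ∈ S, g ρ ≠ 0) ∧
      ∀ z, f z = (∏ ρ ∈ S, (z - ρ) ^ analyticOrderNatAt f ρ) * g z := by
  classical
  induction S using Finset.induction_on with
  | empty => exact ⟨f, hf, by simp, by simp⟩
  | insert ρ S hρ ih =>
    obtain ⟨g, hg, hg0, hfg⟩ := ih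
    have hP : AnalyticAt ℂ (fun z => ∏ r ∈ S, (z - r) ^ analyticOrderNatAt f r) ρ :=
      Differentiable.analyticAt (by fun_prop) _
    have hP0 : (∏ r ∈ S, (ρ - r) ^ analyticOrderNatAt f r) ≠ 0 :=
      Finset.prod_ne_zero_iff.mpr fun r hr => pow_ne_zero _
        (sub_ne_zero.mpr fun e => hρ (e ▸ hr))
    have hord : analyticOrderAt f ρ = analyticOrderAt g ρ := by
      have e : f = (fun z => ∏ r ∈ S, (z - r) ^ analyticOrderNatAt f r) * g := funext hfg
      conv_lhs => rw [e]
      rw [analyticOrderAt_mul hP (hg.analyticAt ρ),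
        hP.analyticOrderAt_eq_zero.mpr hP0, zero_add]
    obtain ⟨g', hg', hg0', hgg'⟩ := exists_entire_eq_pow_mul hg (hord ▸ h ρ)
    refine ⟨g', hg', ?_, fun z => ?_⟩
    · intro r hr
      rcases Finset.mem_insert.mp hr with rfl | hr
      · exact hg0'
      · intro h0
        exact hg0 r hr (by rw [hgg', h0, mul_zero])
    · rw [hfg, hgg', Finset.prod_insert hρ, analyticOrderNatAt, analyticOrderNatAt, hord]
      ring

/-- Local form of the partial fraction expansion of `f'/f`, with an error term that is the
derivative of a bounded function. -/
theorem exists_logDeriv_eq_sum_add_deriv {f : ℂ → ℂ} (hf : Differentiable ℂ f) (h0 : f 0 ≠ 0)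
    {R M : ℝ} (hR : 0 < R) (hM : 0 < M)
    (hb : ∀ z ∈ Metric.sphere (0 : ℂ) R, ‖f z‖ ≤ Real.exp M * ‖f 0‖)
    {S : Finset ℂ} (hS : ∀ ρ, ρ ∈ S ↔ f ρ = 0 ∧ ‖ρ‖ ≤ R / 2) :
    ∃ h : ℂ → ℂ, DifferentiableOn ℂ h (Metric.ball 0 (R / 2)) ∧
      (∀ z, ‖z‖ ≤ R / 4 → ‖h z‖ ≤ 2 * M) ∧
      ∀ z, ‖z‖ < R / 2 → f z ≠ 0 →
        logDeriv f z = ∑ ρ ∈ S, analyticOrderNatAt f ρ * (z - ρ)⁻¹ + deriv h z := by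
  have hfin : ∀ ρ, analyticOrderAt f ρ ≠ ⊤ := by
    intro ρ
    refine AnalyticOnNhd.analyticOrderAt_ne_top_of_isPreconnected (x := 0) (U := Set.univ)
      (fun z _ => hf.analyticAt z) isPreconnected_univ (Set.mem_univ _) (Set.mem_univ _) ?_
    rw [(hf.analyticAt 0).analyticOrderAt_eq_zero.mpr h0]
    simp
  obtain ⟨g, hg, hgS, hfg⟩ := exists_entire_eq_prod_mul hf hfin S
  have hgne : ∀ z, ‖z‖ ≤ R / 2 → g z ≠ 0 := by
    intro z hz hgz
    by_cases hzS : z ∈ S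
    · exact hgS z hzS hgz
    · exact hzS ((hS z).mpr ⟨by rw [hfg, hgz, mul_zero], hz⟩)
  have hg0 : g 0 ≠ 0 := hgne 0 (by simp; positivity)
  -- On |w| = R each factor satisfies |w − ρ| ≥ R/2 ≥ |0 − ρ|, so removing the zeros does not
  -- increase the ratio to the value at 0; the maximum principle carries the bound inside.
  have hmax : ∀ z, ‖z‖ ≤ R → ‖g z‖ ≤ Real.exp M * ‖g 0‖ := by
    intro z hz
    refine norm_le_of_forall_mem_frontier_norm_le (U := Metric.ball 0 R) Metric.isBounded_ball
      hg.diffContOnCl ?_ (by rw [closure_ball _ hR.ne']; simpa using hz)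
    intro w hw
    rw [frontier_ball _ hR.ne'] at hw
    have hwR : ‖w‖ = R := by simpa using hw
    have h1 := hb w hw
    rw [hfg w, hfg 0, norm_mul, norm_mul, norm_prod, norm_prod] at h1
    have h2 : ∏ ρ ∈ S, ‖(0 - ρ) ^ analyticOrderNatAt f ρ‖ ≤
        ∏ ρ ∈ S, ‖(w - ρ) ^ analyticOrderNatAt f ρ‖ := by
      refine Finset.prod_le_prod (fun _ _ => norm_nonneg _) fun ρ hρ => ?_
      rw [norm_pow, norm_pow]
      have h3 := ((hS ρ).mp hρ).2
      have h4 := norm_sub_norm_le w ρ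
      gcongr
      simp only [zero_sub, norm_neg]
      linarith
    have h5 : 0 < ∏ ρ ∈ S, ‖(w - ρ) ^ analyticOrderNatAt f ρ‖ := by
      refine Finset.prod_pos fun ρ hρ => ?_
      rw [norm_pos_iff]
      refine pow_ne_zero _ (sub_ne_zero.mpr ?_)
      rintro rfl
      have h3 := ((hS w).mp hρ).2
      linarith
    refine le_of_mul_le_mul_left (h1.trans ?_) h5
    calc _ = (∏ ρ ∈ S, ‖(0 - ρ) ^ analyticOrderNatAt f ρ‖) * (Real.exp M * ‖g 0‖) := by ring
      _ ≤ _ := by gcongr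
  have hlog : DifferentiableOn ℂ (logDeriv g) (Metric.ball 0 (R / 2)) := by
    intro z hz
    have hz' : ‖z‖ < R / 2 := by simpa using hz
    have h2 : DifferentiableAt ℂ (deriv g) z :=
      (hg.analyticAt z).deriv.differentiableAt
    exact (h2.div (hg z) (hgne z hz'.le)).differentiableWithinAt
  -- h is the branch of log(g/g(0)) on the disc with h(0) = 0. The growth bound controls its real
  -- part only.
  obtain ⟨h, hh0, hh⟩ := hlog.isExactOn_ball.with_val_at 0 0
  have hhd : ∀ z, ‖z‖ < R / 2 → HasDerivAt h (logDeriv g z) z := fun z hz => hh z (by simpa using hz)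
  have hexp : ∀ z, ‖z‖ < R / 2 → g z = g 0 * exp (h z) := by
    have hc : ∀ z ∈ Metric.ball (0 : ℂ) (R / 2), HasDerivAt (fun z => g z * exp (-h z)) 0 z := by
      intro z hz
      have hz' : ‖z‖ < R / 2 := by simpa using hz
      have := (hg z).hasDerivAt.mul ((hhd z hz').neg.cexp)
      refine this.congr_deriv ?_
      rw [logDeriv_apply]
      have := hgne z hz'.le
      field_simp
      ring
    intro z hz
    have hconst : g z * exp (-h z) = g 0 * exp (-h 0) := by
      refine (convex_ball (0 : ℂ) (R / 2)).is_const_of_fderivWithin_eq_zero (𝕜 := ℂ)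
        (f := fun z => g z * exp (-h z))
        (fun z hz => (hc z hz).differentiableAt.differentiableWithinAt) ?_
        (by simpa using hz) (by simp; positivity)
      intro w hw
      rw [fderivWithin_of_isOpen Metric.isOpen_ball hw]
      ext
      simpa using (hc w hw).deriv
    rw [hh0, neg_zero, exp_zero, mul_one, exp_neg] at hconst
    rw [← hconst, mul_assoc, inv_mul_cancel₀ (exp_ne_zero _), mul_one]
  refine ⟨h, fun z hz => ?_, ?_, ?_⟩
  · exact (hhd z (by simpa using hz)).differentiableAt.differentiableWithinAt
  · intro z hz
    have hz2 : ‖z‖ < R / 2 := by linarith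
    -- The resulting bound 2M|z|/(R/2 − |z|) is at most 2M for |z| ≤ R/4.
    have := borelCaratheodory_zero (f := h) (M := M) (R := R / 2) (z := z) hM
      (fun z hz => (hhd z (by simpa using hz)).differentiableAt.differentiableWithinAt)
      (fun w hw => by
        have hw' : ‖w‖ < R / 2 := by simpa using hw
        have h1 := hmax w (by linarith)
        rw [hexp w hw', norm_mul, norm_exp, mul_comm] at h1
        exact Real.exp_le_exp.mp (le_of_mul_le_mul_right h1 (norm_pos_iff.mpr hg0)))
      (by positivity) (by simpa using hz2) hh0
    refine this.trans ?_
    rw [div_le_iff₀ (by linarith)]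
    nlinarith
  · intro z hz hfz
    rw [(hhd z hz).deriv]
    have hne : ∀ ρ ∈ S, z - ρ ≠ 0 := by
      intro ρ hρ e
      rw [sub_eq_zero.mp e] at hfz
      exact hfz ((hS ρ).mp hρ).1
    have e : f = fun z => (∏ ρ ∈ S, (z - ρ) ^ analyticOrderNatAt f ρ) * g z := funext hfg
    have e2 : logDeriv (fun z => ∏ ρ ∈ S, (z - ρ) ^ analyticOrderNatAt f ρ) z =
        ∑ ρ ∈ S, analyticOrderNatAt f ρ * (z - ρ)⁻¹ := by
      rw [logDeriv_prod (f := fun ρ z => (z - ρ) ^ analyticOrderNatAt f ρ)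
        (fun ρ hρ => pow_ne_zero _ (hne ρ hρ)) (fun ρ _ => by fun_prop)]
      refine Finset.sum_congr rfl fun ρ _ => ?_
      rw [logDeriv_fun_pow (by fun_prop)]
      simp [logDeriv_apply]
    rw [← e2]
    conv_lhs => rw [e]
    exact logDeriv_mul _ (Finset.prod_ne_zero_iff.mpr fun ρ hρ => pow_ne_zero _ (hne ρ hρ))
      (hgne z hz.le) (by fun_prop) (hg z)

theorem analyticOrderNatAt_neg_of_even {f : ℂ → ℂ} (heven : ∀ z, f (-z) = f z) (ρ : ℂ) :
    analyticOrderNatAt f (-ρ) = analyticOrderNatAt f ρ := by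
  have h1 : f ∘ (fun z : ℂ => -z) = f := funext heven
  have h2 : deriv (fun z : ℂ => -z) ρ ≠ 0 := by simp
  have h3 := analyticOrderAt_comp_of_deriv_ne_zero (f := f) (g := fun z : ℂ => -z) (z₀ := ρ)
    (by fun_prop) h2
  rw [h1] at h3
  rw [analyticOrderNatAt, analyticOrderNatAt, h3]

theorem deriv_zero_of_even {f : ℂ → ℂ} (heven : ∀ z, f (-z) = f z) : deriv f 0 = 0 := by
  have h := deriv_comp_neg f 0
  simp only [heven, neg_zero] at h
  linear_combination h / 2

/-- Cauchy's estimate twice, with radii R/8 and R/16, bounds the second derivative by 2 · 8 · 16 ·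
M/R²; then integrate from 0. With M of order R^{3/2} a single Cauchy estimate M/R would diverge; the
vanishing of the derivative at 0 gains the factor |z|/R that makes the error tend to 0. -/
theorem norm_deriv_le_of_bounded_of_deriv_zero {h : ℂ → ℂ} {R M : ℝ} (hR : 0 < R)
    (hd : DifferentiableOn ℂ h (Metric.ball 0 (R / 2)))
    (hb : ∀ z, ‖z‖ ≤ R / 4 → ‖h z‖ ≤ 2 * M) (h0 : deriv h 0 = 0) {z : ℂ} (hz : ‖z‖ ≤ R / 16) :
    ‖deriv h z‖ ≤ 256 * M / R ^ 2 * ‖z‖ := by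
  have hball : ∀ w : ℂ, ∀ r : ℝ, 0 < r → ‖w‖ + r < R / 2 →
      Metric.closedBall w r ⊆ Metric.ball 0 (R / 2) := by
    intro w r _ hw v hv
    have h1 : ‖v - w‖ ≤ r := by simpa [dist_eq_norm] using hv
    have h2 : ‖v‖ ≤ ‖w‖ + ‖v - w‖ := by
      have := norm_add_le w (v - w); simpa using this
    simp only [Metric.mem_ball, dist_zero_right]
    linarith
  have hd2 : DifferentiableOn ℂ (deriv h) (Metric.ball 0 (R / 2)) := hd.deriv Metric.isOpen_ball
  have hsph : ∀ w v : ℂ, ∀ r : ℝ, v ∈ Metric.sphere w r → ‖v‖ ≤ ‖w‖ + r := by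
    intro w v r hv
    have h1 : ‖v - w‖ = r := by simpa [dist_eq_norm] using hv
    have := norm_add_le w (v - w)
    rw [h1] at this
    simpa using this
  have h1 : ∀ w : ℂ, ‖w‖ ≤ R / 8 → ‖deriv h w‖ ≤ 2 * M / (R / 8) := by
    intro w hw
    refine norm_deriv_le_of_forall_mem_sphere_norm_le (by positivity) ?_ ?_
    · exact (hd.mono (hball w (R / 8) (by positivity) (by linarith))).diffContOnCl_ball subset_rfl
    · intro v hv
      exact hb v (by linarith [hsph w v _ hv])
  have h2 : ∀ w ∈ Metric.closedBall (0 : ℂ) (R / 16),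
      ‖deriv (deriv h) w‖ ≤ (2 * M / (R / 8)) / (R / 16) := by
    intro w hw
    have hw : ‖w‖ ≤ R / 16 := by simpa using hw
    refine norm_deriv_le_of_forall_mem_sphere_norm_le (by positivity) ?_ ?_
    · exact (hd2.mono (hball w (R / 16) (by positivity) (by linarith))).diffContOnCl_ball subset_rfl
    · intro v hv
      exact h1 v (by linarith [hsph w v _ hv])
  have h3 := Convex.norm_image_sub_le_of_norm_deriv_le (f := deriv h) (𝕜 := ℂ)
    (s := Metric.closedBall 0 (R / 16)) (x := 0) (y := z)
    (fun w hw => (hd2 w (by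
      have : ‖w‖ ≤ R / 16 := by simpa using hw
      simp only [Metric.mem_ball, dist_zero_right]; linarith)).differentiableAt
        (Metric.isOpen_ball.mem_nhds (by
      have : ‖w‖ ≤ R / 16 := by simpa using hw
      simp only [Metric.mem_ball, dist_zero_right]; linarith)))
    h2 (convex_closedBall _ _) (by simp; positivity) (by simpa using hz)
  rw [h0, sub_zero, sub_zero] at h3
  refine h3.trans (le_of_eq ?_)
  field_simp
  ring

/-- The local expansion is applied on the disc of radius 2R. Evenness kills the value at 0 both of
f'/f and of the sum over zeros, so the remainder h' vanishes at 0 and is O(R^{−1/2}) at fixed z. The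
series need not converge absolutely; the truncations |ρ| ≤ R are symmetric. -/
theorem tendsto_sum_zeros_of_ne_zero {f : ℂ → ℂ} (hf : Differentiable ℂ f)
    (heven : ∀ z, f (-z) = f z) (h0 : f 0 ≠ 0) {C : ℝ}
    (hC : ∀ z, 1 ≤ ‖z‖ → ‖f z‖ ≤ Real.exp (C * ‖z‖ ^ (3 / 2 : ℝ)))
    {S : ℝ → Finset ℂ} (hS : ∀ R ρ, ρ ∈ S R ↔ f ρ = 0 ∧ ‖ρ‖ ≤ R) {z : ℂ} (hz : f z ≠ 0) :
    Tendsto (fun R : ℝ => ∑ ρ ∈ S R, analyticOrderNatAt f ρ * (z - ρ)⁻¹) atTop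
      (𝓝 (logDeriv f z)) := by
  set M : ℝ → ℝ := fun R => |C| * (2 * R) ^ (3 / 2 : ℝ) + (|Real.log ‖f 0‖| + 1) with hMdef
  have hlim : Tendsto (fun R : ℝ => 256 * M R / (2 * R) ^ 2 * ‖z‖) atTop (𝓝 0) := by
    have h2R : Tendsto (fun R : ℝ => 2 * R) atTop atTop :=
      tendsto_id.const_mul_atTop (by norm_num)
    have h1 : Tendsto (fun x : ℝ => x ^ (-(1 / 2) : ℝ)) atTop (𝓝 0) :=
      tendsto_rpow_neg_atTop (by norm_num)
    have h2 : Tendsto (fun x : ℝ => x ^ (-(2) : ℝ)) atTop (𝓝 0) :=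
      tendsto_rpow_neg_atTop (by norm_num)
    have h3 := ((((h1.const_mul |C|).add (h2.const_mul (|Real.log ‖f 0‖| + 1))).const_mul
      256).mul_const ‖z‖).comp h2R
    simp only [mul_zero, add_zero, zero_mul] at h3
    refine h3.congr' ?_
    filter_upwards [eventually_gt_atTop 0] with R hR
    have hx : 0 < 2 * R := by positivity
    simp only [Function.comp_apply, hMdef]
    have e1 : (2 * R) ^ (-(1 / 2) : ℝ) = (2 * R) ^ (3 / 2 : ℝ) / (2 * R) ^ 2 := by
      rw [← Real.rpow_natCast, ← Real.rpow_sub hx]; norm_num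
    have e2 : (2 * R) ^ (-(2) : ℝ) = 1 / (2 * R) ^ 2 := by
      rw [Real.rpow_neg hx.le]; norm_num
    rw [e1, e2]; ring
  rw [tendsto_iff_norm_sub_tendsto_zero]
  refine squeeze_zero' (Eventually.of_forall fun _ => norm_nonneg _) ?_ hlim
  filter_upwards [eventually_ge_atTop (8 * ‖z‖ + 1)] with R hR
  have hzn := norm_nonneg z
  have hR1 : 1 ≤ R := by linarith
  have hMpos : 0 < M R := by positivity
  obtain ⟨h, hd, hb, heq⟩ := exists_logDeriv_eq_sum_add_deriv hf h0 (R := 2 * R) (M := M R)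
    (by positivity) hMpos (by
      intro w hw
      have hw' : ‖w‖ = 2 * R := by simpa using hw
      refine (hC w (by linarith)).trans ?_
      rw [hw']
      have h5 : ‖f 0‖ = Real.exp (Real.log ‖f 0‖) := (Real.exp_log (norm_pos_iff.mpr h0)).symm
      rw [h5, ← Real.exp_add, Real.exp_le_exp, hMdef]
      have h6 : C * (2 * R) ^ (3 / 2 : ℝ) ≤ |C| * (2 * R) ^ (3 / 2 : ℝ) := by
        gcongr; exact le_abs_self C
      have h7 := neg_abs_le (Real.log ‖f 0‖)
      linarith) (S := S R) (by
      intro ρ; rw [hS, mul_div_cancel_left₀ R two_ne_zero])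
  -- The terms of ρ and −ρ cancel, the multiplicities being equal.
  have hsum0 : ∑ ρ ∈ S R, analyticOrderNatAt f ρ * (0 - ρ)⁻¹ = 0 := by
    have hneg : ∑ ρ ∈ S R, (analyticOrderNatAt f ρ : ℂ) * (0 - ρ)⁻¹ =
        ∑ ρ ∈ S R, -((analyticOrderNatAt f ρ : ℂ) * (0 - ρ)⁻¹) := by
      refine Finset.sum_nbij' (fun ρ => -ρ) (fun ρ => -ρ) ?_ ?_ ?_ ?_ ?_
      · intro ρ hρ; rw [hS] at hρ ⊢; simpa [heven] using hρ
      · intro ρ hρ; rw [hS] at hρ ⊢; simpa [heven] using hρ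
      · simp
      · simp
      · intro ρ _
        rw [analyticOrderNatAt_neg_of_even heven]
        simp
    rw [Finset.sum_neg_distrib] at hneg
    linear_combination hneg / 2
  have hd0 : deriv h 0 = 0 := by
    have := heq 0 (by simp; positivity) h0
    rw [hsum0, logDeriv_apply, deriv_zero_of_even heven] at this
    simpa using this.symm
  rw [heq z (by linarith) hz, norm_sub_rev, add_sub_cancel_left]
  exact norm_deriv_le_of_bounded_of_deriv_zero (by positivity) hd hb hd0 (by linarith)

/-- The partial fraction expansion of `f'/f` for an even entire function of order at most
`3/2`. -/
theorem tendsto_sum_zeros {f : ℂ → ℂ} (hf : Differentiable ℂ f)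
    (heven : ∀ z, f (-z) = f z) {C : ℝ}
    (hC : ∀ z, 1 ≤ ‖z‖ → ‖f z‖ ≤ Real.exp (C * ‖z‖ ^ (3 / 2 : ℝ)))
    {S : ℝ → Finset ℂ} (hS : ∀ R ρ, ρ ∈ S R ↔ f ρ = 0 ∧ ‖ρ‖ ≤ R) {z : ℂ} (hz : f z ≠ 0) :
    Tendsto (fun R : ℝ => ∑ ρ ∈ S R, analyticOrderNatAt f ρ * (z - ρ)⁻¹) atTop
      (𝓝 (logDeriv f z)) := by
  classical
  -- For ξ this case would mean ζ(1/2) = 0. Instead of excluding it, the zero at the origin is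
  -- divided out.
  by_cases h0 : f 0 = 0
  swap
  · exact tendsto_sum_zeros_of_ne_zero hf heven h0 hC hS hz
  have hz0 : z ≠ 0 := fun h => hz (h ▸ h0)
  have htop : analyticOrderAt f 0 ≠ ⊤ := by
    refine AnalyticOnNhd.analyticOrderAt_ne_top_of_isPreconnected (x := z) (U := Set.univ)
      (fun z _ => hf.analyticAt z) isPreconnected_univ (Set.mem_univ _) (Set.mem_univ _) ?_
    rw [(hf.analyticAt z).analyticOrderAt_eq_zero.mpr hz]
    simp
  obtain ⟨g, hg, hg0, hfg⟩ := exists_entire_eq_pow_mul hf htop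
  set m := analyticOrderNatAt f 0 with hm
  simp only [sub_zero] at hfg
  have hne : ∀ w : ℂ, w ≠ 0 → (f w = 0 ↔ g w = 0) := by
    intro w hw
    rw [hfg, mul_eq_zero]
    simp [hw]
  have hgeven' : (fun w => (-1) ^ m * g (-w)) = g := by
    refine Continuous.ext_on (dense_compl_singleton (0 : ℂ))
      (continuous_const.mul (hg.continuous.comp continuous_neg)) hg.continuous ?_
    intro w hw
    have h1 := heven w
    rw [hfg, hfg, neg_pow] at h1
    have h2 : w ^ m ≠ 0 := pow_ne_zero _ hw
    refine mul_left_cancel₀ h2 ?_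
    rw [← h1]; ring
  -- Evaluating (−1)^m g(−w) = g(w) at 0, where g does not vanish, forces m to be even; hence g is
  -- even too.
  have hsign : ((-1) ^ m : ℂ) = 1 := by
    have h1 := congrFun hgeven' 0
    simp only [neg_zero] at h1
    exact mul_right_cancel₀ hg0 (h1.trans (one_mul _).symm)
  have hgeven : ∀ w, g (-w) = g w := by
    intro w
    have := congrFun hgeven' w
    simpa only [hsign, one_mul] using this
  have hord : ∀ ρ : ℂ, ρ ≠ 0 → analyticOrderNatAt f ρ = analyticOrderNatAt g ρ := by
    intro ρ hρ
    have e : f = (fun w => w ^ m) * g := funext hfg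
    have hP : AnalyticAt ℂ (fun w : ℂ => w ^ m) ρ := by fun_prop
    rw [analyticOrderNatAt, analyticOrderNatAt]
    conv_lhs => rw [e]
    rw [analyticOrderAt_mul hP (hg.analyticAt ρ),
      hP.analyticOrderAt_eq_zero.mpr (pow_ne_zero _ hρ), zero_add]
  have hgz : g z ≠ 0 := fun h => hz ((hne z hz0).mpr h)
  have key := tendsto_sum_zeros_of_ne_zero hg hgeven hg0 (C := C) (by
    intro w hw
    refine le_trans ?_ (hC w hw)
    rw [hfg, norm_mul, norm_pow]
    exact le_mul_of_one_le_left (norm_nonneg _) (one_le_pow₀ hw))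
    (S := fun R => (S R).erase 0) (by
      intro R ρ
      rw [Finset.mem_erase, hS]
      constructor
      · rintro ⟨h1, h2, h3⟩
        exact ⟨(hne ρ h1).mp h2, h3⟩
      · rintro ⟨h1, h2⟩
        have h3 : ρ ≠ 0 := fun h => hg0 (h ▸ h1)
        exact ⟨h3, (hne ρ h3).mpr h1, h2⟩) hgz
  have hlog : logDeriv f z = m * (z - 0)⁻¹ + logDeriv g z := by
    have e : f = fun w => w ^ m * g w := funext hfg
    rw [e, logDeriv_mul (f := fun w => w ^ m) z (pow_ne_zero _ hz0) hgz (by fun_prop) (hg z), logDeriv_fun_pow (by fun_prop)]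
    simp [logDeriv_apply]
  rw [hlog]
  refine (tendsto_const_nhds.add key).congr' ?_
  filter_upwards [eventually_ge_atTop 0] with R hR
  have hmem : (0 : ℂ) ∈ S R := (hS R 0).mpr ⟨h0, by simpa using hR⟩
  rw [← Finset.add_sum_erase _ _ hmem, ← hm]
  congr 1
  refine Finset.sum_congr rfl fun ρ hρ => ?_
  rw [hord ρ (Finset.ne_of_mem_erase hρ)]

/-! ### The function ξ: growth, zeros and multiplicities -/

theorem norm_Gamma_le_Gamma_re {s : ℂ} (hs : 0 < s.re) : ‖Gamma s‖ ≤ Real.Gamma s.re := by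
  rw [Gamma_eq_integral hs, Real.Gamma_eq_integral hs, GammaIntegral]
  refine norm_integral_le_of_norm_le (Real.GammaIntegral_convergent hs) ?_
  filter_upwards [ae_restrict_mem measurableSet_Ioi] with x hx
  rw [norm_mul, norm_cpow_eq_rpow_re_of_pos hx]
  simp [norm_exp]

/-- Γ(x) ≤ n! ≤ n^n with n = ⌈x⌉, and log y ≤ 2y^{1/2}. Any exponent below 2 in place of 3/2 would
serve the partial fraction expansion. -/
theorem Gamma_le_exp {x : ℝ} (hx : 1 ≤ x) :
    Real.Gamma x ≤ Real.exp (2 * (x + 1) ^ (3 / 2 : ℝ)) := by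
  have h1 : Real.Gamma x ≤ Real.Gamma (x + 1) := by
    rw [Real.Gamma_add_one (by positivity)]
    exact le_mul_of_one_le_left (Real.Gamma_pos_of_pos (by positivity)).le hx
  set n := ⌈x⌉₊ with hn
  have hxn : x ≤ n := Nat.le_ceil x
  have hnx : (n : ℝ) ≤ x + 1 := (Nat.ceil_lt_add_one (by positivity)).le
  have h2 : Real.Gamma (x + 1) ≤ Real.Gamma (n + 1) :=
    Real.Gamma_strictMonoOn_Ici.monotoneOn (by simp; linarith) (by simp; linarith) (by linarith)
  rw [Real.Gamma_nat_eq_factorial] at h2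
  have h3 : (n.factorial : ℝ) ≤ (n : ℝ) ^ n := by exact_mod_cast Nat.factorial_le_pow n
  have h4 : (n : ℝ) ^ n ≤ Real.exp (2 * (x + 1) ^ (3 / 2 : ℝ)) := by
    calc (n : ℝ) ^ n ≤ (x + 1) ^ n := by gcongr
      _ = (x + 1) ^ (n : ℝ) := (Real.rpow_natCast _ _).symm
      _ ≤ (x + 1) ^ (x + 1) := Real.rpow_le_rpow_of_exponent_le (by linarith) hnx
      _ = Real.exp (Real.log (x + 1) * (x + 1)) := Real.rpow_def_of_pos (by linarith) _
      _ ≤ _ := by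
        rw [Real.exp_le_exp]
        have h5 := Real.log_le_rpow_div (x := x + 1) (by linarith) (ε := 1 / 2) (by norm_num)
        have h6 : (x + 1) ^ (3 / 2 : ℝ) = (x + 1) ^ (1 / 2 : ℝ) * (x + 1) := by
          rw [← Real.rpow_add_one (by linarith)]; norm_num
        rw [h6]
        have : 0 < x + 1 := by linarith
        calc _ ≤ (x + 1) ^ (1 / 2 : ℝ) / (1 / 2) * (x + 1) := by gcongr
          _ = _ := by ring
  linarith

/-- The function is a Mellin transform convergent for every s. The modulus of its integrand depends
only on Re s, and a power of t is dominated by the sum of the two powers at the ends of the strip.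
-/
theorem exists_norm_completedRiemannZeta₀_le_of_re_mem_Icc (a b : ℝ) :
    ∃ B, ∀ s : ℂ, a ≤ s.re → s.re ≤ b → ‖completedRiemannZeta₀ s‖ ≤ B := by
  set P := HurwitzZeta.hurwitzEvenFEPair 0
  have hconv : ∀ s : ℂ, MellinConvergent P.f_modif s := fun s =>
    (P.isStrongFEPair_toStrongFEPair.hasMellin s).1
  have hInt : ∀ σ : ℝ, IntegrableOn (fun t : ℝ => t ^ (σ - 1) * ‖P.f_modif t‖) (Set.Ioi 0) := by
    intro σ
    refine (hconv σ).norm.congr ?_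
    filter_upwards [ae_restrict_mem measurableSet_Ioi] with t ht
    rw [norm_smul, norm_cpow_eq_rpow_re_of_pos ht]
    simp
  refine ⟨(∫ t in Set.Ioi (0 : ℝ), (t ^ (a / 2 - 1) * ‖P.f_modif t‖ +
    t ^ (b / 2 - 1) * ‖P.f_modif t‖)) / 2, fun s ha hb => ?_⟩
  have e : completedRiemannZeta₀ s = mellin P.f_modif (s / 2) / 2 := rfl
  rw [e, norm_div, norm_ofNat, mellin]
  gcongr
  refine norm_integral_le_of_norm_le ((hInt (a / 2)).add (hInt (b / 2))) ?_
  filter_upwards [ae_restrict_mem measurableSet_Ioi] with t ht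
  have ht : 0 < t := ht
  rw [norm_smul, norm_cpow_eq_rpow_re_of_pos ht, ← add_mul]
  gcongr
  have e2 : (s / 2 - 1).re = s.re / 2 - 1 := by simp
  rw [e2]
  rcases le_total t 1 with h | h
  · have := Real.rpow_le_rpow_of_exponent_ge ht h (show a / 2 - 1 ≤ s.re / 2 - 1 by linarith)
    have := Real.rpow_nonneg ht.le (b / 2 - 1)
    linarith
  · have := Real.rpow_le_rpow_of_exponent_le h (show s.re / 2 - 1 ≤ b / 2 - 1 by linarith)
    have := Real.rpow_nonneg ht.le (a / 2 - 1)
    linarith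

/-- The Riemann xi-function, up to normalisation, as an even function centred at `1/2`. -/
def xi (z : ℂ) : ℂ := 1 - (1 / 2 + z) * (1 / 2 - z) * completedRiemannZeta₀ (1 / 2 + z)

theorem xi_neg (z : ℂ) : xi (-z) = xi z := by
  have h := completedRiemannZeta₀_one_sub (1 / 2 + z)
  rw [show (1 : ℂ) - (1 / 2 + z) = 1 / 2 + -z by ring] at h
  rw [xi, xi, h]
  ring

theorem differentiable_xi : Differentiable ℂ xi := by
  have h : Differentiable ℂ fun z : ℂ => completedRiemannZeta₀ (1 / 2 + z) :=
    differentiable_completedZeta₀.comp (by fun_prop)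
  unfold xi
  fun_prop

/-- For 1/2 ≤ Re s ≤ 2 the Mellin bound applies; for Re s ≥ 2 the Dirichlet series is bounded and
Γ(s/2) carries all the growth. The functional equation covers the other half-plane. -/
theorem exists_norm_completedRiemannZeta₀_le_exp :
    ∃ B, 0 ≤ B ∧ ∀ s : ℂ, 1 / 2 ≤ s.re →
      ‖completedRiemannZeta₀ s‖ ≤ B * Real.exp (2 * (s.re / 2 + 1) ^ (3 / 2 : ℝ)) := by
  obtain ⟨B₁, hB₁⟩ := exists_norm_completedRiemannZeta₀_le_of_re_mem_Icc (1 / 2) 2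
  set Z : ℝ := ∑' n : ℕ, 1 / (n : ℝ) ^ (2 : ℝ) with hZ
  have hZs : Summable fun n : ℕ => 1 / (n : ℝ) ^ (2 : ℝ) :=
    Real.summable_one_div_nat_rpow.mpr (by norm_num)
  have hZ0 : 0 ≤ Z := tsum_nonneg fun n => by positivity
  refine ⟨max B₁ 0 + Z + 2, by positivity, fun s hs => ?_⟩
  have hexp : 1 ≤ Real.exp (2 * (s.re / 2 + 1) ^ (3 / 2 : ℝ)) := by
    rw [Real.one_le_exp_iff]
    have : 0 ≤ s.re / 2 + 1 := by linarith
    positivity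
  rcases le_total s.re 2 with h2 | h2
  · have h3 := (hB₁ s hs h2).trans (le_max_left B₁ 0)
    have : 0 ≤ max B₁ 0 := le_max_right _ _
    nlinarith
  · have e := completedRiemannZeta_eq s
    have h3 : completedRiemannZeta₀ s = completedRiemannZeta s + 1 / s + 1 / (1 - s) := by
      rw [e]; ring
    have h4 : ‖1 / s‖ ≤ 1 := by
      rw [norm_div, norm_one]
      have := re_le_norm s
      exact div_le_one_of_le₀ (by linarith) (norm_nonneg _)
    have h5 : ‖1 / (1 - s)‖ ≤ 1 := by
      rw [norm_div, norm_one, norm_sub_rev]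
      have := re_le_norm (s - 1)
      simp only [sub_re, one_re] at this
      exact div_le_one_of_le₀ (by linarith) (norm_nonneg _)
    have h6 : ‖completedRiemannZeta s‖ ≤ Z * Real.exp (2 * (s.re / 2 + 1) ^ (3 / 2 : ℝ)) := by
      rw [completedZeta_eq_tsum_of_one_lt_re (by linarith), norm_mul, norm_mul, mul_comm Z]
      have h7 : ‖(Real.pi : ℂ) ^ (-s / 2)‖ ≤ 1 := by
        rw [norm_cpow_eq_rpow_re_of_pos Real.pi_pos]
        refine Real.rpow_le_one_of_one_le_of_nonpos (by linarith [Real.pi_gt_three]) ?_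
        simp
        linarith
      have h8 : ‖Gamma (s / 2)‖ ≤ Real.exp (2 * (s.re / 2 + 1) ^ (3 / 2 : ℝ)) := by
        have e2 : (s / 2).re = s.re / 2 := by simp
        have := norm_Gamma_le_Gamma_re (s := s / 2) (by rw [e2]; linarith)
        rw [e2] at this
        exact this.trans (Gamma_le_exp (by linarith))
      have h9 : ‖∑' n : ℕ, 1 / (n : ℂ) ^ s‖ ≤ Z := by
        refine tsum_of_norm_bounded hZs.hasSum fun n => ?_
        rcases Nat.eq_zero_or_pos n with rfl | hn
        · rw [Nat.cast_zero, zero_cpow (ne_zero_of_one_lt_re (by linarith))]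
          simp
        · rw [norm_div, norm_one, norm_natCast_cpow_of_pos hn]
          have : (1 : ℝ) ≤ n := by exact_mod_cast hn
          gcongr
      calc _ ≤ 1 * Real.exp (2 * (s.re / 2 + 1) ^ (3 / 2 : ℝ)) * Z := by gcongr
        _ = _ := by ring
    rw [h3]
    have h10 := norm_add₃_le (a := completedRiemannZeta s) (b := 1 / s) (c := 1 / (1 - s))
    have : 0 ≤ max B₁ 0 := le_max_right _ _
    nlinarith

theorem exists_norm_xi_le :
    ∃ C, ∀ z : ℂ, 1 ≤ ‖z‖ → ‖xi z‖ ≤ Real.exp (C * ‖z‖ ^ (3 / 2 : ℝ)) := by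
  obtain ⟨B, hB0, hB⟩ := exists_norm_completedRiemannZeta₀_le_exp
  -- In the constant, 8 comes from the Gamma factor and 2 from bounding r² by exp(2 r^{3/2}).
  have key : ∀ z : ℂ, 1 ≤ ‖z‖ → 0 ≤ z.re →
      ‖xi z‖ ≤ Real.exp ((Real.log (1 + 4 * B) + 10) * ‖z‖ ^ (3 / 2 : ℝ)) := by
    intro z hz hre
    set r := ‖z‖ with hr
    have h1 := hB (1 / 2 + z) (by simpa using hre)
    have e1 : (1 / 2 + z).re = 1 / 2 + z.re := by simp
    have hzr : z.re ≤ r := re_le_norm z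
    have hrr : r ≤ r ^ (3 / 2 : ℝ) := by
      conv_lhs => rw [← Real.rpow_one r]
      exact Real.rpow_le_rpow_of_exponent_le hz (by norm_num)
    have h2 : 2 * ((1 / 2 + z).re / 2 + 1) ^ (3 / 2 : ℝ) ≤ 8 * r ^ (3 / 2 : ℝ) := by
      have : ((1 / 2 + z).re / 2 + 1) ^ (3 / 2 : ℝ) ≤ (2 * r) ^ (3 / 2 : ℝ) := by
        rw [e1]
        refine Real.rpow_le_rpow (by linarith) (by linarith) (by norm_num)
      rw [Real.mul_rpow (by norm_num) (by positivity)] at this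
      have h3 : (2 : ℝ) ^ (3 / 2 : ℝ) ≤ 2 ^ (2 : ℝ) :=
        Real.rpow_le_rpow_of_exponent_le (by norm_num) (by norm_num)
      have h4 : (2 : ℝ) ^ (2 : ℝ) = 4 := by norm_num
      have h5 : (0 : ℝ) ≤ r ^ (3 / 2 : ℝ) := by positivity
      nlinarith
    have h3 : ‖xi z‖ ≤ 1 + (r + 1) * (r + 1) * (B * Real.exp (8 * r ^ (3 / 2 : ℝ))) := by
      rw [xi]
      refine (norm_sub_le _ _).trans ?_
      rw [norm_one, norm_mul, norm_mul]
      have n1 : ‖1 / 2 + z‖ ≤ r + 1 := by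
        refine (norm_add_le _ _).trans ?_
        norm_num; linarith
      have n2 : ‖1 / 2 - z‖ ≤ r + 1 := by
        refine (norm_sub_le _ _).trans ?_
        norm_num; linarith
      have n3 : ‖completedRiemannZeta₀ (1 / 2 + z)‖ ≤ B * Real.exp (8 * r ^ (3 / 2 : ℝ)) := by
        refine h1.trans ?_
        gcongr
      gcongr
    have hE : 1 ≤ Real.exp (8 * r ^ (3 / 2 : ℝ)) := Real.one_le_exp (by positivity)
    have h4 : ‖xi z‖ ≤ (1 + 4 * B) * (r * r * Real.exp (8 * r ^ (3 / 2 : ℝ))) := by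
      refine h3.trans ?_
      have a1 : (r + 1) * (r + 1) ≤ 4 * (r * r) := by nlinarith
      have a2 : 1 ≤ r * r * Real.exp (8 * r ^ (3 / 2 : ℝ)) := by nlinarith
      have a3 : 0 ≤ B * Real.exp (8 * r ^ (3 / 2 : ℝ)) := by positivity
      nlinarith [mul_le_mul_of_nonneg_right a1 a3]
    refine h4.trans ?_
    have h5 : r ≤ Real.exp (r ^ (3 / 2 : ℝ)) := hrr.trans (by linarith [Real.add_one_le_exp (r ^ (3 / 2 : ℝ))])
    have h6 : 1 + 4 * B ≤ Real.exp (Real.log (1 + 4 * B) * r ^ (3 / 2 : ℝ)) := by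
      conv_lhs => rw [← Real.exp_log (show 0 < 1 + 4 * B by positivity)]
      rw [Real.exp_le_exp]
      exact le_mul_of_one_le_right (Real.log_nonneg (by linarith)) (hz.trans hrr)
    calc _ ≤ Real.exp (Real.log (1 + 4 * B) * r ^ (3 / 2 : ℝ)) * (Real.exp (r ^ (3 / 2 : ℝ)) *
          Real.exp (r ^ (3 / 2 : ℝ)) * Real.exp (8 * r ^ (3 / 2 : ℝ))) := by gcongr
      _ = _ := by
        rw [← Real.exp_add, ← Real.exp_add, ← Real.exp_add]
        congr 1; ring
  refine ⟨Real.log (1 + 4 * B) + 10, fun z hz => ?_⟩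
  rcases le_total 0 z.re with h | h
  · exact key z hz h
  · have := key (-z) (by simpa using hz) (by simpa using h)
    rwa [xi_neg, norm_neg] at this

theorem xi_eq_mul_riemannZeta {z : ℂ} (hz : -(1 / 2) < z.re) (hz1 : z ≠ 1 / 2) :
    xi z = -(1 / 2 + z) * (1 / 2 - z) * Gammaℝ (1 / 2 + z) * riemannZeta (1 / 2 + z) := by
  have hre : 0 < (1 / 2 + z).re := by simp; linarith
  have hs0 : 1 / 2 + z ≠ 0 := fun h => by rw [h] at hre; simp at hre
  have hs1 : 1 / 2 - z ≠ 0 := sub_ne_zero.mpr hz1.symm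
  have hG : Gammaℝ (1 / 2 + z) ≠ 0 := Gammaℝ_ne_zero_of_re_pos hre
  rw [riemannZeta_def_of_ne_zero hs0, completedRiemannZeta_eq, xi,
    show (1 : ℂ) - (1 / 2 + z) = 1 / 2 - z by ring]
  generalize completedRiemannZeta₀ (1 / 2 + z) = L at *
  generalize Gammaℝ (1 / 2 + z) = G at *
  rw [mul_assoc _ G, mul_div_cancel₀ _ hG]
  have e : (1 : ℂ) / 2 + z + (1 / 2 - z) = 1 := by ring
  generalize (1 : ℂ) / 2 + z = u at *
  generalize (1 : ℂ) / 2 - z = v at *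
  field_simp
  linear_combination -e

theorem xi_one_half : xi (1 / 2) = 1 := by simp [xi]

theorem differentiableAt_Gammaℝ {s : ℂ} (hs : 0 < s.re) : DifferentiableAt ℂ Gammaℝ s := by
  have h1 : DifferentiableAt ℂ (fun s => (Gammaℝ s)⁻¹) s := differentiable_Gammaℝ_inv s
  have h2 := h1.inv (inv_ne_zero (Gammaℝ_ne_zero_of_re_pos hs))
  have e : (fun s => (Gammaℝ s)⁻¹)⁻¹ = Gammaℝ := by ext; simp
  rwa [e] at h2

theorem xi_eq_zero_iff {z : ℂ} (hz : -(1 / 2) < z.re) :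
    xi z = 0 ↔ riemannZeta (1 / 2 + z) = 0 := by
  have hre : 0 < (1 / 2 + z).re := by simp; linarith
  have hs0 : 1 / 2 + z ≠ 0 := fun h => by rw [h] at hre; simp at hre
  by_cases hz1 : z = 1 / 2
  · subst hz1
    rw [xi_one_half]
    norm_num
    -- At the pole s = 1 the value of `riemannZeta` is a convention, and it is nonzero, so the
    -- equivalence survives there.
    exact riemannZeta_one_ne_zero
  · rw [xi_eq_mul_riemannZeta hz hz1]
    simp [sub_ne_zero.mpr (Ne.symm hz1), Gammaℝ_ne_zero_of_re_pos hre, -one_div]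
    intro h
    exact absurd h (by
      intro h
      apply hs0
      linear_combination -h)

theorem re_eq_zero_of_xi_eq_zero (hRH : RiemannHypothesis) {z : ℂ} (hz : xi z = 0) : z.re = 0 := by
  have key : ∀ w : ℂ, 0 ≤ w.re → xi w = 0 → w.re = 0 := by
    intro w hw h
    have h1 := (xi_eq_zero_iff (by linarith)).mp h
    have h2 := hRH (1 / 2 + w) h1 (by
      rintro ⟨n, hn⟩
      have := congrArg re hn
      simp at this
      have : (0 : ℝ) ≤ n := Nat.cast_nonneg n
      linarith) (by
      intro h3
      have : w = 1 / 2 := by linear_combination h3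
      rw [this, xi_one_half] at h
      exact one_ne_zero h)
    simpa using h2
  rcases le_total 0 z.re with h | h
  · exact key z h hz
  · have := key (-z) (by simpa using h) (by rwa [xi_neg])
    simpa using this

/-- Near the critical line the factor relating ξ to ζ is analytic and nonvanishing, so
multiplicities agree. -/
theorem analyticOrderNatAt_xi (γ : ℝ) :
    analyticOrderNatAt xi (γ * I) = analyticOrderNatAt riemannZeta (1 / 2 + γ * I) := by
  have hre : (γ * I : ℂ).re = 0 := by simp
  have hev : xi =ᶠ[𝓝 (γ * I : ℂ)] (fun z => -(1 / 2 + z) * (1 / 2 - z) * Gammaℝ (1 / 2 + z)) *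
      (riemannZeta ∘ fun z => 1 / 2 + z) := by
    have : {z : ℂ | -(1 / 2) < z.re ∧ z.re < 1 / 2} ∈ 𝓝 (γ * I : ℂ) := by
      refine IsOpen.mem_nhds ?_ ⟨by rw [hre]; norm_num, by rw [hre]; norm_num⟩
      exact (isOpen_lt continuous_const continuous_re).inter
        (isOpen_lt continuous_re continuous_const)
    filter_upwards [this] with z hz
    have : z ≠ 1 / 2 := by
      rintro rfl
      have := hz.2
      norm_num at this
    exact xi_eq_mul_riemannZeta hz.1 this
  have hs : 0 < (1 / 2 + γ * I : ℂ).re := by simp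
  have hA : AnalyticAt ℂ (fun z => -(1 / 2 + z) * (1 / 2 - z) * Gammaℝ (1 / 2 + z)) (γ * I : ℂ) := by
    have hd : DifferentiableOn ℂ (fun z => -(1 / 2 + z) * (1 / 2 - z) * Gammaℝ (1 / 2 + z))
        {z : ℂ | -(1 / 2) < z.re} := by
      intro z hz
      have : DifferentiableAt ℂ (fun z : ℂ => Gammaℝ (1 / 2 + z)) z :=
        DifferentiableAt.comp (g := Gammaℝ) (f := fun z : ℂ => 1 / 2 + z) z
          (differentiableAt_Gammaℝ (by simp; linarith [show -(1 / 2) < z.re from hz])) (by fun_prop)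
      exact (DifferentiableAt.mul (by fun_prop) this).differentiableWithinAt
    exact hd.analyticAt ((isOpen_lt continuous_const continuous_re).mem_nhds
      (by change -(1 / 2) < (γ * I : ℂ).re; rw [hre]; norm_num))
  have hA0 : -(1 / 2 + γ * I) * (1 / 2 - γ * I) * Gammaℝ (1 / 2 + γ * I : ℂ) ≠ 0 := by
    refine mul_ne_zero (mul_ne_zero (neg_ne_zero.mpr fun h => ?_) fun h => ?_)
      (Gammaℝ_ne_zero_of_re_pos hs)
    · have := congrArg re h; simp at this
    · have := congrArg re h; simp at this
  have hne1 : (1 / 2 + γ * I : ℂ) ≠ 1 := by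
    intro h
    have := congrArg re h
    norm_num at this
  have hZ : AnalyticAt ℂ riemannZeta (1 / 2 + γ * I) := analyticOn_riemannZeta _ hne1
  have hZ' : AnalyticAt ℂ (riemannZeta ∘ fun z => 1 / 2 + z) (γ * I : ℂ) :=
    AnalyticAt.comp (g := riemannZeta) hZ (by fun_prop)
  rw [analyticOrderNatAt, analyticOrderNatAt, analyticOrderAt_congr hev, analyticOrderAt_mul hA hZ',
    hA.analyticOrderAt_eq_zero.mpr hA0, zero_add,
    analyticOrderAt_comp_of_deriv_ne_zero (g := fun z : ℂ => 1 / 2 + z) (by fun_prop) (by simp)]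

/-! ### Sums over zeros and the Poisson formula for ξ'/ξ -/

theorem zeroIndexAbs_finite (R : ℝ) : {p : ℝ × ℕ | |p.1| ≤ R ∧ riemannZeta (1 / 2 + p.1 * I) = 0 ∧
    p.2 < analyticOrderNatAt riemannZeta (1 / 2 + p.1 * I)}.Finite := by
  have hc : Continuous fun t : ℝ => (1 / 2 + t * I : ℂ) := by fun_prop
  have hinj : Function.Injective fun t : ℝ => (1 / 2 + t * I : ℂ) := by
    intro s t h
    simpa using h
  have h1 : (((fun t : ℝ => (1 / 2 + t * I : ℂ)) '' Set.Icc (-R) R) ∩ riemannZetaZeros).Finite :=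
    (isCompact_Icc.image hc).inter_riemannZetaZeros_finite
  have h2 := h1.preimage (f := fun t : ℝ => (1 / 2 + t * I : ℂ)) hinj.injOn
  refine (h2.biUnion (t := fun γ : ℝ => (fun k : ℕ => (γ, k)) ''
    Set.Iio (analyticOrderNatAt riemannZeta (1 / 2 + γ * I)))
    fun γ _ => (Set.finite_Iio _).image _).subset ?_
  rintro ⟨γ, k⟩ ⟨h0, hz, hk⟩
  refine Set.mem_biUnion (x := γ) ⟨⟨γ, abs_le.mp h0, rfl⟩, ?_⟩ ⟨k, hk, rfl⟩
  simpa [riemannZetaZeros] using hz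

/-- Indices of the zeros `1/2 + iγ` of `ζ` with `|γ| ≤ R`, counted with multiplicity. -/
def zeroIndexAbs (R : ℝ) : Finset (ℝ × ℕ) := (zeroIndexAbs_finite R).toFinset

theorem mem_zeroIndexAbs {R : ℝ} {p : ℝ × ℕ} : p ∈ zeroIndexAbs R ↔ |p.1| ≤ R ∧
    riemannZeta (1 / 2 + p.1 * I) = 0 ∧
      p.2 < analyticOrderNatAt riemannZeta (1 / 2 + p.1 * I) := by
  simp [zeroIndexAbs]

theorem mem_zeroIndex {T : ℝ} {p : ℝ × ℕ} : p ∈ zeroIndex T ↔ 0 < p.1 ∧ p.1 < T ∧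
    riemannZeta (1 / 2 + p.1 * I) = 0 ∧
      p.2 < analyticOrderNatAt riemannZeta (1 / 2 + p.1 * I) := by
  simp [zeroIndex, zeroIndexSet]

theorem xi_ne_zero_of_re_pos (hRH : RiemannHypothesis) {z : ℂ} (hz : 0 < z.re) : xi z ≠ 0 :=
  fun h => hz.ne' (re_eq_zero_of_xi_eq_zero hRH h)

theorem analyticOrderAt_xi_ne_top (z : ℂ) : analyticOrderAt xi z ≠ ⊤ := by
  refine AnalyticOnNhd.analyticOrderAt_ne_top_of_isPreconnected (x := 1 / 2) (U := Set.univ)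
    (fun z _ => differentiable_xi.analyticAt z) isPreconnected_univ (Set.mem_univ _)
    (Set.mem_univ _) ?_
  rw [(differentiable_xi.analyticAt _).analyticOrderAt_eq_zero.mpr (by rw [xi_one_half]; exact one_ne_zero)]
  simp

/-- The fibre of (γ, k) ↦ iγ over a zero has as many elements as its order, so the weighted sum over
zeros becomes a plain sum over indices. RH makes every zero of the form iγ with γ real. -/
theorem tendsto_sum_zeroIndexAbs (hRH : RiemannHypothesis) {z : ℂ} (hz : 0 < z.re) :
    Tendsto (fun R : ℝ => ∑ p ∈ zeroIndexAbs R, (z - p.1 * I)⁻¹) atTop (𝓝 (logDeriv xi z)) := by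
  classical
  obtain ⟨C, hC⟩ := exists_norm_xi_le
  have hS : ∀ (R : ℝ) (ρ : ℂ), ρ ∈ (zeroIndexAbs R).image (fun p => (p.1 : ℂ) * I) ↔
      xi ρ = 0 ∧ ‖ρ‖ ≤ R := by
    intro R ρ
    rw [Finset.mem_image]
    constructor
    · rintro ⟨p, hp, rfl⟩
      rw [mem_zeroIndexAbs] at hp
      exact ⟨(xi_eq_zero_iff (by simp)).mpr hp.2.1, by simpa using hp.1⟩
    · rintro ⟨h1, h2⟩
      have hre := re_eq_zero_of_xi_eq_zero hRH h1
      have e : ρ = (ρ.im : ℂ) * I := by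
        apply Complex.ext <;> simp [hre]
      refine ⟨(ρ.im, 0), ?_, e.symm⟩
      rw [mem_zeroIndexAbs]
      refine ⟨(abs_im_le_norm ρ).trans h2, ?_, ?_⟩
      · rw [← e]; exact (xi_eq_zero_iff (by rw [hre]; norm_num)).mp h1
      · rw [← analyticOrderNatAt_xi, ← e]
        refine Nat.pos_of_ne_zero fun h => ?_
        rw [analyticOrderNatAt, ENat.toNat_eq_zero] at h
        rcases h with h | h
        · exact (differentiable_xi.analyticAt ρ).analyticOrderAt_eq_zero.mp h h1
        · exact analyticOrderAt_xi_ne_top ρ h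
  refine (tendsto_sum_zeros differentiable_xi xi_neg hC hS (xi_ne_zero_of_re_pos hRH hz)).congr
    fun R => ?_
  rw [Finset.sum_comp (fun ρ : ℂ => (z - ρ)⁻¹) (fun p : ℝ × ℕ => (p.1 : ℂ) * I)]
  refine Finset.sum_congr rfl fun ρ hρ => ?_
  rw [nsmul_eq_mul]
  congr 2
  obtain ⟨q, hq, rfl⟩ := Finset.mem_image.mp hρ
  have hq' := mem_zeroIndexAbs.mp hq
  have : {p ∈ zeroIndexAbs R | (p.1 : ℂ) * I = q.1 * I} =
      (Finset.range (analyticOrderNatAt xi (q.1 * I))).image fun k => (q.1, k) := by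
    ext ⟨γ, k⟩
    simp only [Finset.mem_filter, mem_zeroIndexAbs, Finset.mem_image, Finset.mem_range,
      analyticOrderNatAt_xi, Prod.mk.injEq]
    constructor
    · rintro ⟨⟨h1, h2, h3⟩, h4⟩
      have : γ = q.1 := by simpa using h4
      subst this
      exact ⟨k, h3, rfl, rfl⟩
    · rintro ⟨k', h1, rfl, rfl⟩
      exact ⟨⟨hq'.1, hq'.2.1, h1⟩, rfl⟩
  rw [this, Finset.card_image_of_injective _ (fun a b h => by simpa using h), Finset.card_range]

/-- The Poisson kernel of the half-plane, normalised to have total mass `π`. -/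
def poisson (x d : ℝ) : ℝ := x / (x ^ 2 + d ^ 2)

theorem poisson_nonneg {x : ℝ} (hx : 0 ≤ x) (d : ℝ) : 0 ≤ poisson x d := by
  unfold poisson; positivity

theorem re_inv_sub_mul_I (x y γ : ℝ) :
    ((x + y * I - γ * I : ℂ)⁻¹).re = poisson x (y - γ) := by
  simp [poisson, inv_re, normSq_apply, sq]

theorem tendsto_sum_poisson (hRH : RiemannHypothesis) {x : ℝ} (hx : 0 < x) (y : ℝ) :
    Tendsto (fun R : ℝ => ∑ p ∈ zeroIndexAbs R, poisson x (y - p.1)) atTop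
      (𝓝 (logDeriv xi (x + y * I)).re) := by
  have h := (continuous_re.tendsto _).comp
    (tendsto_sum_zeroIndexAbs hRH (z := x + y * I) (by simpa using hx))
  refine h.congr fun R => ?_
  simp only [Function.comp_apply, re_sum]
  exact Finset.sum_congr rfl fun p _ => re_inv_sub_mul_I x y p.1

/-- The real parts are nonnegative, so any finite set of genuine zero indices contributes at most
the full limit. -/
theorem sum_poisson_le (hRH : RiemannHypothesis) {x : ℝ} (hx : 0 < x) (y : ℝ)
    (Q : Finset (ℝ × ℕ)) (hQ : ∀ p ∈ Q, p ∈ zeroIndexAbs |p.1|) :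
    ∑ p ∈ Q, poisson x (y - p.1) ≤ (logDeriv xi (x + y * I)).re := by
  refine ge_of_tendsto (tendsto_sum_poisson hRH hx y) ?_
  obtain ⟨R₀, hR₀⟩ := (Q.image fun p => |p.1|).bddAbove
  filter_upwards [eventually_ge_atTop R₀] with R hR
  refine Finset.sum_le_sum_of_subset_of_nonneg (fun p hp => ?_)
    fun p _ _ => poisson_nonneg hx.le _
  have h1 := mem_zeroIndexAbs.mp (hQ p hp)
  have h2 : |p.1| ≤ R₀ := hR₀ (Finset.mem_coe.mpr (Finset.mem_image_of_mem (fun p : ℝ × ℕ => |p.1|) hp))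
  exact mem_zeroIndexAbs.mpr ⟨h2.trans hR, h1.2⟩

theorem mem_zeroIndexAbs_of_mem_zeroIndex {T : ℝ} {p : ℝ × ℕ} (hp : p ∈ zeroIndex T) :
    p ∈ zeroIndexAbs |p.1| :=
  mem_zeroIndexAbs.mpr ⟨le_rfl, (mem_zeroIndex.mp hp).2.2⟩

/-- The omitted zeros lie at distance d ≥ 1 from y, and for such d the kernel of width x is at most
3x times the kernel of width 5/2. Hence the tail is controlled by ξ'/ξ on the line Re s = 3. -/
theorem re_logDeriv_xi_sub_sum_le (hRH : RiemannHypothesis) {x y T : ℝ} (hx : 0 < x) (hy : 1 ≤ y)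
    (hyT : y ≤ T - 1) :
    (logDeriv xi (x + y * I)).re - ∑ p ∈ zeroIndex T, poisson x (y - p.1) ≤
      3 * x * (logDeriv xi ((5 / 2 : ℝ) + y * I)).re := by
  classical
  refine le_of_tendsto ((tendsto_sum_poisson hRH hx y).sub_const _) ?_
  filter_upwards [eventually_ge_atTop T] with R hR
  have hsub : zeroIndex T ⊆ zeroIndexAbs R := by
    intro p hp
    have h := mem_zeroIndex.mp hp
    refine mem_zeroIndexAbs.mpr ⟨?_, h.2.2⟩
    rw [abs_of_pos h.1]
    linarith [h.2.1]
  rw [← Finset.sum_sdiff hsub, add_sub_cancel_right]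
  calc ∑ p ∈ zeroIndexAbs R \ zeroIndex T, poisson x (y - p.1)
      ≤ ∑ p ∈ zeroIndexAbs R \ zeroIndex T, 3 * x * poisson (5 / 2) (y - p.1) := by
        refine Finset.sum_le_sum fun p hp => ?_
        rw [Finset.mem_sdiff] at hp
        have h1 := mem_zeroIndexAbs.mp hp.1
        have h2 : p.1 ≤ 0 ∨ T ≤ p.1 := by
          by_contra h
          push Not at h
          exact hp.2 (mem_zeroIndex.mpr ⟨h.1, h.2, h1.2⟩)
        have h3 : 1 ≤ (y - p.1) ^ 2 := by
          rcases h2 with h | h <;> nlinarith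
        unfold poisson
        rw [← mul_div_assoc, div_le_div_iff₀ (by positivity) (by positivity)]
        nlinarith [mul_pos hx hx, mul_nonneg hx.le (sq_nonneg x)]
    _ = 3 * x * ∑ p ∈ zeroIndexAbs R \ zeroIndex T, poisson (5 / 2) (y - p.1) :=
        (Finset.mul_sum _ _ _).symm
    _ ≤ _ := by
        gcongr
        refine sum_poisson_le hRH (by norm_num) y _ fun p hp => ?_
        exact mem_zeroIndexAbs.mpr ⟨le_rfl, (mem_zeroIndexAbs.mp (Finset.mem_sdiff.mp hp).1).2⟩

/-- With ρ = iγ, z = x + iy and z₀ = x₀ + iy, the terms differ by (x₀ − x)/(|z − ρ||z₀ − ρ|), and |z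
− ρ| ≥ (x/x₀)|z₀ − ρ|. So each difference is at most a multiple of the Poisson kernel of width x₀,
and these sum to a real part. -/
theorem norm_logDeriv_xi_sub_le (hRH : RiemannHypothesis) {x x₀ : ℝ} (hx : 0 < x) (hxx : x ≤ x₀)
    (y : ℝ) : ‖logDeriv xi (x + y * I) - logDeriv xi (x₀ + y * I)‖ ≤
      (x₀ - x) / x * (logDeriv xi (x₀ + y * I)).re := by
  have hx0 : 0 < x₀ := hx.trans_le hxx
  have h1 := ((tendsto_sum_zeroIndexAbs hRH (z := x + y * I) (by simpa using hx)).sub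
    (tendsto_sum_zeroIndexAbs hRH (z := x₀ + y * I) (by simpa using hx0))).norm
  refine le_of_tendsto_of_tendsto h1
    ((tendsto_sum_poisson hRH hx0 y).const_mul ((x₀ - x) / x)) (Eventually.of_forall fun R => ?_)
  simp only
  rw [← Finset.sum_sub_distrib, Finset.mul_sum]
  refine (norm_sum_le _ _).trans (Finset.sum_le_sum fun p _ => ?_)
  have hz : (x + y * I - p.1 * I : ℂ) ≠ 0 := fun h => by
    have := congrArg re h; simp at this; linarith
  have hz0 : (x₀ + y * I - p.1 * I : ℂ) ≠ 0 := fun h => by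
    have := congrArg re h; simp at this; linarith
  rw [inv_sub_inv hz hz0, norm_div, norm_mul]
  have e1 : ‖(x₀ + y * I - p.1 * I) - (x + y * I - p.1 * I : ℂ)‖ = x₀ - x := by
    rw [show (x₀ + y * I - p.1 * I) - (x + y * I - p.1 * I : ℂ) = ((x₀ - x : ℝ) : ℂ) by
      push_cast; ring, norm_real, Real.norm_of_nonneg (by linarith)]
  have nsq : ∀ v : ℝ, ‖(v + y * I - p.1 * I : ℂ)‖ ^ 2 = v ^ 2 + (y - p.1) ^ 2 := by
    intro v
    rw [Complex.sq_norm, normSq_apply]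
    simp
    ring
  have e2 : x / x₀ * ‖(x₀ + y * I - p.1 * I : ℂ)‖ ≤ ‖(x + y * I - p.1 * I : ℂ)‖ := by
    refine le_of_sq_le_sq ?_ (norm_nonneg _)
    rw [mul_pow, nsq, nsq, div_pow, div_mul_eq_mul_div, div_le_iff₀ (by positivity)]
    have : x ^ 2 ≤ x₀ ^ 2 := by gcongr
    nlinarith [sq_nonneg (y - p.1)]
  have hpos : 0 < ‖(x₀ + y * I - p.1 * I : ℂ)‖ := norm_pos_iff.mpr hz0
  rw [e1, poisson, ← nsq x₀]
  calc (x₀ - x) / (‖(x + y * I - p.1 * I : ℂ)‖ * ‖(x₀ + y * I - p.1 * I : ℂ)‖)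
      ≤ (x₀ - x) / ((x / x₀ * ‖(x₀ + y * I - p.1 * I : ℂ)‖) * ‖(x₀ + y * I - p.1 * I : ℂ)‖) := by
        gcongr
    _ = _ := by field_simp

/-! ### From ξ'/ξ to ζ'/ζ -/

theorem logDeriv_Gammaℝ {s : ℂ} (hs : 0 < s.re) :
    logDeriv Gammaℝ s = -(Real.log Real.pi : ℂ) / 2 + digamma (s / 2) / 2 := by
  have hpi : (Real.pi : ℂ) ≠ 0 := by exact_mod_cast Real.pi_ne_zero
  have hs2 : 0 < (s / 2).re := by simpa using hs
  have h1 : HasDerivAt (fun s : ℂ => (Real.pi : ℂ) ^ (-s / 2))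
      ((Real.pi : ℂ) ^ (-s / 2) * Complex.log Real.pi * (-1 / 2)) s :=
    (((hasDerivAt_id s).neg).div_const 2).const_cpow (Or.inl hpi)
  have hG : DifferentiableAt ℂ Gamma (s / 2) := differentiableAt_Gamma _ fun m h => by
    rw [h] at hs2
    simp at hs2
    have : (0 : ℝ) ≤ m := Nat.cast_nonneg m
    linarith
  have h2 : HasDerivAt (fun s : ℂ => Gamma (s / 2)) (deriv Gamma (s / 2) * (1 / 2)) s :=
    HasDerivAt.comp (h₂ := Gamma) (h := fun s : ℂ => s / 2) s hG.hasDerivAt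
      ((hasDerivAt_id s).div_const 2)
  have e : Gammaℝ = fun s : ℂ => (Real.pi : ℂ) ^ (-s / 2) * Gamma (s / 2) := rfl
  have hne1 : (Real.pi : ℂ) ^ (-s / 2) ≠ 0 := by simp [cpow_eq_zero_iff, hpi]
  have hne2 : Gamma (s / 2) ≠ 0 := Gamma_ne_zero_of_re_pos hs2
  rw [e, logDeriv_mul (f := fun s : ℂ => (Real.pi : ℂ) ^ (-s / 2)) (g := fun s : ℂ => Gamma (s / 2))
    s hne1 hne2 h1.differentiableAt h2.differentiableAt, logDeriv_apply, logDeriv_apply, h1.deriv,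
    h2.deriv, digamma_def, logDeriv_apply, ← ofReal_log Real.pi_pos.le]
  field_simp

theorem norm_logDeriv_Gammaℝ_sub_le {s : ℂ} (hs : 1 / 2 ≤ s.re) :
    ‖logDeriv Gammaℝ s - log s / 2‖ ≤ 20 := by
  have hs0 : s ≠ 0 := fun h => by rw [h] at hs; norm_num at hs
  have h1 := norm_digamma_sub_log_le (z := s / 2) (by simp; linarith)
  have h2 : log (s / 2) = log s - Real.log 2 := by
    have := log_ofReal_mul (r := 1 / 2) (by norm_num) hs0
    rw [show (((1 / 2 : ℝ) : ℂ) * s) = s / 2 by push_cast; ring] at this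
    rw [this]
    simp
    ring
  rw [logDeriv_Gammaℝ (by linarith)]
  have e : -(Real.log Real.pi : ℂ) / 2 + digamma (s / 2) / 2 - log s / 2 =
      ((-(Real.log Real.pi) / 2 - Real.log 2 / 2 : ℝ) : ℂ) + (digamma (s / 2) - log (s / 2)) / 2 := by
    rw [h2]; push_cast; ring
  rw [e]
  refine (norm_add_le _ _).trans ?_
  rw [norm_real, norm_div, norm_ofNat, Real.norm_eq_abs]
  have hp : Real.log Real.pi ≤ 3 := by
    have := Real.log_le_sub_one_of_pos Real.pi_pos
    linarith [Real.pi_lt_four]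
  have hp0 : 0 ≤ Real.log Real.pi := Real.log_nonneg (by linarith [Real.pi_gt_three])
  have hl2 : Real.log 2 ≤ 1 := by
    have := Real.log_le_sub_one_of_pos (show (0 : ℝ) < 2 by norm_num)
    linarith
  have hl0 : 0 ≤ Real.log 2 := Real.log_nonneg (by norm_num)
  have : |-(Real.log Real.pi) / 2 - Real.log 2 / 2| ≤ 2 := by
    rw [abs_le]; constructor <;> linarith
  linarith

theorem exists_norm_logDeriv_riemannZeta_le {σ : ℝ} (hσ : 1 < σ) :
    ∃ K, ∀ t : ℝ, ‖logDeriv riemannZeta (σ + t * I)‖ ≤ K := by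
  have hs : ∀ t : ℝ, 1 < (σ + t * I : ℂ).re := fun t => by simpa using hσ
  have hsum := ArithmeticFunction.LSeriesSummable_vonMangoldt (s := (σ : ℂ)) (by simpa using hσ)
  refine ⟨∑' n, ‖LSeries.term (fun n => (ArithmeticFunction.vonMangoldt n : ℂ)) σ n‖, fun t => ?_⟩
  have h1 := ArithmeticFunction.LSeries_vonMangoldt_eq_deriv_riemannZeta_div (hs t)
  have h2 : logDeriv riemannZeta (σ + t * I) =
      -LSeries (fun n => (ArithmeticFunction.vonMangoldt n : ℂ)) (σ + t * I) := by
    rw [h1, logDeriv_apply]; ring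
  rw [h2, norm_neg, LSeries]
  refine tsum_of_norm_bounded hsum.norm.hasSum fun n => ?_
  rw [LSeries.norm_term_eq, LSeries.norm_term_eq]
  simp

theorem logDeriv_xi_eq {z : ℂ} (hz : -(1 / 2) < z.re) (hz1 : z ≠ 1 / 2) (hxi : xi z ≠ 0) :
    logDeriv xi z = 1 / (1 / 2 + z) + 1 / (1 / 2 + z - 1) + logDeriv Gammaℝ (1 / 2 + z) +
      logDeriv riemannZeta (1 / 2 + z) := by
  have hre : 0 < (1 / 2 + z).re := by simp; linarith
  have hs0 : 1 / 2 + z ≠ 0 := fun h => by rw [h] at hre; simp at hre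
  have hs1 : 1 / 2 - z ≠ 0 := sub_ne_zero.mpr hz1.symm
  have hs1' : 1 / 2 + z ≠ 1 := fun h => hz1 (by linear_combination h)
  have hs2 : 1 / 2 + z - 1 ≠ 0 := sub_ne_zero.mpr hs1'
  have hG : Gammaℝ (1 / 2 + z) ≠ 0 := Gammaℝ_ne_zero_of_re_pos hre
  have hζ : riemannZeta (1 / 2 + z) ≠ 0 := fun h => hxi ((xi_eq_zero_iff hz).mpr h)
  have hd1 : HasDerivAt (fun z : ℂ => 1 / 2 + z) 1 z := (hasDerivAt_id z).const_add _
  have hdG : HasDerivAt (fun z : ℂ => Gammaℝ (1 / 2 + z)) (deriv Gammaℝ (1 / 2 + z) * 1) z :=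
    HasDerivAt.comp (h₂ := Gammaℝ) (h := fun z : ℂ => 1 / 2 + z) z
      (differentiableAt_Gammaℝ hre).hasDerivAt hd1
  have hdζ : HasDerivAt (fun z : ℂ => riemannZeta (1 / 2 + z))
      (deriv riemannZeta (1 / 2 + z) * 1) z :=
    HasDerivAt.comp (h₂ := riemannZeta) (h := fun z : ℂ => 1 / 2 + z) z
      (differentiableAt_riemannZeta hs1').hasDerivAt hd1
  have hev : xi =ᶠ[𝓝 z] fun z =>
      -(1 / 2 + z) * (1 / 2 - z) * Gammaℝ (1 / 2 + z) * riemannZeta (1 / 2 + z) := by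
    filter_upwards [(isOpen_lt continuous_const continuous_re).mem_nhds hz,
      isOpen_compl_singleton.mem_nhds hz1] with w hw hw1
    exact xi_eq_mul_riemannZeta hw hw1
  have hder := (((hd1.neg.mul ((hasDerivAt_id z).const_sub (1 / 2 : ℂ))).mul hdG).mul hdζ)
  rw [logDeriv_apply, hev.deriv_eq, xi_eq_mul_riemannZeta hz hz1]
  have hder' := hder.deriv
  simp only [Pi.mul_def, Pi.neg_def, id] at hder'
  rw [hder', logDeriv_apply, logDeriv_apply]
  have e : (1 : ℂ) / 2 + z - 1 = -(1 / 2 - z) := by ring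
  rw [e]
  generalize (1 : ℂ) / 2 + z = u at *
  generalize (1 : ℂ) / 2 - z = v at *
  field_simp
  ring

theorem log_abs_add_two_pos (y : ℝ) : 1 / 2 ≤ Real.log (|y| + 2) := by
  have h1 : Real.log 2 ≤ Real.log (|y| + 2) :=
    Real.log_le_log (by norm_num) (by linarith [abs_nonneg y])
  linarith [Real.log_two_gt_d9]

theorem norm_log_le {x y : ℝ} (hx : 0 ≤ x) (hx' : x ≤ 5 / 2) :
    ‖log (1 / 2 + x + y * I : ℂ)‖ ≤ 12 * Real.log (|y| + 2) := by
  have hs : (1 / 2 + x + y * I : ℂ).re = 1 / 2 + x := by simp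
  have hlow : 1 / 2 ≤ ‖(1 / 2 + x + y * I : ℂ)‖ := by
    refine le_trans ?_ (re_le_norm _)
    rw [hs]; linarith
  have hup : ‖(1 / 2 + x + y * I : ℂ)‖ ≤ (|y| + 2) ^ 2 := by
    have h1 : (1 / 2 + x + y * I : ℂ) = ((1 / 2 + x : ℝ) : ℂ) + y * I := by push_cast; ring
    rw [h1]
    refine (norm_add_le _ _).trans ?_
    rw [norm_real, norm_mul, norm_real, norm_I, Real.norm_of_nonneg (by linarith), Real.norm_eq_abs]
    nlinarith [abs_nonneg y]
  have hℓ := log_abs_add_two_pos y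
  have h2 : Real.log ‖(1 / 2 + x + y * I : ℂ)‖ ≤ 2 * Real.log (|y| + 2) := by
    have := Real.log_le_log (by linarith) hup
    rwa [Real.log_pow, Nat.cast_ofNat] at this
  have h3 : -1 ≤ Real.log ‖(1 / 2 + x + y * I : ℂ)‖ := by
    have := Real.log_le_log (by norm_num) hlow
    have h4 : Real.log (1 / 2) = -Real.log 2 := by simp
    have h5 := Real.log_two_lt_d9
    linarith
  have h6 : ‖log (1 / 2 + x + y * I : ℂ)‖ ≤
      |Real.log ‖(1 / 2 + x + y * I : ℂ)‖| + |arg (1 / 2 + x + y * I : ℂ)| := by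
    have := norm_le_abs_re_add_abs_im (log (1 / 2 + x + y * I : ℂ))
    rwa [log_re, log_im] at this
  have h7 := abs_arg_le_pi (1 / 2 + x + y * I : ℂ)
  have h8 : |Real.log ‖(1 / 2 + x + y * I : ℂ)‖| ≤ 2 * Real.log (|y| + 2) := by
    rw [abs_le]; constructor <;> linarith
  linarith [Real.pi_lt_four]

/-- Here Re s = 3, so ζ'/ζ is bounded by its Dirichlet series and only the Gamma factor grows. Every
later bound on the density of zeros rests on this. -/
theorem exists_norm_logDeriv_xi_le (hRH : RiemannHypothesis) :
    ∃ K, 0 < K ∧ ∀ y : ℝ, ‖logDeriv xi ((5 / 2 : ℝ) + y * I)‖ ≤ K * Real.log (|y| + 2) := by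
  obtain ⟨K₀, hK₀⟩ := exists_norm_logDeriv_riemannZeta_le (σ := 3) (by norm_num)
  have hK₀0 : 0 ≤ K₀ := (norm_nonneg _).trans (hK₀ 0)
  refine ⟨2 * (22 + K₀) + 6, by positivity, fun y => ?_⟩
  have hre : (((5 / 2 : ℝ) : ℂ) + y * I).re = 5 / 2 := by simp
  have hs : (1 / 2 : ℂ) + (((5 / 2 : ℝ) : ℂ) + y * I) = 3 + y * I := by push_cast; ring
  rw [logDeriv_xi_eq (by rw [hre]; norm_num) (fun h => by rw [h] at hre; norm_num at hre)
    (xi_ne_zero_of_re_pos hRH (by rw [hre]; norm_num))]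
  have h1 : ‖1 / ((1 / 2 : ℂ) + (((5 / 2 : ℝ) : ℂ) + y * I))‖ ≤ 1 := by
    rw [hs, norm_div, norm_one]
    refine div_le_one_of_le₀ (le_trans ?_ (re_le_norm _)) (norm_nonneg _)
    simp
  have h2 : ‖1 / ((1 / 2 : ℂ) + (((5 / 2 : ℝ) : ℂ) + y * I) - 1)‖ ≤ 1 := by
    rw [hs, norm_div, norm_one]
    refine div_le_one_of_le₀ (le_trans ?_ (re_le_norm _)) (norm_nonneg _)
    simp; norm_num
  have h3 := norm_logDeriv_Gammaℝ_sub_le (s := (1 / 2 : ℂ) + (((5 / 2 : ℝ) : ℂ) + y * I))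
    (by rw [hs]; simp; norm_num)
  have h4 := norm_log_le (x := 5 / 2) (y := y) (by norm_num) le_rfl
  rw [add_assoc] at h4
  have h5 := hK₀ y
  rw [show (((3 : ℝ) : ℂ) + y * I) = (1 / 2 : ℂ) + (((5 / 2 : ℝ) : ℂ) + y * I) by
    push_cast; ring] at h5
  have hℓ := log_abs_add_two_pos y
  generalize (1 / 2 : ℂ) + (((5 / 2 : ℝ) : ℂ) + y * I) = s at *
  have h6 : ‖logDeriv Gammaℝ s‖ ≤ 20 + 6 * Real.log (|y| + 2) := by
    have : logDeriv Gammaℝ s = (logDeriv Gammaℝ s - log s / 2) + log s / 2 := by ring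
    rw [this]
    refine (norm_add_le _ _).trans ?_
    have : ‖log s / 2‖ ≤ 6 * Real.log (|y| + 2) := by
      rw [norm_div, norm_ofNat]; linarith
    linarith
  have h7 : ‖1 / s + 1 / (s - 1) + logDeriv Gammaℝ s + logDeriv riemannZeta s‖ ≤
      ‖1 / s‖ + ‖1 / (s - 1)‖ + ‖logDeriv Gammaℝ s‖ + ‖logDeriv riemannZeta s‖ := norm_add₄_le
  nlinarith

theorem logDeriv_riemannZeta_eq (hRH : RiemannHypothesis) {x y : ℝ} (hx : 0 < x)
    (h1 : x ≠ 1 / 2 ∨ y ≠ 0) :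
    logDeriv riemannZeta (1 / 2 + x + y * I) = logDeriv xi (x + y * I) -
      (1 / (1 / 2 + x + y * I) + 1 / (1 / 2 + x + y * I - 1) +
        logDeriv Gammaℝ (1 / 2 + x + y * I)) := by
  have hre : (x + y * I : ℂ).re = x := by simp
  have him : (x + y * I : ℂ).im = y := by simp
  rw [logDeriv_xi_eq (z := x + y * I) (by rw [hre]; linarith)
    (fun h => by
      rw [h] at hre him
      norm_num at hre him
      rcases h1 with h1 | h1
      · exact h1 (by linarith)
      · exact h1 (by linarith))
    (xi_ne_zero_of_re_pos hRH (by rw [hre]; exact hx)), add_assoc (1 / 2 : ℂ)]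
  ring

/-- A crude pointwise bound for `ζ'/ζ` to the right of the critical line. -/
theorem exists_norm_logDeriv_riemannZeta_le_log (hRH : RiemannHypothesis) :
    ∃ K, 0 < K ∧ ∀ x y : ℝ, 0 < x → x ≤ 5 / 2 → (x ≤ 1 / 4 ∨ 1 ≤ y) →
      ‖logDeriv riemannZeta (1 / 2 + x + y * I)‖ ≤ K * (1 + 1 / x) * Real.log (|y| + 2) := by
  obtain ⟨K₀, hK₀0, hK₀⟩ := exists_norm_logDeriv_xi_le hRH
  refine ⟨3 * K₀ + 60, by positivity, fun x y hx hx' hxy => ?_⟩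
  rw [logDeriv_riemannZeta_eq hRH hx (by
    rcases hxy with h | h
    · left; linarith
    · right; linarith)]
  have hℓ := log_abs_add_two_pos y
  have hA := norm_logDeriv_xi_sub_le hRH hx hx' y
  have hA0 := hK₀ y
  have hA0' := re_le_norm (logDeriv xi ((5 / 2 : ℝ) + y * I))
  have hA1 : ‖logDeriv xi (x + y * I)‖ ≤ 3 * K₀ * (1 + 1 / x) * Real.log (|y| + 2) := by
    have h1 := norm_le_norm_sub_add (logDeriv xi (x + y * I)) (logDeriv xi ((5 / 2 : ℝ) + y * I))
    have h2 : (5 / 2 - x) / x * (logDeriv xi ((5 / 2 : ℝ) + y * I)).re ≤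
        (5 / 2) / x * (K₀ * Real.log (|y| + 2)) := by
      have h3 : (5 / 2 - x) / x * (logDeriv xi ((5 / 2 : ℝ) + y * I)).re ≤
          (5 / 2 - x) / x * (K₀ * Real.log (|y| + 2)) := by
        have : 0 ≤ 5 / 2 - x := by linarith
        gcongr
        linarith
      refine h3.trans ?_
      gcongr
      linarith
    have h4 : ‖logDeriv xi (x + y * I)‖ ≤ (5 / 2) / x * (K₀ * Real.log (|y| + 2)) +
        K₀ * Real.log (|y| + 2) := by linarith
    refine h4.trans ?_
    have h5 : 0 ≤ K₀ * Real.log (|y| + 2) := by positivity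
    have h6 : 0 ≤ 1 / x * (K₀ * Real.log (|y| + 2)) := by positivity
    have h7 : (5 / 2) / x * (K₀ * Real.log (|y| + 2)) = 5 / 2 * (1 / x * (K₀ * Real.log (|y| + 2))) := by
      ring
    rw [h7]
    linarith
  have hsre : (1 / 2 + x + y * I : ℂ).re = 1 / 2 + x := by simp
  have hsim : (1 / 2 + x + y * I : ℂ).im = y := by simp
  have h1 : ‖1 / (1 / 2 + x + y * I : ℂ)‖ ≤ 2 := by
    rw [norm_div, norm_one, div_le_iff₀]
    · have := re_le_norm (1 / 2 + x + y * I : ℂ)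
      rw [hsre] at this
      linarith
    · have := re_le_norm (1 / 2 + x + y * I : ℂ)
      rw [hsre] at this
      linarith
  have h2 : ‖1 / (1 / 2 + x + y * I - 1 : ℂ)‖ ≤ 4 := by
    -- Either alternative of `hxy` keeps s at distance at least 1/4 from the pole at 1.
    have hb : 1 / 4 ≤ ‖(1 / 2 + x + y * I - 1 : ℂ)‖ := by
      rcases hxy with h | h
      · have := abs_re_le_norm (1 / 2 + x + y * I - 1 : ℂ)
        rw [sub_re, hsre, one_re, abs_of_nonpos (by linarith)] at this
        linarith
      · have := abs_im_le_norm (1 / 2 + x + y * I - 1 : ℂ)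
        rw [sub_im, hsim, one_im, sub_zero, abs_of_pos (by linarith)] at this
        linarith
    rw [norm_div, norm_one, div_le_iff₀ (by linarith)]
    linarith
  have h3 := norm_logDeriv_Gammaℝ_sub_le (s := (1 / 2 + x + y * I : ℂ)) (by rw [hsre]; linarith)
  have h4 := norm_log_le (y := y) hx.le hx'
  generalize (1 / 2 + x + y * I : ℂ) = s at *
  have h6 : ‖logDeriv Gammaℝ s‖ ≤ 20 + 6 * Real.log (|y| + 2) := by
    have : logDeriv Gammaℝ s = (logDeriv Gammaℝ s - log s / 2) + log s / 2 := by ring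
    rw [this]
    refine (norm_add_le _ _).trans ?_
    have : ‖log s / 2‖ ≤ 6 * Real.log (|y| + 2) := by
      rw [norm_div, norm_ofNat]; linarith
    linarith
  have h7 : ‖1 / s + 1 / (s - 1) + logDeriv Gammaℝ s‖ ≤
      ‖1 / s‖ + ‖1 / (s - 1)‖ + ‖logDeriv Gammaℝ s‖ := norm_add₃_le
  have h8 := norm_sub_le (logDeriv xi (x + y * I)) (1 / s + 1 / (s - 1) + logDeriv Gammaℝ s)
  have h9 : 60 * Real.log (|y| + 2) ≤ 60 * (1 + 1 / x) * Real.log (|y| + 2) := by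
    have : 0 ≤ 1 / x * Real.log (|y| + 2) := by positivity
    linarith
  have h10 : (3 * K₀ + 60) * (1 + 1 / x) * Real.log (|y| + 2) =
    3 * K₀ * (1 + 1 / x) * Real.log (|y| + 2) + 60 * (1 + 1 / x) * Real.log (|y| + 2) := by ring
  linarith

/-- The Gamma factor contributes Re (log s)/2 = (log |s|)/2 up to O(1), and y ≤ |s| ≤ 4y. This
logarithm, divided by log T, becomes the centring constant 1/2 of the linear statistic. -/
theorem abs_re_logDeriv_riemannZeta_sub_le (hRH : RiemannHypothesis) {x y : ℝ} (hx : 0 < x)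
    (hx' : x ≤ 5 / 2) (hy : 1 ≤ y) :
    |(logDeriv riemannZeta (1 / 2 + x + y * I)).re -
      ((logDeriv xi (x + y * I)).re - Real.log y / 2)| ≤ 24 := by
  rw [logDeriv_riemannZeta_eq hRH hx (Or.inr (by linarith))]
  have hsre : (1 / 2 + x + y * I : ℂ).re = 1 / 2 + x := by simp
  have hsim : (1 / 2 + x + y * I : ℂ).im = y := by simp
  have h1 : ‖1 / (1 / 2 + x + y * I : ℂ)‖ ≤ 1 := by
    rw [norm_div, norm_one]
    refine div_le_one_of_le₀ (le_trans ?_ (abs_im_le_norm _)) (norm_nonneg _)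
    rw [hsim]; exact hy.trans (le_abs_self y)
  have h2 : ‖1 / (1 / 2 + x + y * I - 1 : ℂ)‖ ≤ 1 := by
    rw [norm_div, norm_one]
    refine div_le_one_of_le₀ (le_trans ?_ (abs_im_le_norm _)) (norm_nonneg _)
    rw [sub_im, hsim, one_im, sub_zero]; exact hy.trans (le_abs_self y)
  have h3 := norm_logDeriv_Gammaℝ_sub_le (s := (1 / 2 + x + y * I : ℂ)) (by rw [hsre]; linarith)
  have hlow : y ≤ ‖(1 / 2 + x + y * I : ℂ)‖ := by
    refine (le_abs_self y).trans (le_trans (le_of_eq ?_) (abs_im_le_norm _))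
    rw [hsim]
  have hup : ‖(1 / 2 + x + y * I : ℂ)‖ ≤ 4 * y := by
    have h1 : (1 / 2 + x + y * I : ℂ) = ((1 / 2 + x : ℝ) : ℂ) + y * I := by push_cast; ring
    rw [h1]
    refine (norm_add_le _ _).trans ?_
    rw [norm_real, norm_mul, norm_real, norm_I, Real.norm_of_nonneg (by linarith),
      Real.norm_of_nonneg (by linarith)]
    linarith
  have h4 : (log (1 / 2 + x + y * I : ℂ)).re = Real.log ‖(1 / 2 + x + y * I : ℂ)‖ := log_re _
  have h5 : Real.log y ≤ Real.log ‖(1 / 2 + x + y * I : ℂ)‖ :=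
    Real.log_le_log (by linarith) hlow
  have h6 : Real.log ‖(1 / 2 + x + y * I : ℂ)‖ ≤ 2 + Real.log y := by
    refine (Real.log_le_log (by linarith) hup).trans ?_
    rw [Real.log_mul (by norm_num) (by linarith)]
    have : Real.log 4 = 2 * Real.log 2 := by
      rw [show (4 : ℝ) = 2 ^ 2 by norm_num, Real.log_pow]; norm_num
    linarith [Real.log_two_lt_d9]
  generalize (1 / 2 + x + y * I : ℂ) = s at *
  have e1 := (abs_re_le_norm (1 / s)).trans h1
  have e2 := (abs_re_le_norm (1 / (s - 1))).trans h2
  have e3 := (abs_re_le_norm (logDeriv Gammaℝ s - log s / 2)).trans h3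
  have e4 : (log s / 2).re = Real.log ‖s‖ / 2 := by
    rw [← h4]; simp
  rw [sub_re, e4] at e3
  rw [sub_re, add_re, add_re]
  rw [abs_le] at *
  constructor <;> linarith [e1.1, e1.2, e2.1, e2.2, e3.1, e3.2]

/-! ### Contour shift and reduction to the real part -/

theorem riemannZeta_ne_zero_of_half_lt_re (hRH : RiemannHypothesis) {s : ℂ} (hs : 1 / 2 < s.re) :
    riemannZeta s ≠ 0 := by
  have h1 : 0 < (s - 1 / 2).re := by simp; linarith
  have h2 := (xi_eq_zero_iff (z := s - 1 / 2) (by linarith)).not.mp (xi_ne_zero_of_re_pos hRH h1)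
  rwa [add_sub_cancel] at h2

theorem differentiableAt_logDeriv_riemannZeta (hRH : RiemannHypothesis) {s : ℂ}
    (hs : 1 / 2 < s.re) (hs1 : s ≠ 1) : DifferentiableAt ℂ (logDeriv riemannZeta) s := by
  have h1 : AnalyticAt ℂ riemannZeta s := analyticOn_riemannZeta s hs1
  exact h1.deriv.differentiableAt.div h1.differentiableAt (riemannZeta_ne_zero_of_half_lt_re hRH hs)

theorem logDeriv_riemannZeta_conj (s : ℂ) :
    logDeriv riemannZeta ((starRingEnd ℂ) s) = (starRingEnd ℂ) (logDeriv riemannZeta s) := by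
  have e : (starRingEnd ℂ) ∘ riemannZeta ∘ (starRingEnd ℂ) = riemannZeta := by
    ext z
    simp [riemannZeta_conj]
  have h : deriv riemannZeta ((starRingEnd ℂ) s) = (starRingEnd ℂ) (deriv riemannZeta s) := by
    conv_lhs => rw [← e]
    rw [deriv_conj_conj]
    simp
  rw [logDeriv_apply, logDeriv_apply, h, riemannZeta_conj, map_div₀]

theorem continuous_logDeriv_riemannZeta_line (hRH : RiemannHypothesis) {x : ℝ} (hx : 0 < x)
    (hx' : x < 1 / 2) : Continuous fun t : ℝ => logDeriv riemannZeta (1 / 2 + x + t * I) := by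
  rw [continuous_iff_continuousAt]
  intro t
  have hs : (1 / 2 + x + t * I : ℂ).re = 1 / 2 + x := by simp
  have h1 := (differentiableAt_logDeriv_riemannZeta hRH (s := 1 / 2 + x + t * I)
    (by rw [hs]; linarith) (fun h => by rw [h] at hs; simp at hs; linarith)).continuousAt
  exact ContinuousAt.comp (f := fun t : ℝ => (1 / 2 + x + t * I : ℂ)) h1 (by fun_prop)

/-- Shifting the line of integration to `Re s = 3`. -/
theorem exists_norm_integral_logDeriv_pow_le (hRH : RiemannHypothesis) (k : ℕ) :
    ∃ K, 0 < K ∧ ∀ x T : ℝ, 0 < x → x ≤ 1 / 4 → 1 ≤ T →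
      ‖∫ t in (1 : ℝ)..T, logDeriv riemannZeta (1 / 2 + x + t * I) ^ k‖ ≤
        K * (T + ((1 + 1 / x) * Real.log (T + 2)) ^ k) := by
  obtain ⟨K₃, hK₃⟩ := exists_norm_logDeriv_riemannZeta_le (σ := 3) (by norm_num)
  obtain ⟨K₁, hK₁0, hK₁⟩ := exists_norm_logDeriv_riemannZeta_le_log hRH
  have hK₃0 : 0 ≤ K₃ := (norm_nonneg _).trans (hK₃ 0)
  refine ⟨K₃ ^ k + 6 * K₁ ^ k, by positivity, fun x T hx hx' hT => ?_⟩
  set f : ℂ → ℂ := fun s => logDeriv riemannZeta s ^ k with hf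
  -- The rectangle starts at height 1, which leaves the pole outside. On the horizontal sides the
  -- crude logarithmic bound is used, on Re s = 3 the Dirichlet series.
  have hrect := integral_boundary_rect_eq_zero_of_differentiableOn f
    (((1 / 2 + x : ℝ) : ℂ) + (1 : ℝ) * I) ((3 : ℝ) + (T : ℝ) * I) (by
      intro s hs
      rw [mem_reProdIm] at hs
      have h1 : (((1 / 2 + x : ℝ) : ℂ) + (1 : ℝ) * I).re = 1 / 2 + x := by simp
      have h2 : (((1 / 2 + x : ℝ) : ℂ) + (1 : ℝ) * I).im = 1 := by simp
      have h3 : (((3 : ℝ) : ℂ) + (T : ℝ) * I).re = 3 := by simp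
      have h4 : (((3 : ℝ) : ℂ) + (T : ℝ) * I).im = T := by simp
      rw [h1, h2, h3, h4, Set.uIcc_of_le (by linarith), Set.uIcc_of_le hT] at hs
      refine (DifferentiableAt.pow (differentiableAt_logDeriv_riemannZeta hRH
        (by linarith [hs.1.1]) ?_) k).differentiableWithinAt
      rintro rfl
      have := hs.2.1
      simp at this
      linarith)
  simp only [add_re, ofReal_re, mul_re, I_re, mul_zero, ofReal_im, I_im, mul_one, sub_self,
    add_zero, add_im, mul_im, zero_add] at hrect
  have hb : ∀ y : ℝ, 1 ≤ y → y ≤ T → ‖∫ v in (1 / 2 + x)..3, f (v + y * I)‖ ≤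
      3 * (K₁ * ((1 + 1 / x) * Real.log (T + 2))) ^ k := by
    intro y hy hyT
    have h1 : ∀ v ∈ Set.uIoc (1 / 2 + x) 3, ‖f (v + y * I)‖ ≤
        (K₁ * ((1 + 1 / x) * Real.log (T + 2))) ^ k := by
      intro v hv
      rw [Set.uIoc_of_le (by linarith)] at hv
      have h2 := hK₁ (v - 1 / 2) y (by linarith [hv.1]) (by linarith [hv.2]) (Or.inr hy)
      rw [show (1 / 2 : ℂ) + ((v - 1 / 2 : ℝ) : ℂ) + y * I = v + y * I by push_cast; ring] at h2
      rw [hf]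
      simp only [norm_pow]
      refine pow_le_pow_left₀ (norm_nonneg _) (h2.trans ?_) k
      rw [mul_assoc, abs_of_pos (by linarith)]
      have : x ≤ v - 1 / 2 := by linarith [hv.1]
      have hl : 0 ≤ Real.log (y + 2) := Real.log_nonneg (by linarith)
      gcongr
    have h2 := intervalIntegral.norm_integral_le_of_norm_le_const h1
    refine h2.trans ?_
    rw [mul_comm, abs_of_pos (by linarith)]
    have : 0 ≤ (K₁ * ((1 + 1 / x) * Real.log (T + 2))) ^ k := by
      have : 0 ≤ Real.log (T + 2) := Real.log_nonneg (by linarith)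
      positivity
    gcongr
    linarith
  have h1 := hb 1 le_rfl hT
  have h2 := hb T hT le_rfl
  have h3 : ‖∫ y in (1 : ℝ)..T, f ((3 : ℝ) + y * I)‖ ≤ K₃ ^ k * T := by
    have : ∀ y ∈ Set.uIoc (1 : ℝ) T, ‖f ((3 : ℝ) + y * I)‖ ≤ K₃ ^ k := by
      intro y _
      rw [hf]
      simp only [norm_pow]
      exact pow_le_pow_left₀ (norm_nonneg _) (hK₃ y) k
    refine (intervalIntegral.norm_integral_le_of_norm_le_const this).trans ?_
    gcongr
    rw [abs_of_nonneg (by linarith)]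
    linarith
  have e : ∫ t in (1 : ℝ)..T, logDeriv riemannZeta (1 / 2 + x + t * I) ^ k =
      ∫ y in (1 : ℝ)..T, f (((1 / 2 + x : ℝ) : ℂ) + y * I) := by
    refine intervalIntegral.integral_congr fun t _ => ?_
    simp only [hf]
    push_cast
    rfl
  rw [e]
  set A := ∫ v in (1 / 2 + x)..3, f (v + (1 : ℝ) * I)
  set B := ∫ v in (1 / 2 + x)..3, f (v + T * I)
  set D := ∫ y in (1 : ℝ)..T, f ((3 : ℝ) + y * I)
  set E := ∫ y in (1 : ℝ)..T, f (((1 / 2 + x : ℝ) : ℂ) + y * I)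
  have hE : I * E = A - B + I * D := by
    simp only [smul_eq_mul] at hrect
    linear_combination -hrect
  have hn : ‖E‖ ≤ ‖A‖ + ‖B‖ + ‖D‖ := by
    have h4 : ‖E‖ = ‖I * E‖ := by simp
    rw [h4, hE]
    refine (norm_add_le _ _).trans ?_
    have h5 := norm_sub_le A B
    have h6 : ‖I * D‖ = ‖D‖ := by simp
    linarith
  rw [mul_pow] at h1 h2
  have hl : 0 ≤ ((1 + 1 / x) * Real.log (T + 2)) ^ k := by
    have : 0 ≤ Real.log (T + 2) := Real.log_nonneg (by linarith)
    positivity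
  have h7 : 0 ≤ K₃ ^ k * ((1 + 1 / x) * Real.log (T + 2)) ^ k := by positivity
  have h8 : 0 ≤ K₁ ^ k * T := by positivity
  nlinarith

/-- With w = u + iv, |w|² u = u³ + uv² and Re w³ = u³ − 3uv²; eliminate uv². This trades the
non-holomorphic integrand for a cube of the real part, which is a sum over zeros, and a holomorphic
cube, whose contour can be moved. -/
theorem re_normSq_mul_self (w : ℂ) :
    (((‖w‖ ^ 2 : ℝ) : ℂ) * w).re = 4 / 3 * w.re ^ 3 - 1 / 3 * (w ^ 3).re := by
  have h : ‖w‖ ^ 2 = w.re ^ 2 + w.im ^ 2 := by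
    rw [Complex.sq_norm, normSq_apply]; ring
  rw [re_ofReal_mul, h]
  simp [pow_succ]
  ring

/-- By Schwarz reflection the integrand at −t is the conjugate of that at t, so each pair
contributes twice its real part; this doubles the coefficients 4/3 and 1/3. -/
theorem integral_normSq_mul_logDeriv (hRH : RiemannHypothesis) {x : ℝ} (hx : 0 < x)
    (hx' : x < 1 / 2) (T : ℝ) :
    ∫ t in (-T)..T, ((‖logDeriv riemannZeta (1 / 2 + x + t * I)‖ ^ 2 : ℝ) : ℂ) *
        logDeriv riemannZeta (1 / 2 + x + t * I) =
      ((8 / 3 * (∫ t in (0 : ℝ)..T, (logDeriv riemannZeta (1 / 2 + x + t * I)).re ^ 3) -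
        2 / 3 * (∫ t in (0 : ℝ)..T, logDeriv riemannZeta (1 / 2 + x + t * I) ^ 3).re : ℝ) : ℂ) := by
  have hc := continuous_logDeriv_riemannZeta_line hRH hx hx'
  set F : ℝ → ℂ := fun t => logDeriv riemannZeta (1 / 2 + x + t * I) with hF
  have hconj : ∀ t, F (-t) = (starRingEnd ℂ) (F t) := by
    intro t
    simp only [hF]
    rw [← logDeriv_riemannZeta_conj]
    congr 1
    simp [map_ofNat]
  set G : ℝ → ℂ := fun t => ((‖F t‖ ^ 2 : ℝ) : ℂ) * F t with hG
  have hGc : Continuous G := by fun_prop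
  have h1 : ∫ t in (-T)..T, G t = (∫ t in (-T)..0, G t) + ∫ t in (0 : ℝ)..T, G t :=
    (intervalIntegral.integral_add_adjacent_intervals (hGc.intervalIntegrable _ _)
      (hGc.intervalIntegrable _ _)).symm
  have h2 : ∫ t in (-T)..0, G t = ∫ t in (0 : ℝ)..T, G (-t) := by
    rw [intervalIntegral.integral_comp_neg]; simp
  have h3 : ∀ t, G (-t) + G t = ((8 / 3 * (F t).re ^ 3 - 2 / 3 * (F t ^ 3).re : ℝ) : ℂ) := by
    intro t
    have : G (-t) = (starRingEnd ℂ) (G t) := by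
      simp only [hG, hconj, map_mul, conj_ofReal, RCLike.norm_conj]
    rw [this, add_comm, add_conj]
    simp only [hG, re_normSq_mul_self]
    push_cast
    ring
  have hGn : Continuous fun t => G (-t) := by fun_prop
  change ∫ t in (-T)..T, G t = _
  rw [h1, h2, ← intervalIntegral.integral_add (hGn.intervalIntegrable _ _)
    (hGc.intervalIntegrable _ _)]
  simp_rw [h3]
  rw [intervalIntegral.integral_ofReal]
  congr 1
  have hr1 : Continuous fun t => 8 / 3 * (F t).re ^ 3 := by
    exact continuous_const.mul ((continuous_re.comp hc).pow 3)
  have hr2 : Continuous fun t => 2 / 3 * (F t ^ 3).re := by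
    exact continuous_const.mul (continuous_re.comp (hc.pow 3))
  rw [intervalIntegral.integral_sub (hr1.intervalIntegrable _ _) (hr2.intervalIntegrable _ _),
    intervalIntegral.integral_const_mul, intervalIntegral.integral_const_mul]
  congr 2
  exact intervalIntegral.intervalIntegral_re ((hc.pow 3).intervalIntegrable _ _)

/-! ### Fourier transforms of the Poisson kernel and its square -/

open scoped FourierTransform

/-- Fourier inversion, so that the transform of a Poisson kernel can be found backwards: its
exponential dual is transformed by elementary half-line integrals. -/
theorem integral_mul_exp_eq_of_fourier {q P : ℝ → ℂ} (hq : Continuous q) (hqi : Integrable q)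
    (hP : Integrable P)
    (h : ∀ x : ℝ, ∫ ξ : ℝ, cexp (-(2 * Real.pi * x * I) * ξ) * q ξ = P x) (η : ℝ) :
    ∫ x : ℝ, P x * cexp (2 * Real.pi * x * η * I) = q η := by
  have h1 : 𝓕 q = P := by
    ext x
    rw [Real.fourier_real_eq_integral_exp_smul, ← h x]
    refine integral_congr_ae (Eventually.of_forall fun ξ => ?_)
    simp only [smul_eq_mul]
    congr 2
    push_cast
    ring
  have h2 := hq.fourierInv_fourier_eq hqi (h1 ▸ hP)
  rw [← congrFun h2 η, h1, Real.fourierInv_eq']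
  refine integral_congr_ae (Eventually.of_forall fun x => ?_)
  simp only [smul_eq_mul, mul_comm (P x)]
  congr 2
  simp
  ring

theorem integrableOn_Iic_of_comp_neg {E : Type*} [NormedAddCommGroup E] {f : ℝ → E}
    (h : IntegrableOn (fun x => f (-x)) (Set.Ioi 0)) : IntegrableOn f (Set.Iic 0) := by
  rw [← Measure.map_neg_eq_self (volume : Measure ℝ)]
  have m : MeasurableEmbedding fun x : ℝ => -x := (Homeomorph.neg ℝ).measurableEmbedding
  rw [m.integrableOn_map_iff, Set.neg_preimage, Set.neg_Iic, neg_zero,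
    integrableOn_Ici_iff_integrableOn_Ioi]
  exact h

theorem integrable_comp_abs {E : Type*} [NormedAddCommGroup E] {g : ℝ → E}
    (hg : IntegrableOn g (Set.Ioi 0)) : Integrable fun x => g |x| := by
  have h1 : IntegrableOn (fun x => g |x|) (Set.Ioi 0) :=
    hg.congr_fun (fun x hx => by rw [abs_of_pos (show 0 < x from hx)]) measurableSet_Ioi
  have h2 : IntegrableOn (fun x => g |x|) (Set.Iic 0) :=
    integrableOn_Iic_of_comp_neg (by simpa only [abs_neg] using h1)
  rw [← integrableOn_univ, ← Set.Iic_union_Ioi (a := (0 : ℝ))]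
  exact h2.union h1

theorem integral_even_mul_exp {g : ℝ → ℝ} (x : ℝ) {A B : ℂ}
    (hi : IntegrableOn (fun ξ : ℝ => (g ξ : ℂ)) (Set.Ioi 0))
    (hA : ∫ ξ in Set.Ioi (0 : ℝ), cexp (-(2 * Real.pi * x * I) * ξ) * g ξ = A)
    (hB : ∫ ξ in Set.Ioi (0 : ℝ), cexp ((2 * Real.pi * x * I) * ξ) * g ξ = B) :
    ∫ ξ : ℝ, cexp (-(2 * Real.pi * x * I) * ξ) * g |ξ| = A + B := by
  have hn : ∀ (c : ℝ) (ξ : ℝ), ‖cexp (c * I * ξ)‖ = 1 := by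
    intro c ξ
    rw [show (c * I * ξ : ℂ) = ((c * ξ : ℝ) : ℂ) * I by push_cast; ring, norm_exp_ofReal_mul_I]
  have hInt : ∀ c : ℝ, IntegrableOn (fun ξ : ℝ => cexp (c * I * ξ) * g ξ) (Set.Ioi 0) := by
    intro c
    refine hi.bdd_mul (c := 1) (by fun_prop) (Eventually.of_forall fun ξ => (hn c ξ).le)
  have e1 : ∀ ξ : ℝ, cexp (-(2 * Real.pi * x * I) * ξ) = cexp ((-(2 * Real.pi * x) : ℝ) * I * ξ) := by
    intro ξ; congr 1; push_cast; ring
  have e2 : ∀ ξ : ℝ, cexp ((2 * Real.pi * x * I) * ξ) = cexp ((2 * Real.pi * x : ℝ) * I * ξ) := by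
    intro ξ; congr 1; push_cast; ring
  have hpos : IntegrableOn (fun ξ : ℝ => cexp (-(2 * Real.pi * x * I) * ξ) * g |ξ|) (Set.Ioi 0) := by
    refine (hInt (-(2 * Real.pi * x))).congr_fun (fun ξ hξ => ?_) measurableSet_Ioi
    simp only [e1, abs_of_pos (show 0 < ξ from hξ)]
  have hcomp : ∀ ξ : ℝ, cexp (-(2 * Real.pi * x * I) * (-ξ : ℝ)) * g |(-ξ)| =
      cexp ((2 * Real.pi * x * I) * ξ) * g |ξ| := by
    intro ξ
    rw [abs_neg]; congr 2; push_cast; ring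
  have hneg : IntegrableOn (fun ξ : ℝ => cexp (-(2 * Real.pi * x * I) * ξ) * g |ξ|) (Set.Iic 0) := by
    refine integrableOn_Iic_of_comp_neg ?_
    refine (hInt (2 * Real.pi * x)).congr_fun (fun ξ hξ => ?_) measurableSet_Ioi
    simp only
    rw [hcomp, e2, abs_of_pos (show 0 < ξ from hξ)]
  rw [← intervalIntegral.integral_Iic_add_Ioi hneg hpos, add_comm]
  congr 1
  · rw [← hA]
    refine setIntegral_congr_fun measurableSet_Ioi fun ξ hξ => ?_
    simp only [abs_of_pos (show 0 < ξ from hξ)]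
  · rw [← hB, ← neg_zero, ← integral_comp_neg_Ioi]
    rw [neg_zero]
    refine setIntegral_congr_fun measurableSet_Ioi fun ξ hξ => ?_
    rw [hcomp, abs_of_pos (show 0 < ξ from hξ)]

theorem integral_Ioi_exp_neg_mul {β : ℂ} (hβ : 0 < β.re) :
    ∫ ξ in Set.Ioi (0 : ℝ), cexp (-(β * ξ)) = 1 / β := by
  have := integral_exp_mul_complex_Ioi (a := -β) (by simpa using hβ) 0
  simp only [neg_mul] at this
  rw [this]
  simp

theorem integral_Ioi_id_mul_exp_neg_mul {β : ℂ} (hβ : 0 < β.re) :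
    IntegrableOn (fun ξ : ℝ => (ξ : ℂ) * cexp (-(β * ξ))) (Set.Ioi 0) ∧
    ∫ ξ in Set.Ioi (0 : ℝ), (ξ : ℂ) * cexp (-(β * ξ)) = 1 / β ^ 2 := by
  have hβ0 : β ≠ 0 := fun h => by rw [h] at hβ; simp at hβ
  have hnorm : ∀ ξ : ℝ, ‖cexp (-(β * ξ))‖ = Real.exp (-(β.re * ξ)) := by
    intro ξ; rw [norm_exp]; simp
  have hi : IntegrableOn (fun ξ : ℝ => (ξ : ℂ) * cexp (-(β * ξ))) (Set.Ioi 0) := by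
    have h1 := integrableOn_rpow_mul_exp_neg_mul_rpow (s := 1) (p := 1) (b := β.re) (by norm_num)
      zero_lt_one hβ
    refine Integrable.mono' h1 (by fun_prop) ?_
    filter_upwards [ae_restrict_mem measurableSet_Ioi] with ξ hξ
    rw [norm_mul, hnorm, norm_real, Real.norm_of_nonneg (le_of_lt hξ)]
    simp
  refine ⟨hi, ?_⟩
  have hder : ∀ ξ ∈ Set.Ici (0 : ℝ), HasDerivAt
      (fun ξ : ℝ => -((ξ : ℂ) / β + 1 / β ^ 2) * cexp (-(β * ξ)))
      ((ξ : ℂ) * cexp (-(β * ξ))) ξ := by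
    intro ξ _
    have h1 : HasDerivAt (fun z : ℂ => -(z / β + 1 / β ^ 2) * cexp (-(β * z)))
        (-(1 / β) * cexp (-(β * ξ)) + -((ξ : ℂ) / β + 1 / β ^ 2) * (cexp (-(β * ξ)) * -(β * 1))) ξ := by
      exact ((((hasDerivAt_id (ξ : ℂ)).div_const β).add_const _).neg).mul
        (((hasDerivAt_id (ξ : ℂ)).const_mul β).neg.cexp)
    refine h1.comp_ofReal.congr_deriv ?_
    field_simp
    ring
  have hlim : Tendsto (fun ξ : ℝ => -((ξ : ℂ) / β + 1 / β ^ 2) * cexp (-(β * ξ))) atTop (𝓝 0) := by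
    have t1 : Tendsto (fun ξ : ℝ => (ξ : ℂ) * cexp (-(β * ξ))) atTop (𝓝 0) := by
      rw [tendsto_zero_iff_norm_tendsto_zero]
      have := Real.tendsto_pow_mul_exp_neg_atTop_nhds_zero 1
      have h2 := (this.comp (tendsto_id.const_mul_atTop hβ)).const_mul (1 / β.re)
      rw [mul_zero] at h2
      refine h2.congr' ?_
      filter_upwards [eventually_ge_atTop 0] with ξ hξ
      rw [norm_mul, hnorm, norm_real, Real.norm_of_nonneg hξ]
      simp only [Function.comp_apply, id, pow_one]
      field_simp
    have t2 : Tendsto (fun ξ : ℝ => cexp (-(β * ξ))) atTop (𝓝 0) := by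
      rw [tendsto_zero_iff_norm_tendsto_zero]
      simp_rw [hnorm]
      exact Real.tendsto_exp_neg_atTop_nhds_zero.comp (tendsto_id.const_mul_atTop hβ)
    have h3 := (t1.const_mul (-(1 / β))).add (t2.const_mul (-(1 / β ^ 2)))
    rw [mul_zero, mul_zero, add_zero] at h3
    refine h3.congr fun ξ => ?_
    ring
  have := integral_Ioi_of_hasDerivAt_of_tendsto' hder hi hlim
  rw [this]
  simp

theorem continuous_poisson {α : ℝ} (hα : 0 < α) : Continuous (poisson α) := by
  unfold poisson
  exact continuous_const.div (by fun_prop) fun x => by positivity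

theorem integrable_poisson {α : ℝ} (hα : 0 < α) :
    Integrable fun x : ℝ => poisson α (2 * Real.pi * x) := by
  have h1 := integrable_inv_one_add_sq.comp_mul_left' (R := 2 * Real.pi / α) (by positivity)
  refine (h1.const_mul (1 / α)).congr (Eventually.of_forall fun x => ?_)
  unfold poisson
  simp only
  field_simp

theorem poisson_le {α : ℝ} (hα : 0 < α) (x : ℝ) : poisson α x ≤ 1 / α := by
  unfold poisson
  rw [div_le_div_iff₀ (by positivity) hα]
  nlinarith [sq_nonneg x]

theorem integrable_poisson_sq {α : ℝ} (hα : 0 < α) :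
    Integrable fun x : ℝ => poisson α (2 * Real.pi * x) ^ 2 := by
  have h := (integrable_poisson hα).bdd_mul (c := 1 / α) (f := fun x => poisson α (2 * Real.pi * x))
    ((continuous_poisson hα).comp (by fun_prop)).aestronglyMeasurable
    (Eventually.of_forall fun x => by
      rw [Real.norm_of_nonneg (poisson_nonneg hα.le _)]; exact poisson_le hα _)
  refine h.congr (Eventually.of_forall fun x => ?_)
  simp [sq]

theorem add_mul_I_mul_sub_mul_I (α c : ℝ) :
    ((α : ℂ) + c * I) * (α - c * I) = ((α ^ 2 + c ^ 2 : ℝ) : ℂ) := by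
  push_cast
  ring_nf
  rw [I_sq]
  ring

theorem integrableOn_exp_neg_mul {α : ℝ} (hα : 0 < α) :
    IntegrableOn (fun ξ : ℝ => Real.exp (-(α * ξ))) (Set.Ioi 0) := by
  have := exp_neg_integrableOn_Ioi 0 hα
  simpa only [neg_mul] using this

theorem integrableOn_id_mul_exp_neg_mul {α : ℝ} (hα : 0 < α) :
    IntegrableOn (fun ξ : ℝ => ξ * Real.exp (-(α * ξ))) (Set.Ioi 0) := by
  have := integrableOn_rpow_mul_exp_neg_mul_rpow (s := 1) (p := 1) (b := α) (by norm_num)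
      zero_lt_one hα
  simpa only [neg_mul, Real.rpow_one] using this

theorem integral_poisson_mul_exp {α : ℝ} (hα : 0 < α) (η : ℝ) :
    ∫ x : ℝ, ((poisson α (2 * Real.pi * x) : ℝ) : ℂ) * cexp (2 * Real.pi * x * η * I) =
      ((Real.exp (-(α * |η|)) / 2 : ℝ) : ℂ) := by
  have hi : IntegrableOn (fun ξ : ℝ => ((Real.exp (-(α * ξ)) / 2 : ℝ) : ℂ)) (Set.Ioi 0) :=
    Integrable.ofReal ((integrableOn_exp_neg_mul hα).div_const 2)
  refine integral_mul_exp_eq_of_fourier (q := fun η => ((Real.exp (-(α * |η|)) / 2 : ℝ) : ℂ))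
    (P := fun x => ((poisson α (2 * Real.pi * x) : ℝ) : ℂ))
    (by fun_prop) (integrable_comp_abs hi) (integrable_poisson hα).ofReal (fun x => ?_) η
  have hprod := add_mul_I_mul_sub_mul_I α (2 * Real.pi * x)
  push_cast at hprod
  set β : ℂ := α + 2 * Real.pi * x * I with hβ
  have hβre : β.re = α := by simp [hβ]
  set β' : ℂ := α - 2 * Real.pi * x * I with hβ'
  have hβre' : β'.re = α := by simp [hβ']
  rw [integral_even_mul_exp (g := fun ξ => Real.exp (-(α * ξ)) / 2) x (A := 1 / β / 2)
    (B := 1 / β' / 2) hi]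
  · have h0 : β ≠ 0 := fun h => by rw [h] at hβre; simp at hβre; exact hα.ne hβre
    have h0' : β' ≠ 0 := fun h => by rw [h] at hβre'; simp at hβre'; exact hα.ne hβre'
    unfold poisson
    push_cast
    rw [← hprod]
    field_simp
    rw [hβ, hβ']
    ring
  · rw [← integral_Ioi_exp_neg_mul (by rw [hβre]; exact hα), ← integral_div]
    refine setIntegral_congr_fun measurableSet_Ioi fun ξ _ => ?_
    push_cast
    rw [← mul_div_assoc, ← Complex.exp_add]
    congr 2
    rw [hβ]; ring
  · rw [← integral_Ioi_exp_neg_mul (by rw [hβre']; exact hα), ← integral_div]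
    refine setIntegral_congr_fun measurableSet_Ioi fun ξ _ => ?_
    push_cast
    rw [← mul_div_assoc, ← Complex.exp_add]
    congr 2
    rw [hβ']; ring

/-- The right-hand profile is the self-convolution of e^{−α|η|}/2, as squaring the kernel requires.
It is checked by transforming back, which reduces to β + β' = 2α and ββ' = α² + (2πx)². -/
theorem integral_poisson_sq_mul_exp {α : ℝ} (hα : 0 < α) (η : ℝ) :
    ∫ x : ℝ, ((poisson α (2 * Real.pi * x) ^ 2 : ℝ) : ℂ) * cexp (2 * Real.pi * x * η * I) =
      (((|η| + 1 / α) * Real.exp (-(α * |η|)) / 4 : ℝ) : ℂ) := by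
  have hi' : IntegrableOn (fun ξ : ℝ => (ξ + 1 / α) * Real.exp (-(α * ξ)) / 4) (Set.Ioi 0) := by
    refine Integrable.div_const ?_ 4
    refine ((integrableOn_id_mul_exp_neg_mul hα).add
      ((integrableOn_exp_neg_mul hα).const_mul (1 / α))).congr (Eventually.of_forall fun ξ => ?_)
    simp only [Pi.add_apply]
    ring
  have hi : IntegrableOn (fun ξ : ℝ => (((ξ + 1 / α) * Real.exp (-(α * ξ)) / 4 : ℝ) : ℂ))
      (Set.Ioi 0) := Integrable.ofReal hi'
  refine integral_mul_exp_eq_of_fourier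
    (q := fun η => (((|η| + 1 / α) * Real.exp (-(α * |η|)) / 4 : ℝ) : ℂ))
    (P := fun x => ((poisson α (2 * Real.pi * x) ^ 2 : ℝ) : ℂ))
    (by fun_prop) (integrable_comp_abs hi) (integrable_poisson_sq hα).ofReal (fun x => ?_) η
  have hprod := add_mul_I_mul_sub_mul_I α (2 * Real.pi * x)
  push_cast at hprod
  have hα' : (α : ℂ) ≠ 0 := by exact_mod_cast hα.ne'
  have key : ∀ β : ℂ, β.re = α → ∫ ξ in Set.Ioi (0 : ℝ),
      ((ξ : ℂ) * cexp (-(β * ξ)) + 1 / α * cexp (-(β * ξ))) = 1 / β ^ 2 + 1 / α * (1 / β) := by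
    intro β hβre
    have h1 := integral_Ioi_id_mul_exp_neg_mul (β := β) (by rw [hβre]; exact hα)
    have h2 : IntegrableOn (fun ξ : ℝ => cexp (-(β * ξ))) (Set.Ioi 0) := by
      have := integrableOn_exp_mul_complex_Ioi (a := -β) (by simpa [hβre] using hα) 0
      simpa only [neg_mul] using this
    rw [integral_add h1.1 (h2.const_mul _), h1.2, integral_const_mul,
      integral_Ioi_exp_neg_mul (by rw [hβre]; exact hα)]
  set β : ℂ := α + 2 * Real.pi * x * I with hβ
  have hβre : β.re = α := by simp [hβ]
  set β' : ℂ := α - 2 * Real.pi * x * I with hβ'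
  have hβre' : β'.re = α := by simp [hβ']
  rw [integral_even_mul_exp (g := fun ξ => (ξ + 1 / α) * Real.exp (-(α * ξ)) / 4) x
    (A := (1 / β ^ 2 + 1 / α * (1 / β)) / 4) (B := (1 / β' ^ 2 + 1 / α * (1 / β')) / 4) hi]
  · have h0 : β ≠ 0 := fun h => by rw [h] at hβre; simp at hβre; exact hα.ne hβre
    have h0' : β' ≠ 0 := fun h => by rw [h] at hβre'; simp at hβre'; exact hα.ne hβre'
    have hsum : β + β' = 2 * α := by rw [hβ, hβ']; ring
    unfold poisson
    push_cast
    rw [← hprod]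
    field_simp
    linear_combination (2 * β * β' + α * (β + β' + 2 * α)) * hsum
  · rw [← key β hβre, ← integral_div]
    refine setIntegral_congr_fun measurableSet_Ioi fun ξ _ => ?_
    push_cast
    have : cexp (-(β * ξ)) = cexp (-(2 * Real.pi * x * I) * ξ) * cexp (-(α * ξ)) := by
      rw [← Complex.exp_add]
      congr 1
      rw [hβ]; ring
    rw [this]
    ring
  · rw [← key β' hβre', ← integral_div]
    refine setIntegral_congr_fun measurableSet_Ioi fun ξ _ => ?_
    push_cast
    have : cexp (-(β' * ξ)) = cexp ((2 * Real.pi * x * I) * ξ) * cexp (-(α * ξ)) := by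
      rw [← Complex.exp_add]
      congr 1
      rw [hβ']; ring
    rw [this]
    ring

theorem integral_poisson_two_pi {α : ℝ} (hα : 0 < α) :
    ∫ x : ℝ, poisson α (2 * Real.pi * x) = 1 / 2 := by
  have h := integral_poisson_mul_exp hα 0
  simp only [ofReal_zero, mul_zero, zero_mul, Complex.exp_zero, mul_one, abs_zero, neg_zero,
    Real.exp_zero] at h
  rw [integral_complex_ofReal] at h
  exact_mod_cast h

/-- The third moment of the Poisson kernel. -/
theorem integral_poisson_cube {α : ℝ} (hα : 0 < α) :
    Integrable (fun x : ℝ => poisson α (2 * Real.pi * x) ^ 3) ∧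
    ∫ x : ℝ, poisson α (2 * Real.pi * x) ^ 3 = 3 / (16 * α ^ 2) := by
  have hInt : Integrable (fun x : ℝ => poisson α (2 * Real.pi * x) ^ 3) := by
    have h := (integrable_poisson_sq hα).bdd_mul (c := 1 / α)
      (f := fun x => poisson α (2 * Real.pi * x))
      ((continuous_poisson hα).comp (by fun_prop)).aestronglyMeasurable
      (Eventually.of_forall fun x => by
        rw [Real.norm_of_nonneg (poisson_nonneg hα.le _)]; exact poisson_le hα _)
    refine h.congr (Eventually.of_forall fun x => ?_)
    simp only
    ring
  refine ⟨hInt, ?_⟩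
  have hpi := Real.pi_pos
  set c : ℝ := 2 * Real.pi / α with hc
  have hc0 : 0 < c := by positivity
  -- In y = cx the kernel is 1/(α(1 + y²)), and the bracket is the standard antiderivative of (1 +
  -- y²)^{−3}; the prefactor combines α^{−3} with dx = α dy/(2π). Only the total mass of the cube is
  -- needed, not its transform.
  have hder : ∀ x : ℝ, HasDerivAt (fun x : ℝ => 1 / (2 * Real.pi * α ^ 2) *
      ((c * x) / (4 * (1 + (c * x) ^ 2) ^ 2) + 3 * (c * x) / (8 * (1 + (c * x) ^ 2)) +
        3 / 8 * Real.arctan (c * x))) (poisson α (2 * Real.pi * x) ^ 3) x := by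
    intro x
    have h1 : HasDerivAt (fun x : ℝ => c * x) c x := by
      simpa using (hasDerivAt_id x).const_mul c
    have h2 : HasDerivAt (fun x : ℝ => 1 + (c * x) ^ 2) (2 * (c * x) * c) x := by
      simpa using (h1.pow 2).const_add 1
    have hne : 1 + (c * x) ^ 2 ≠ 0 := by positivity
    have h3 := h1.div ((h2.pow 2).const_mul 4) (mul_ne_zero four_ne_zero (pow_ne_zero 2 hne))
    have h4 := (h1.const_mul 3).div (h2.const_mul 8) (by positivity)
    have h5 := (h1.arctan).const_mul (3 / 8)
    refine (((h3.add h4).add h5).const_mul (1 / (2 * Real.pi * α ^ 2))).congr_deriv ?_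
    have e : poisson α (2 * Real.pi * x) = 1 / α * (1 / (1 + (c * x) ^ 2)) := by
      unfold poisson
      rw [hc]
      field_simp
    have e2 : Real.pi = c * α / 2 := by rw [hc]; field_simp
    rw [e, e2]
    simp only [Pi.pow_apply]
    field_simp
    ring
  have hlin : Tendsto (fun x : ℝ => c * x) atTop atTop := tendsto_id.const_mul_atTop hc0
  have hlin' : Tendsto (fun x : ℝ => c * x) atBot atBot := tendsto_id.const_mul_atBot hc0
  have hrat : ∀ (l : Filter ℝ), Tendsto (fun y : ℝ => y⁻¹) l (𝓝 0) → (∀ᶠ y in l, y ≠ 0) →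
      Tendsto (fun y : ℝ => y / (4 * (1 + y ^ 2) ^ 2) + 3 * y / (8 * (1 + y ^ 2))) l (𝓝 0) := by
    intro l hl hl0
    have : Tendsto (fun w : ℝ => w ^ 3 / (4 * (w ^ 2 + 1) ^ 2) + 3 * w / (8 * (w ^ 2 + 1))) (𝓝 0)
        (𝓝 (0 ^ 3 / (4 * (0 ^ 2 + 1) ^ 2) + 3 * 0 / (8 * (0 ^ 2 + 1)))) := by
      refine Continuous.tendsto (Continuous.add ?_ ?_) 0
      · exact (continuous_pow 3).div (by fun_prop) fun w => by positivity
      · exact (by fun_prop : Continuous fun w : ℝ => 3 * w).div (by fun_prop) fun w => by positivity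
    norm_num at this
    refine (this.comp hl).congr' ?_
    filter_upwards [hl0] with y hy
    simp only [Function.comp_apply]
    field_simp
  have htop := ((hrat atTop tendsto_inv_atTop_zero (eventually_ne_atTop 0)).comp hlin).add
    (((Real.tendsto_arctan_atTop.mono_right nhdsWithin_le_nhds).comp hlin).const_mul (3 / 8))
  have hbot := ((hrat atBot tendsto_inv_atBot_zero (eventually_ne_atBot 0)).comp hlin').add
    (((Real.tendsto_arctan_atBot.mono_right nhdsWithin_le_nhds).comp hlin').const_mul (3 / 8))
  rw [integral_of_hasDerivAt_of_tendsto hder hInt (hbot.const_mul _) (htop.const_mul _)]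
  field_simp
  ring

/-! ### Determinantal integrals as integrals over unit cubes -/

/-- Lebesgue measure on the unit interval. -/
def unitMeasure : Measure ℝ := volume.restrict (Set.Ioc 0 1)

instance : IsProbabilityMeasure unitMeasure :=
  ⟨by simp [unitMeasure]⟩

theorem integral_unitMeasure {E : Type*} [NormedAddCommGroup E] [NormedSpace ℝ E] (f : ℝ → E) :
    ∫ x, f x ∂unitMeasure = ∫ x in (0:ℝ)..1, f x := by
  rw [intervalIntegral.integral_of_le zero_le_one]; rfl

theorem continuous_sineKernel : Continuous sineKernel :=
  Real.continuous_sinc.comp (by fun_prop)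

theorem sineKernel_neg (t : ℝ) : sineKernel (-t) = sineKernel t := by
  simp [sineKernel, mul_neg, Real.sinc_neg]

theorem sineKernel_zero : sineKernel 0 = 1 := by simp [sineKernel]

theorem abs_sineKernel_le (t : ℝ) : |sineKernel t| ≤ 1 := Real.abs_sinc_le_one _

/-- The sine kernel is the Fourier transform of the indicator of a unit interval. The interval is
[0, 1] with an explicit shift by 1/2, which cancels in products along permutations. -/
theorem sineKernel_eq_integral (t : ℝ) :
    (sineKernel t : ℂ) = ∫ η, cexp (2 * Real.pi * t * (η - 1 / 2) * I) ∂unitMeasure := by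
  rw [integral_unitMeasure]
  rcases eq_or_ne t 0 with rfl | ht
  · simp [sineKernel_zero]
  have hpi : (Real.pi : ℂ) ≠ 0 := by exact_mod_cast Real.pi_ne_zero
  have htc : (t : ℂ) ≠ 0 := by exact_mod_cast ht
  have hw : 2 * Real.pi * t * I ≠ 0 := by simp [hpi, htc]
  have hder : ∀ η : ℝ, HasDerivAt
      (fun η : ℝ => cexp (2 * Real.pi * t * (η - 1 / 2) * I) / (2 * Real.pi * t * I))
      (cexp (2 * Real.pi * t * (η - 1 / 2) * I)) η := by
    intro η
    have h1 : HasDerivAt (fun z : ℂ => 2 * Real.pi * t * (z - 1 / 2) * I)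
        (2 * Real.pi * t * I) (η : ℂ) := by
      have := (((hasDerivAt_id (η : ℂ)).sub_const (1 / 2)).const_mul
        (2 * Real.pi * t : ℂ)).mul_const I
      simpa using this
    have h2 := (h1.cexp.div_const (2 * Real.pi * t * I)).comp_ofReal
    rwa [mul_div_cancel_right₀ _ hw] at h2
  rw [intervalIntegral.integral_eq_sub_of_hasDerivAt (fun η _ => hder η)
    (Continuous.intervalIntegrable (by fun_prop) _ _)]
  have hpt : Real.pi * t ≠ 0 := mul_ne_zero Real.pi_ne_zero ht
  rw [sineKernel, Real.sinc_of_ne_zero hpt]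
  push_cast
  rw [Complex.sin]
  have e1 : 2 * Real.pi * t * ((1:ℂ) - 1 / 2) * I = Real.pi * t * I := by ring
  have e2 : 2 * Real.pi * t * ((0:ℂ) - 1 / 2) * I = -(Real.pi * t) * I := by ring
  rw [e1, e2]
  field_simp
  ring_nf
  simp

/-- A cyclic product of sine kernels integrated against a product function, expressed by the
Fourier transforms of the factors. -/
theorem integral_prod_mul_sineKernel {n : ℕ} (q : Fin n → ℝ → ℝ) (hq : ∀ j, Integrable (q j))
    (σ : Equiv.Perm (Fin n)) :
    ∫ x : Fin n → ℝ, ((∏ j, q j (x j) * sineKernel (x (σ j) - x j) : ℝ) : ℂ) =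
      ∫ η : Fin n → ℝ, ∏ j, (∫ y : ℝ, (q j y : ℂ) *
        cexp (2 * Real.pi * y * ((η (σ.symm j) - η j : ℝ) : ℂ) * I))
          ∂(Measure.pi fun _ => unitMeasure) := by
  -- Reindexing by σ moves the differences from x to η, and the shifts by 1/2 cancel. Each
  -- x-coordinate then enters through a single Fourier integral.
  have key : ∀ x η : Fin n → ℝ,
      ∏ j, ((q j (x j) : ℂ) *
        cexp (2 * Real.pi * (x (σ j) - x j : ℝ) * (η j - 1 / 2) * I)) =
      ∏ j, ((q j (x j) : ℂ) *
        cexp (2 * Real.pi * x j * ((η (σ.symm j) - η j : ℝ) : ℂ) * I)) := by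
    intro x η
    rw [Finset.prod_mul_distrib, Finset.prod_mul_distrib, ← Complex.exp_sum, ← Complex.exp_sum]
    congr 2
    have h1 : ∑ j, 2 * Real.pi * (x (σ j) : ℂ) * (η j - 1 / 2) * I =
        ∑ j, 2 * Real.pi * (x j : ℂ) * (η (σ.symm j) - 1 / 2) * I := by
      rw [← Equiv.sum_comp σ (fun j => 2 * Real.pi * (x j : ℂ) * (η (σ.symm j) - 1 / 2) * I)]
      simp
    calc _ = ∑ j, 2 * Real.pi * (x (σ j) : ℂ) * (η j - 1 / 2) * I -
          ∑ j, 2 * Real.pi * (x j : ℂ) * (η j - 1 / 2) * I := by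
          rw [← Finset.sum_sub_distrib]
          refine Finset.sum_congr rfl fun j _ => ?_
          push_cast; ring
      _ = _ := by
          rw [h1, ← Finset.sum_sub_distrib]
          refine Finset.sum_congr rfl fun j _ => ?_
          push_cast; ring
  have hL : ∀ x : Fin n → ℝ, ((∏ j, q j (x j) * sineKernel (x (σ j) - x j) : ℝ) : ℂ) =
      ∫ η : Fin n → ℝ, ∏ j, ((q j (x j) : ℂ) *
        cexp (2 * Real.pi * x j * ((η (σ.symm j) - η j : ℝ) : ℂ) * I))
          ∂(Measure.pi fun _ => unitMeasure) := by
    intro x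
    simp_rw [← key]
    rw [integral_fintype_prod_eq_prod (fun j (y : ℝ) => (q j (x j) : ℂ) *
        cexp (2 * Real.pi * (x (σ j) - x j : ℝ) * (y - 1 / 2) * I))]
    push_cast
    refine Finset.prod_congr rfl fun j _ => ?_
    rw [integral_const_mul, ← ofReal_sub, sineKernel_eq_integral]
  have hR : ∀ η : Fin n → ℝ, ∏ j, (∫ y : ℝ, (q j y : ℂ) *
        cexp (2 * Real.pi * y * ((η (σ.symm j) - η j : ℝ) : ℂ) * I)) =
      ∫ x : Fin n → ℝ, ∏ j, ((q j (x j) : ℂ) *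
        cexp (2 * Real.pi * x j * ((η (σ.symm j) - η j : ℝ) : ℂ) * I)) := by
    intro η
    rw [integral_fintype_prod_volume_eq_prod (fun j (y : ℝ) => (q j y : ℂ) *
        cexp (2 * Real.pi * y * ((η (σ.symm j) - η j : ℝ) : ℂ) * I))]
  simp_rw [hL, hR]
  -- The phases have modulus 1 and the η-measure is a probability measure, so integrability of the
  -- product of the factors q suffices for Fubini.
  refine integral_integral_swap ?_
  have h1 : Integrable (fun x : Fin n → ℝ => ∏ j, (q j (x j) : ℂ)) :=
    Integrable.fintype_prod (f := fun j (y : ℝ) => (q j y : ℂ)) (fun j => (hq j).ofReal)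
  have h2 : Integrable (fun _ : Fin n → ℝ => (1:ℂ)) (Measure.pi fun _ : Fin n => unitMeasure) :=
    integrable_const _
  have h3 := (h1.mul_prod h2).mul_bdd (c := 1)
    (g := fun z : (Fin n → ℝ) × (Fin n → ℝ) => ∏ j,
      cexp (2 * Real.pi * z.1 j * ((z.2 (σ.symm j) - z.2 j : ℝ) : ℂ) * I))
    (by refine Continuous.aestronglyMeasurable ?_; fun_prop)
    (Eventually.of_forall fun z => by
      rw [norm_prod]
      refine (Finset.prod_eq_one fun j _ => ?_).le
      rw [← Complex.norm_exp_ofReal_mul_I (2 * Real.pi * z.1 j * (z.2 (σ.symm j) - z.2 j))]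
      push_cast; rfl)
  refine h3.congr (Eventually.of_forall fun z => ?_)
  simp [Function.uncurry, Finset.prod_mul_distrib]

/-- Fubini's theorem on `ℝ^(n+1)`, singling out the first coordinate. -/
theorem integral_pi_succ {n : ℕ} {E : Type*} [NormedAddCommGroup E] [NormedSpace ℝ E]
    {μ : Measure ℝ} [SigmaFinite μ] {f : (Fin (n + 1) → ℝ) → E}
    (hf : Integrable f (Measure.pi fun _ => μ)) :
    ∫ x, f x ∂(Measure.pi fun _ => μ) =
      ∫ a, ∫ y, f (Matrix.vecCons a y) ∂(Measure.pi fun _ : Fin n => μ) ∂μ := by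
  have h := (measurePreserving_piFinSuccAbove (fun _ : Fin (n + 1) => μ) 0).symm
  rw [← h.integral_comp']
  rw [← h.integrable_comp_emb (MeasurableEquiv.measurableEmbedding _)] at hf
  refine (integral_prod _ hf).trans ?_
  simp only [Function.comp_apply, MeasurableEquiv.piFinSuccAbove_symm_apply, Fin.insertNthEquiv,
    Fin.insertNth_zero]
  rfl

theorem integrable_pi_unitMeasure {n : ℕ} {E : Type*} [NormedAddCommGroup E]
    {f : (Fin n → ℝ) → E} (hf : Continuous f) :
    Integrable f (Measure.pi fun _ => unitMeasure) := by
  have h : (Measure.pi fun _ : Fin n => unitMeasure) =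
      volume.restrict (Set.univ.pi fun _ : Fin n => Set.Ioc (0:ℝ) 1) := by
    rw [volume_pi, Measure.restrict_pi_pi]; rfl
  rw [h]
  refine hf.continuousOn.integrableOn_of_subset_isCompact
    (K := Set.univ.pi fun _ : Fin n => Set.Icc (0:ℝ) 1)
    (isCompact_univ_pi fun _ => isCompact_Icc)
    (MeasurableSet.univ_pi fun _ => measurableSet_Ioc)
    (Set.pi_mono fun _ _ => Set.Ioc_subset_Icc_self) ?_
  rw [Real.volume_pi_Ioc]; simp

theorem integral_pi_unitMeasure_two {f : (Fin 2 → ℝ) → ℝ} (hf : Continuous f) :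
    ∫ η, f η ∂(Measure.pi fun _ => unitMeasure) =
      ∫ a in (0:ℝ)..1, ∫ b in (0:ℝ)..1, f ![a, b] := by
  rw [integral_pi_succ (integrable_pi_unitMeasure hf), integral_unitMeasure]
  refine intervalIntegral.integral_congr fun a _ => ?_
  rw [integral_pi_succ (integrable_pi_unitMeasure (by fun_prop)), integral_unitMeasure]
  refine intervalIntegral.integral_congr fun b _ => ?_
  rw [integral_unique, probReal_univ, one_smul]
  congr 3

theorem integral_pi_unitMeasure_three {f : (Fin 3 → ℝ) → ℝ} (hf : Continuous f) :
    ∫ η, f η ∂(Measure.pi fun _ => unitMeasure) =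
      ∫ a in (0:ℝ)..1, ∫ b in (0:ℝ)..1, ∫ c in (0:ℝ)..1, f ![a, b, c] := by
  rw [integral_pi_succ (integrable_pi_unitMeasure hf), integral_unitMeasure]
  refine intervalIntegral.integral_congr fun a _ => ?_
  rw [integral_pi_unitMeasure_two (by fun_prop)]

/-- The integral of a product function against the determinantal density. -/
theorem integral_prod_mul_gueDensity {n : ℕ} (q : Fin n → ℝ → ℝ) (hq : ∀ j, Integrable (q j))
    (h : Fin n → ℝ → ℝ) (hh : ∀ j (ξ : ℝ), ∫ y : ℝ, (q j y : ℂ) *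
      cexp (2 * Real.pi * y * (ξ : ℂ) * I) = (h j ξ : ℂ)) :
    ∫ x : Fin n → ℝ, (∏ j, q j (x j)) * gueDensity x =
      ∑ σ : Equiv.Perm (Fin n), ((Equiv.Perm.sign σ : ℤ) : ℝ) *
        ∫ η : Fin n → ℝ, ∏ j, h j (η (σ.symm j) - η j) ∂(Measure.pi fun _ => unitMeasure) := by
  have hInt : ∀ σ : Equiv.Perm (Fin n), Integrable
      (fun x : Fin n → ℝ => ∏ j, q j (x j) * sineKernel (x (σ j) - x j)) := by
    intro σ
    have h1 : Integrable (fun x : Fin n → ℝ => ∏ j, q j (x j)) := Integrable.fintype_prod hq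
    have h2 := h1.mul_bdd (c := 1) (g := fun x : Fin n → ℝ => ∏ j, sineKernel (x (σ j) - x j))
      (by
        refine Continuous.aestronglyMeasurable ?_
        exact continuous_finsetProd _ fun j _ => continuous_sineKernel.comp (by fun_prop))
      (Eventually.of_forall fun x => by
        rw [norm_prod]
        exact Finset.prod_le_one (fun _ _ => norm_nonneg _) fun j _ => abs_sineKernel_le _)
    refine h2.congr (Eventually.of_forall fun x => ?_)
    simp [Finset.prod_mul_distrib]
  have hval : ∀ σ : Equiv.Perm (Fin n),
      ∫ x : Fin n → ℝ, ∏ j, q j (x j) * sineKernel (x (σ j) - x j) =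
        ∫ η : Fin n → ℝ, ∏ j, h j (η (σ.symm j) - η j) ∂(Measure.pi fun _ => unitMeasure) := by
    intro σ
    have := integral_prod_mul_sineKernel q hq σ
    simp_rw [hh, ← ofReal_prod] at this
    rw [integral_complex_ofReal, integral_complex_ofReal] at this
    exact_mod_cast this
  have hexp : ∀ x : Fin n → ℝ, (∏ j, q j (x j)) * gueDensity x =
      ∑ σ : Equiv.Perm (Fin n), ((Equiv.Perm.sign σ : ℤ) : ℝ) *
        ∏ j, q j (x j) * sineKernel (x (σ j) - x j) := by
    intro x
    rw [gueDensity, Matrix.det_apply', Finset.mul_sum]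
    refine Finset.sum_congr rfl fun σ _ => ?_
    rw [Finset.prod_mul_distrib]
    simp only [Matrix.of_apply]
    ring
  simp_rw [hexp]
  rw [integral_finsetSum _ fun σ _ => (hInt σ).const_mul _]
  refine Finset.sum_congr rfl fun σ _ => ?_
  rw [integral_const_mul, hval]

theorem integral_prod_mul_gueDensity_two (q h : Fin 2 → ℝ → ℝ) (hq : ∀ j, Integrable (q j))
    (hh : ∀ j (ξ : ℝ), ∫ y : ℝ, (q j y : ℂ) * cexp (2 * Real.pi * y * (ξ : ℂ) * I) = (h j ξ : ℂ))
    (hc : ∀ j, Continuous (h j)) :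
    ∫ x : Fin 2 → ℝ, (∏ j, q j (x j)) * gueDensity x =
      h 0 0 * h 1 0 - ∫ a in (0:ℝ)..1, ∫ b in (0:ℝ)..1, h 0 (b - a) * h 1 (a - b) := by
  rw [integral_prod_mul_gueDensity q hq h hh]
  have hu : (Finset.univ : Finset (Equiv.Perm (Fin 2))) = {1, Equiv.swap 0 1} := by decide
  rw [hu, Finset.sum_pair (by decide)]
  have hcont : ∀ σ : Equiv.Perm (Fin 2),
      Continuous fun η : Fin 2 → ℝ => ∏ j, h j (η (σ.symm j) - η j) := fun σ =>
    continuous_finsetProd _ fun j _ => (hc j).comp (by fun_prop)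
  rw [integral_pi_unitMeasure_two (hcont _), integral_pi_unitMeasure_two (hcont _)]
  have e1 : (Equiv.symm (1 : Equiv.Perm (Fin 2))) = 1 := rfl
  simp [Fin.prod_univ_two, e1, sub_eq_add_neg]

/-- The identity gives the cube of h(0), each of the three transpositions gives h(0) times a pair
integral with sign −1, and the two 3-cycles agree because h is even. -/
theorem integral_prod_mul_gueDensity_three (q h : ℝ → ℝ) (hq : Integrable q)
    (hh : ∀ ξ : ℝ, ∫ y : ℝ, (q y : ℂ) * cexp (2 * Real.pi * y * (ξ : ℂ) * I) = (h ξ : ℂ))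
    (hc : Continuous h) (he : ∀ ξ, h (-ξ) = h ξ) :
    ∫ x : Fin 3 → ℝ, (∏ j, q (x j)) * gueDensity x =
      h 0 ^ 3 - 3 * (h 0 * ∫ a in (0:ℝ)..1, ∫ b in (0:ℝ)..1, h (b - a) * h (a - b)) +
        2 * ∫ a in (0:ℝ)..1, ∫ b in (0:ℝ)..1, ∫ c in (0:ℝ)..1,
          h (b - a) * h (c - b) * h (a - c) := by
  rw [integral_prod_mul_gueDensity (fun _ => q) (fun _ => hq) (fun _ => h) (fun _ => hh)]
  have hu : (Finset.univ : Finset (Equiv.Perm (Fin 3))) =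
      {1, Equiv.swap 0 1, Equiv.swap 0 2, Equiv.swap 1 2, Equiv.swap 0 1 * Equiv.swap 1 2,
        Equiv.swap 1 2 * Equiv.swap 0 1} := by decide
  rw [hu, Finset.sum_insert (by decide), Finset.sum_insert (by decide),
    Finset.sum_insert (by decide), Finset.sum_insert (by decide), Finset.sum_pair (by decide)]
  have hcont : ∀ σ : Equiv.Perm (Fin 3),
      Continuous fun η : Fin 3 → ℝ => ∏ j, h (η (σ.symm j) - η j) := fun σ =>
    continuous_finsetProd _ fun j _ => hc.comp (by fun_prop)
  simp_rw [integral_pi_unitMeasure_three (hcont _)]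
  have e1 : ∀ (σ : Equiv.Perm (Fin 3)) (τ : Fin 3 → Fin 3), (∀ i, σ.symm i = τ i) →
      ∀ a b c : ℝ, ∏ j, h (![a, b, c] (σ.symm j) - ![a, b, c] j) =
        h (![a, b, c] (τ 0) - a) * h (![a, b, c] (τ 1) - b) * h (![a, b, c] (τ 2) - c) := by
    intro σ τ hτ a b c
    simp [Fin.prod_univ_three, hτ]
  -- The vectors list the values of the inverse permutations.
  simp_rw [e1 1 ![0, 1, 2] (by decide), e1 (Equiv.swap 0 1) ![1, 0, 2] (by decide),
    e1 (Equiv.swap 0 2) ![2, 1, 0] (by decide), e1 (Equiv.swap 1 2) ![0, 2, 1] (by decide),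
    e1 (Equiv.swap 0 1 * Equiv.swap 1 2) ![2, 0, 1] (by decide),
    e1 (Equiv.swap 1 2 * Equiv.swap 0 1) ![1, 2, 0] (by decide)]
  have hsym : ∀ x y : ℝ, h (x - y) = h (y - x) := fun x y => by rw [← he, neg_sub]
  have s1 : Equiv.Perm.sign (Equiv.swap (0 : Fin 3) 1) = -1 := by decide
  have s2 : Equiv.Perm.sign (Equiv.swap (0 : Fin 3) 2) = -1 := by decide
  have s3 : Equiv.Perm.sign (Equiv.swap (1 : Fin 3) 2) = -1 := by decide
  simp [s1, s2, s3]
  have hD : ∀ a b c : ℝ, h (c - a) * h (a - b) * h (b - c) = h (b - a) * h (c - b) * h (a - c) := by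
    intro a b c
    rw [hsym c a, hsym a b, hsym b c]; ring
  have e2 : ∫ a in (0:ℝ)..1, ∫ c in (0:ℝ)..1, h (c - a) * h 0 * h (a - c) =
      h 0 * ∫ a in (0:ℝ)..1, ∫ b in (0:ℝ)..1, h (b - a) * h (a - b) := by
    rw [← intervalIntegral.integral_const_mul]
    congr 1 with a
    rw [← intervalIntegral.integral_const_mul]
    congr 1 with b
    ring
  have e3 : ∫ a in (0:ℝ)..1, ∫ c in (0:ℝ)..1, h 0 * h (c - a) * h (a - c) =
      h 0 * ∫ a in (0:ℝ)..1, ∫ b in (0:ℝ)..1, h (b - a) * h (a - b) := by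
    rw [← e2]
    congr 1 with a
    congr 1 with b
    ring
  have e4 : ∫ a in (0:ℝ)..1, ∫ b in (0:ℝ)..1, ∫ c in (0:ℝ)..1, h (c - a) * h (a - b) * h (b - c) =
      ∫ a in (0:ℝ)..1, ∫ b in (0:ℝ)..1, ∫ c in (0:ℝ)..1, h (b - a) * h (c - b) * h (a - c) := by
    congr 1 with a
    congr 1 with b
    congr 1 with c
    exact hD a b c
  rw [e2, e3, e4]
  ring

/-! ### Explicit exponential integrals over the square and the cube -/

/-- All integrals below are of this kind piecewise. The integrand is kept in differentiated form, so
that a use consists in naming k, m, A and B; constants are the case k = 0, A = 0. -/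
theorem integral_exp_mul_affine (k m A B s t : ℝ) :
    ∫ x in s..t, Real.exp (k * x + m) * (k * (A + B * x) + B) =
      Real.exp (k * t + m) * (A + B * t) - Real.exp (k * s + m) * (A + B * s) := by
  rw [intervalIntegral.integral_eq_sub_of_hasDerivAt
    (f := fun x => Real.exp (k * x + m) * (A + B * x)) (fun x _ => ?_)
    (Continuous.intervalIntegrable (by fun_prop) _ _)]
  have h1 : HasDerivAt (fun x : ℝ => k * x + m) k x := by
    simpa using ((hasDerivAt_id x).const_mul k).add_const m
  have h2 : HasDerivAt (fun x : ℝ => A + B * x) B x := by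
    simpa using ((hasDerivAt_id x).const_mul B).const_add A
  refine (h1.exp.mul h2).congr_deriv ?_
  ring

theorem integral_exp_mul_affine_of_eq {k m A B s t : ℝ} {f : ℝ → ℝ} (hst : s ≤ t)
    (hf : ∀ x, s ≤ x → x ≤ t → f x = Real.exp (k * x + m) * (k * (A + B * x) + B)) :
    ∫ x in s..t, f x =
      Real.exp (k * t + m) * (A + B * t) - Real.exp (k * s + m) * (A + B * s) := by
  rw [← integral_exp_mul_affine]
  refine intervalIntegral.integral_congr fun x hx => ?_
  rw [Set.uIcc_of_le hst] at hx
  exact hf x hx.1 hx.2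

/-- The sum of the three pairwise distances is twice the spread of the three points: 2(b − c), 2(b −
a) or 2(c − a) according to whether c lies left of, between or right of a and b. -/
theorem integral_exp_triangle {α a b : ℝ} (hα : 0 < α) (ha : 0 ≤ a) (hab : a ≤ b) (hb : b ≤ 1) :
    ∫ c in (0:ℝ)..1, Real.exp (-(α * (|b - a| + |c - b| + |a - c|))) =
      Real.exp (-(2 * α * (b - a))) * (b - a + 1 / α) -
        (Real.exp (-(2 * α * b)) + Real.exp (-(2 * α * (1 - a)))) / (2 * α) := by
  have hc : Continuous fun c : ℝ => Real.exp (-(α * (|b - a| + |c - b| + |a - c|))) := by fun_prop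
  rw [← intervalIntegral.integral_add_adjacent_intervals (b := a)
      (hc.intervalIntegrable _ _) (hc.intervalIntegrable _ _),
    ← intervalIntegral.integral_add_adjacent_intervals (a := a) (b := b)
      (hc.intervalIntegrable _ _) (hc.intervalIntegrable _ _)]
  rw [integral_exp_mul_affine_of_eq (k := 2 * α) (m := -(2 * α * b)) (A := 1 / (2 * α)) (B := 0) ha,
    integral_exp_mul_affine_of_eq (k := 0) (m := -(2 * α * (b - a))) (A := 0) (B := 1) hab,
    integral_exp_mul_affine_of_eq (k := -(2 * α)) (m := 2 * α * a) (A := -1 / (2 * α)) (B := 0) hb]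
  · have e1 : 2 * α * a + -(2 * α * b) = -(2 * α * (b - a)) := by ring
    have e2 : -(2 * α) * 1 + 2 * α * a = -(2 * α * (1 - a)) := by ring
    have e3 : -(2 * α) * b + 2 * α * a = -(2 * α * (b - a)) := by ring
    have e4 : 2 * α * 0 + -(2 * α * b) = -(2 * α * b) := by ring
    rw [e1, e2, e3, e4]
    simp only [zero_mul, zero_add]
    field_simp
    ring
  · intro c h1 h2
    rw [abs_of_nonneg (by linarith), abs_of_nonneg (by linarith), abs_of_nonpos (by linarith)]
    have : -(α * (b - a + (c - b) + -(a - c))) = -(2 * α) * c + 2 * α * a := by ring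
    rw [this]
    field_simp
    ring
  · intro c h1 h2
    rw [abs_of_nonneg (by linarith), abs_of_nonpos (by linarith), abs_of_nonpos (by linarith)]
    have : -(α * (b - a + -(c - b) + -(a - c))) = 0 * c + -(2 * α * (b - a)) := by ring
    rw [this]
    ring
  · intro c h1 h2
    rw [abs_of_nonneg (by linarith), abs_of_nonpos (by linarith), abs_of_nonneg (by linarith)]
    have : -(α * (b - a + -(c - b) + (a - c))) = 2 * α * c + -(2 * α * b) := by ring
    rw [this]
    field_simp
    ring

/-- Integrating out c in the cube gives the pair integrand g minus a boundary term m, so the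
combination is −g − 2m. After the inner integration this is a sum of two exact derivatives and a
constant. The identity is what collapses the third cumulant to a single exponential. -/
theorem integral_square_cube {α : ℝ} (hα : 0 < α) :
    2 * (∫ a in (0:ℝ)..1, ∫ b in (0:ℝ)..1, ∫ c in (0:ℝ)..1,
        Real.exp (-(α * (|b - a| + |c - b| + |a - c|)))) -
      3 * (∫ a in (0:ℝ)..1, ∫ b in (0:ℝ)..1,
        (|b - a| + 1 / α) * Real.exp (-(2 * α * |b - a|))) =
      -(3 / (2 * α ^ 2)) * (1 - Real.exp (-(2 * α))) := by
  have hX : ∀ a b : ℝ, 0 ≤ a → a ≤ 1 → 0 ≤ b → b ≤ 1 →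
      ∫ c in (0:ℝ)..1, Real.exp (-(α * (|b - a| + |c - b| + |a - c|))) =
      (|b - a| + 1 / α) * Real.exp (-(2 * α * |b - a|)) -
        (Real.exp (-(2 * α * max a b)) + Real.exp (-(2 * α * (1 - min a b)))) / (2 * α) := by
    intro a b ha ha' hb hb'
    rcases le_total a b with h | h
    · rw [integral_exp_triangle hα ha h hb', abs_of_nonneg (by linarith : 0 ≤ b - a),
        max_eq_right h, min_eq_left h]
      ring
    · have : ∀ c : ℝ, |b - a| + |c - b| + |a - c| = |a - b| + |c - a| + |b - c| := by
        intro c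
        rw [abs_sub_comm b a, abs_sub_comm c b, abs_sub_comm a c]; ring
      simp_rw [this]
      rw [integral_exp_triangle hα hb h ha', abs_of_nonpos (by linarith : b - a ≤ 0),
        max_eq_left h, min_eq_right h]
      ring_nf
  set g : ℝ → ℝ → ℝ := fun a b => (|b - a| + 1 / α) * Real.exp (-(2 * α * |b - a|)) with hg
  set m : ℝ → ℝ → ℝ := fun a b =>
    (Real.exp (-(2 * α * max a b)) + Real.exp (-(2 * α * (1 - min a b)))) / (2 * α) with hm
  have hgc : Continuous (Function.uncurry g) := by
    simp only [hg]; fun_prop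
  have hmc : Continuous (Function.uncurry m) := by
    simp only [hm]; fun_prop
  have hgi : Continuous fun a => ∫ b in (0:ℝ)..1, g a b :=
    intervalIntegral.continuous_parametric_intervalIntegral_of_continuous' hgc 0 1
  have hmi : Continuous fun a => ∫ b in (0:ℝ)..1, m a b :=
    intervalIntegral.continuous_parametric_intervalIntegral_of_continuous' hmc 0 1
  have hga : ∀ a, Continuous (g a) := fun a => by simp only [hg]; fun_prop
  have hma : ∀ a, Continuous (m a) := fun a => by simp only [hm]; fun_prop
  have e1 : ∫ a in (0:ℝ)..1, ∫ b in (0:ℝ)..1, ∫ c in (0:ℝ)..1,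
        Real.exp (-(α * (|b - a| + |c - b| + |a - c|))) =
      (∫ a in (0:ℝ)..1, ∫ b in (0:ℝ)..1, g a b) - ∫ a in (0:ℝ)..1, ∫ b in (0:ℝ)..1, m a b := by
    rw [← intervalIntegral.integral_sub (hgi.intervalIntegrable _ _) (hmi.intervalIntegrable _ _)]
    refine intervalIntegral.integral_congr fun a ha => ?_
    rw [Set.uIcc_of_le zero_le_one] at ha
    rw [← intervalIntegral.integral_sub ((hga a).intervalIntegrable _ _)
      ((hma a).intervalIntegrable _ _)]
    refine intervalIntegral.integral_congr fun b hb => ?_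
    rw [Set.uIcc_of_le zero_le_one] at hb
    exact hX a b ha.1 ha.2 hb.1 hb.2
  rw [e1]
  have e2 : ∀ a ∈ Set.Icc (0:ℝ) 1, (∫ b in (0:ℝ)..1, g a b) = 3 / (2 * α ^ 2) -
      Real.exp (-(2 * α * a)) * (3 / (4 * α ^ 2) + a / (2 * α)) -
      Real.exp (-(2 * α * (1 - a))) * (3 / (4 * α ^ 2) + (1 - a) / (2 * α)) := by
    intro a ha
    rw [← intervalIntegral.integral_add_adjacent_intervals (b := a)
      ((hga a).intervalIntegrable _ _) ((hga a).intervalIntegrable _ _)]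
    rw [integral_exp_mul_affine_of_eq (k := 2 * α) (m := -(2 * α * a))
        (A := a / (2 * α) + 3 / (4 * α ^ 2)) (B := -(1 / (2 * α))) ha.1,
      integral_exp_mul_affine_of_eq (k := -(2 * α)) (m := 2 * α * a)
        (A := a / (2 * α) - 3 / (4 * α ^ 2)) (B := -(1 / (2 * α))) ha.2]
    · have e1 : 2 * α * a + -(2 * α * a) = 0 := by ring
      have e2 : -(2 * α) * 1 + 2 * α * a = -(2 * α * (1 - a)) := by ring
      have e3 : -(2 * α) * a + 2 * α * a = 0 := by ring
      have e4 : 2 * α * 0 + -(2 * α * a) = -(2 * α * a) := by ring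
      rw [e1, e2, e3, e4, Real.exp_zero]
      field_simp
      ring
    · intro b h1 h2
      simp only [hg]
      rw [abs_of_nonneg (by linarith)]
      have : -(2 * α * (b - a)) = -(2 * α) * b + 2 * α * a := by ring
      rw [this]
      field_simp
      ring
    · intro b h1 h2
      simp only [hg]
      rw [abs_of_nonpos (by linarith)]
      have : -(2 * α * -(b - a)) = 2 * α * b + -(2 * α * a) := by ring
      rw [this]
      field_simp
      ring
  have e3 : ∀ a ∈ Set.Icc (0:ℝ) 1, (∫ b in (0:ℝ)..1, m a b) =
      (Real.exp (-(2 * α * a)) * (a + 1 / (2 * α)) +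
        Real.exp (-(2 * α * (1 - a))) * (1 - a + 1 / (2 * α)) -
          Real.exp (-(2 * α)) / α) / (2 * α) := by
    intro a ha
    have h1 : ∀ b : ℝ, m a b = (2 * α)⁻¹ * (Real.exp (-(2 * α * max a b))) +
        (2 * α)⁻¹ * Real.exp (-(2 * α * (1 - min a b))) := by
      intro b; simp only [hm]; field_simp
    have c1 : Continuous fun b => Real.exp (-(2 * α * max a b)) := by fun_prop
    have c2 : Continuous fun b => Real.exp (-(2 * α * (1 - min a b))) := by fun_prop
    simp_rw [h1]
    rw [intervalIntegral.integral_add ((c1.const_mul _).intervalIntegrable _ _)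
      ((c2.const_mul _).intervalIntegrable _ _), intervalIntegral.integral_const_mul,
      intervalIntegral.integral_const_mul,
      ← intervalIntegral.integral_add_adjacent_intervals (b := a)
        (c1.intervalIntegrable _ _) (c1.intervalIntegrable _ _),
      ← intervalIntegral.integral_add_adjacent_intervals (b := a)
        (c2.intervalIntegrable _ _) (c2.intervalIntegrable _ _)]
    rw [integral_exp_mul_affine_of_eq (k := 0) (m := -(2 * α * a)) (A := 0) (B := 1) ha.1,
      integral_exp_mul_affine_of_eq (k := -(2 * α)) (m := 0) (A := -1 / (2 * α)) (B := 0) ha.2,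
      integral_exp_mul_affine_of_eq (k := 2 * α) (m := -(2 * α)) (A := 1 / (2 * α)) (B := 0) ha.1,
      integral_exp_mul_affine_of_eq (k := 0) (m := -(2 * α * (1 - a))) (A := 0) (B := 1) ha.2]
    · have e1 : 2 * α * a + -(2 * α) = -(2 * α * (1 - a)) := by ring
      have e2 : -(2 * α) * 1 + 0 = -(2 * α) := by ring
      have e3 : -(2 * α) * a + 0 = -(2 * α * a) := by ring
      have e4 : 2 * α * 0 + -(2 * α) = -(2 * α) := by ring
      rw [e1, e2, e3, e4]
      simp only [zero_mul, zero_add]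
      field_simp
      ring
    · intro b h1 h2
      rw [min_eq_left h1]
      ring_nf
    · intro b h1 h2
      rw [min_eq_right h2]
      have : -(2 * α * (1 - b)) = 2 * α * b + -(2 * α) := by ring
      rw [this]
      field_simp
      ring
    · intro b h1 h2
      rw [max_eq_right h1]
      have : -(2 * α * b) = -(2 * α) * b + 0 := by ring
      rw [this]
      field_simp
      ring
    · intro b h1 h2
      rw [max_eq_left h2]
      ring_nf
  have e4 : 2 * ((∫ a in (0:ℝ)..1, ∫ b in (0:ℝ)..1, g a b) -
        ∫ a in (0:ℝ)..1, ∫ b in (0:ℝ)..1, m a b) -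
      3 * (∫ a in (0:ℝ)..1, ∫ b in (0:ℝ)..1, g a b) =
      ∫ a in (0:ℝ)..1, ((∫ b in (0:ℝ)..1, g a b) * (-1) + (∫ b in (0:ℝ)..1, m a b) * (-2)) := by
    rw [intervalIntegral.integral_add ((hgi.mul_const _).intervalIntegrable _ _)
      ((hmi.mul_const _).intervalIntegrable _ _), intervalIntegral.integral_mul_const,
      intervalIntegral.integral_mul_const]
    ring
  rw [e4]
  -- The remaining terms are arranged as the derivatives of e^{−2αa} a/(4α²) and of e^{−2α(1−a)}(a −
  -- 1)/(4α²), plus a constant.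
  have e5 : ∫ a in (0:ℝ)..1, ((∫ b in (0:ℝ)..1, g a b) * (-1) + (∫ b in (0:ℝ)..1, m a b) * (-2)) =
      ∫ a in (0:ℝ)..1, ((Real.exp (-(2 * α) * a + 0) *
          (-(2 * α) * (0 + 1 / (4 * α ^ 2) * a) + 1 / (4 * α ^ 2)) +
        Real.exp (2 * α * a + -(2 * α)) *
          (2 * α * (-1 / (4 * α ^ 2) + 1 / (4 * α ^ 2) * a) + 1 / (4 * α ^ 2))) +
        (Real.exp (-(2 * α)) / α ^ 2 - 3 / (2 * α ^ 2))) := by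
    refine intervalIntegral.integral_congr fun a ha => ?_
    rw [Set.uIcc_of_le zero_le_one] at ha
    rw [e2 a ha, e3 a ha]
    have e1 : -(2 * α) * a + 0 = -(2 * α * a) := by ring
    have e2 : 2 * α * a + -(2 * α) = -(2 * α * (1 - a)) := by ring
    rw [e1, e2]
    field_simp
    ring
  rw [e5, intervalIntegral.integral_add (Continuous.intervalIntegrable (by fun_prop) _ _)
    (Continuous.intervalIntegrable (by fun_prop) _ _),
    intervalIntegral.integral_add (Continuous.intervalIntegrable (by fun_prop) _ _)
    (Continuous.intervalIntegrable (by fun_prop) _ _), integral_exp_mul_affine,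
    integral_exp_mul_affine]
  simp
  field_simp
  ring

/-! ### Limiting moments under GUE -/

theorem continuous_gueDensity {n : ℕ} : Continuous (gueDensity (n := n)) := by
  refine Continuous.matrix_det (continuous_matrix fun i j => ?_)
  exact continuous_sineKernel.comp (by fun_prop)

theorem abs_gueDensity_le {n : ℕ} (x : Fin n → ℝ) : |gueDensity x| ≤ n.factorial := by
  rw [gueDensity, Matrix.det_apply']
  refine (Finset.abs_sum_le_sum_abs _ _).trans ?_
  refine (Finset.sum_le_card_nsmul _ _ 1 fun σ _ => ?_).trans ?_
  · rw [abs_mul, Finset.abs_prod]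
    refine mul_le_one₀ (le_of_eq ?_) (Finset.prod_nonneg fun _ _ => abs_nonneg _)
      (Finset.prod_le_one (fun _ _ => abs_nonneg _) fun j _ => abs_sineKernel_le _)
    rcases Int.units_eq_one_or (Equiv.Perm.sign σ) with h | h <;> simp [h]
  · simp [Fintype.card_perm]

theorem integrable_mul_gueDensity {n : ℕ} {f : (Fin n → ℝ) → ℝ} (hf : Integrable f) :
    Integrable fun x => f x * gueDensity x :=
  hf.mul_bdd (c := n.factorial) continuous_gueDensity.aestronglyMeasurable
    (Eventually.of_forall abs_gueDensity_le)

/-- The limiting third moment of the linear statistic of `φ`. -/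
def gueThirdMoment (φ : ℝ → ℝ) : ℝ :=
  (∫ x, φ x ^ 3) + 3 / 2 * (∫ x : Fin 2 → ℝ,
    (φ (x 0) ^ 2 * φ (x 1) + φ (x 0) * φ (x 1) ^ 2) * gueDensity x) +
    ∫ x : Fin 3 → ℝ, (∏ i, φ (x i)) * gueDensity x

/-- The limiting second moment of the linear statistic of `φ`. -/
def gueSecondMoment (φ : ℝ → ℝ) : ℝ :=
  (∫ x, φ x ^ 2) + ∫ x : Fin 2 → ℝ, (∏ i, φ (x i)) * gueDensity x

/-- The left side is the limiting expectation of (S − 1/2)³, and S has mean ∫ p = 1/2, so products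
involving a factor h(0) cancel and the third cumulant is left: ∫ p³, minus three pair integrals,
plus twice the triple one. By `integral_square_cube` the last two add −(3/(16α²))(1 − e^{−2α}) to ∫
p³ = 3/(16α²). -/
theorem gue_cumulant_poisson {α : ℝ} (hα : 0 < α) :
    gueThirdMoment (fun x => poisson α (2 * Real.pi * x)) -
      3 / 2 * gueSecondMoment (fun x => poisson α (2 * Real.pi * x)) +
      3 / 4 * (∫ x, poisson α (2 * Real.pi * x)) - 1 / 8 =
    3 * Real.exp (-(2 * α)) / (16 * α ^ 2) := by
  set p : ℝ → ℝ := fun x => poisson α (2 * Real.pi * x) with hp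
  set h1 : ℝ → ℝ := fun η => Real.exp (-(α * |η|)) / 2 with hh1
  set h2 : ℝ → ℝ := fun η => (|η| + 1 / α) * Real.exp (-(α * |η|)) / 4 with hh2
  have c1 : Continuous h1 := by simp only [hh1]; fun_prop
  have c2 : Continuous h2 := by simp only [hh2]; fun_prop
  have f1 : ∀ ξ : ℝ, ∫ y : ℝ, (p y : ℂ) * cexp (2 * Real.pi * y * (ξ : ℂ) * I) = (h1 ξ : ℂ) :=
    fun ξ => integral_poisson_mul_exp hα ξ
  have f2 : ∀ ξ : ℝ, ∫ y : ℝ, ((p y ^ 2 : ℝ) : ℂ) * cexp (2 * Real.pi * y * (ξ : ℂ) * I) =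
      (h2 ξ : ℂ) := fun ξ => integral_poisson_sq_mul_exp hα ξ
  have i1 : Integrable p := integrable_poisson hα
  have i2 : Integrable fun x => p x ^ 2 := integrable_poisson_sq hα
  have m2 := integral_prod_mul_gueDensity_two (fun _ => p) (fun _ => h1) (fun _ => i1)
    (fun _ => f1) (fun _ => c1)
  have m21 := integral_prod_mul_gueDensity_two ![fun x => p x ^ 2, p] ![h2, h1]
    (by intro j; fin_cases j <;> assumption) (by intro j; fin_cases j <;> assumption)
    (by intro j; fin_cases j <;> assumption)
  have m12 := integral_prod_mul_gueDensity_two ![p, fun x => p x ^ 2] ![h1, h2]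
    (by intro j; fin_cases j <;> assumption) (by intro j; fin_cases j <;> assumption)
    (by intro j; fin_cases j <;> assumption)
  have j21 := integrable_mul_gueDensity (Integrable.fintype_prod (f := ![fun x => p x ^ 2, p])
    (μ := fun _ => volume) (by intro j; fin_cases j <;> assumption))
  have j12 := integrable_mul_gueDensity (Integrable.fintype_prod (f := ![p, fun x => p x ^ 2])
    (μ := fun _ => volume) (by intro j; fin_cases j <;> assumption))
  have m3 := integral_prod_mul_gueDensity_three p h1 i1 f1 c1 (fun ξ => by simp [hh1])
  have hsq : ∫ x, p x ^ 2 = h2 0 := by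
    have := f2 0
    simp only [ofReal_zero, mul_zero, zero_mul, Complex.exp_zero, mul_one] at this
    rw [integral_complex_ofReal] at this
    exact_mod_cast this
  simp only [Fin.prod_univ_two, Matrix.cons_val_zero, Matrix.cons_val_one] at m21 m12 j21 j12
  have msum : ∫ x : Fin 2 → ℝ, (p (x 0) ^ 2 * p (x 1) + p (x 0) * p (x 1) ^ 2) * gueDensity x =
      (∫ x : Fin 2 → ℝ, p (x 0) ^ 2 * p (x 1) * gueDensity x) +
        ∫ x : Fin 2 → ℝ, p (x 0) * p (x 1) ^ 2 * gueDensity x := by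
    rw [← integral_add j21 j12]
    simp_rw [add_mul]
  have J' : ∫ a in (0:ℝ)..1, ∫ b in (0:ℝ)..1, h1 (b - a) * h2 (a - b) =
      ∫ a in (0:ℝ)..1, ∫ b in (0:ℝ)..1, h2 (b - a) * h1 (a - b) := by
    congr 1 with a
    congr 1 with b
    simp only [hh1, hh2]
    rw [abs_sub_comm a b]
    ring
  have J : ∫ a in (0:ℝ)..1, ∫ b in (0:ℝ)..1, h2 (b - a) * h1 (a - b) =
      1 / 8 * ∫ a in (0:ℝ)..1, ∫ b in (0:ℝ)..1,
        (|b - a| + 1 / α) * Real.exp (-(2 * α * |b - a|)) := by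
    rw [← intervalIntegral.integral_const_mul]
    congr 1 with a
    rw [← intervalIntegral.integral_const_mul]
    congr 1 with b
    simp only [hh1, hh2]
    rw [abs_sub_comm a b]
    have : Real.exp (-(2 * α * |b - a|)) = Real.exp (-(α * |b - a|)) * Real.exp (-(α * |b - a|)) := by
      rw [← Real.exp_add]; ring_nf
    rw [this]; ring
  have D : ∫ a in (0:ℝ)..1, ∫ b in (0:ℝ)..1, ∫ c in (0:ℝ)..1,
        h1 (b - a) * h1 (c - b) * h1 (a - c) =
      1 / 8 * ∫ a in (0:ℝ)..1, ∫ b in (0:ℝ)..1, ∫ c in (0:ℝ)..1,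
        Real.exp (-(α * (|b - a| + |c - b| + |a - c|))) := by
    rw [← intervalIntegral.integral_const_mul]
    congr 1 with a
    rw [← intervalIntegral.integral_const_mul]
    congr 1 with b
    rw [← intervalIntegral.integral_const_mul]
    congr 1 with c
    simp only [hh1]
    rw [mul_add, mul_add, neg_add, neg_add, Real.exp_add, Real.exp_add]
    ring
  have key := integral_square_cube hα
  rw [J', J] at m12
  rw [J] at m21
  rw [D] at m3
  have h10 : h1 0 = 1 / 2 := by simp [hh1]
  rw [gueThirdMoment, gueSecondMoment, msum, m2, m21, m12, m3, hsq, h10,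
    show ∫ x, p x = 1 / 2 from integral_poisson_two_pi hα,
    show ∫ x, p x ^ 3 = 3 / (16 * α ^ 2) from (integral_poisson_cube hα).2]
  have : 3 * Real.exp (-(2 * α)) / (16 * α ^ 2) = 3 / (16 * α ^ 2) +
    1 / 8 * (-(3 / (2 * α ^ 2)) * (1 - Real.exp (-(2 * α)))) := by
    field_simp; ring
  rw [this, ← key]
  ring

/-! ### Sums over tuples of distinct indices -/

section Combinatorics

variable {ι : Type*} [Fintype ι] [DecidableEq ι]

theorem sum_embedding_eq {n : ℕ} (F : (Fin n → ι) → ℝ) :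
    ∑ v : Fin n ↪ ι, F v = ∑ w : Fin n → ι, if Function.Injective w then F w else 0 := by
  classical
  rw [← Finset.sum_filter, ← Finset.sum_subtype_eq_sum_filter]
  rw [← (Equiv.subtypeInjectiveEquivEmbedding (Fin n) ι).sum_comp]
  exact Finset.sum_congr (by ext; simp) fun _ _ => rfl

theorem sum_embedding_two (F : ι → ι → ℝ) :
    ∑ v : Fin 2 ↪ ι, F (v 0) (v 1) = ∑ a, ∑ b, if a ≠ b then F a b else 0 := by
  rw [sum_embedding_eq (fun w => F (w 0) (w 1)), ← (finTwoArrowEquiv ι).symm.sum_comp,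
    Fintype.sum_prod_type]
  refine Finset.sum_congr rfl fun a _ => Finset.sum_congr rfl fun b _ => ?_
  have : Function.Injective ((finTwoArrowEquiv ι).symm (a, b)) ↔ a ≠ b := by
    constructor
    · intro h hab
      have := @h 0 1 (by simp [finTwoArrowEquiv, hab])
      simp at this
    · intro h i j hij
      fin_cases i <;> fin_cases j <;> simp_all [finTwoArrowEquiv]
  simp only [this]
  rfl

theorem sum_embedding_three (F : ι → ι → ι → ℝ) :
    ∑ v : Fin 3 ↪ ι, F (v 0) (v 1) (v 2) =
      ∑ a, ∑ b, ∑ c, if a ≠ b ∧ a ≠ c ∧ b ≠ c then F a b c else 0 := by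
  rw [sum_embedding_eq (fun w => F (w 0) (w 1) (w 2)),
    ← (Fin.consEquiv (fun _ : Fin 3 => ι)).sum_comp, Fintype.sum_prod_type]
  refine Finset.sum_congr rfl fun a _ => ?_
  rw [← (finTwoArrowEquiv ι).symm.sum_comp, Fintype.sum_prod_type]
  refine Finset.sum_congr rfl fun b _ => Finset.sum_congr rfl fun c _ => ?_
  have : Function.Injective (Fin.consEquiv (fun _ : Fin 3 => ι)
      (a, (finTwoArrowEquiv ι).symm (b, c))) ↔ a ≠ b ∧ a ≠ c ∧ b ≠ c := by
    constructor
    · intro h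
      refine ⟨fun e => ?_, fun e => ?_, fun e => ?_⟩
      · exact absurd (@h 0 1 e) (by decide)
      · exact absurd (@h 0 2 e) (by decide)
      · exact absurd (@h 1 2 e) (by decide)
    · rintro ⟨h1, h2, h3⟩ i j hij
      fin_cases i <;> fin_cases j <;> first | rfl | exact absurd hij ‹_› | exact absurd hij.symm ‹_›
  simp only [this]
  rfl

theorem sum_sq_eq (x : ι → ℝ) :
    (∑ a, x a) ^ 2 = (∑ v : Fin 2 ↪ ι, ∏ i, x (v i)) + ∑ a, x a ^ 2 := by
  simp only [Fin.prod_univ_two]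
  rw [sum_embedding_two (fun a b => x a * x b), sq, Finset.sum_mul_sum, ← Finset.sum_add_distrib]
  refine Finset.sum_congr rfl fun a _ => ?_
  have : x a ^ 2 = ∑ b, if a = b then x a * x b else 0 := by simp [sq]
  rw [this, ← Finset.sum_add_distrib]
  refine Finset.sum_congr rfl fun b _ => ?_
  by_cases h : a = b <;> simp [h]

/-- Triples are split by coincidence of indices. The contribution 3 ∑ x_a² x_b of pairs is written
in symmetrised form with coefficient 3/2, because correlations are available only for symmetric test
functions. -/
theorem sum_cube_eq (x : ι → ℝ) :
    (∑ a, x a) ^ 3 = (∑ v : Fin 3 ↪ ι, ∏ i, x (v i)) +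
      3 / 2 * (∑ v : Fin 2 ↪ ι, (x (v 0) ^ 2 * x (v 1) + x (v 0) * x (v 1) ^ 2)) +
      ∑ a, x a ^ 3 := by
  simp only [Fin.prod_univ_three]
  rw [sum_embedding_three (fun a b c => x a * x b * x c),
    sum_embedding_two (fun a b => x a ^ 2 * x b + x a * x b ^ 2)]
  have hsw' : ∑ a, ∑ b, (if a ≠ b then x a * x b ^ 2 else 0) =
        ∑ a, ∑ b, if a ≠ b then x a ^ 2 * x b else 0 := by
    rw [Finset.sum_comm]
    refine Finset.sum_congr rfl fun a _ => Finset.sum_congr rfl fun b _ => ?_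
    simp only [ne_comm (a := b), mul_comm (x b)]
  have hsw : ∑ a, ∑ b, (if a ≠ b then x a ^ 2 * x b + x a * x b ^ 2 else 0) =
      2 * ∑ a, ∑ b, if a ≠ b then x a ^ 2 * x b else 0 := by
    rw [two_mul]
    nth_rewrite 2 [← hsw']
    simp_rw [← Finset.sum_add_distrib]
    refine Finset.sum_congr rfl fun a _ => Finset.sum_congr rfl fun b _ => ?_
    split_ifs <;> simp
  rw [hsw]
  have h3 : (∑ a, x a) ^ 3 = ∑ a, ∑ b, ∑ c, x a * x b * x c := by
    rw [pow_succ, sq, Finset.sum_mul_sum, Finset.sum_mul]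
    refine Finset.sum_congr rfl fun a _ => ?_
    rw [Finset.sum_mul]
    refine Finset.sum_congr rfl fun b _ => ?_
    rw [Finset.mul_sum]
  -- For a ≠ b the index c is distinct from both, equal to a, or equal to b; for a = b it is left
  -- free and split afterwards.
  have hin : ∀ a b, ∑ c, x a * x b * x c =
      (∑ c, if a ≠ b ∧ a ≠ c ∧ b ≠ c then x a * x b * x c else 0) +
      ((if a ≠ b then x a ^ 2 * x b else 0) + (if a ≠ b then x a * x b ^ 2 else 0) +
      if a = b then ∑ c, x a ^ 2 * x c else 0) := by
    intro a b
    by_cases h : a = b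
    · subst h
      simp [sq]
    · have e : ∀ c, x a * x b * x c = (if a ≠ b ∧ a ≠ c ∧ b ≠ c then x a * x b * x c else 0) +
          ((if c = a then x a * x b * x c else 0) + if c = b then x a * x b * x c else 0) := by
        intro c
        by_cases h1 : c = a
        · subst h1; simp [h]
        · by_cases h2 : c = b
          · subst h2; simp [h1]
          · simp [h, h1, h2, Ne.symm h1, Ne.symm h2]
      rw [Finset.sum_congr rfl fun c _ => e c, Finset.sum_add_distrib, Finset.sum_add_distrib]
      simp [h]
      ring
  rw [h3]
  simp_rw [hin, Finset.sum_add_distrib]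
  have hd : ∑ a, ∑ b, (if a = b then ∑ c, x a ^ 2 * x c else 0) =
      (∑ a, ∑ b, if a ≠ b then x a ^ 2 * x b else 0) + ∑ a, x a ^ 3 := by
    rw [← Finset.sum_add_distrib]
    refine Finset.sum_congr rfl fun a _ => ?_
    have : x a ^ 3 = ∑ b, if a = b then x a ^ 2 * x b else 0 := by simp; ring
    rw [this, ← Finset.sum_add_distrib, Finset.sum_ite_eq, if_pos (Finset.mem_univ _)]
    refine Finset.sum_congr rfl fun b _ => ?_
    by_cases h : a = b <;> simp [h]
  rw [hd, hsw']
  ring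

end Combinatorics

/-! ### Integrals of translation invariant functions -/

theorem gueDensity_add_const {n : ℕ} (x : Fin n → ℝ) (t : ℝ) :
    gueDensity (x + fun _ => t) = gueDensity x := by
  simp [gueDensity]

theorem gueDensity_neg {n : ℕ} (x : Fin n → ℝ) : gueDensity (-x) = gueDensity x := by
  unfold gueDensity
  congr 1
  ext i j
  simp only [Matrix.of_apply, Pi.neg_apply]
  rw [← sineKernel_neg]
  congr 1
  ring

theorem gueDensity_const_sub {n : ℕ} (x : Fin n → ℝ) (t : ℝ) :
    gueDensity (fun i => t - x i) = gueDensity x := by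
  rw [← gueDensity_neg x, ← gueDensity_add_const (-x) t]
  congr 1
  ext i
  simp
  ring

/-- The substitution has matrix I + 11ᵀ, of determinant n + 1. -/
theorem integral_comp_add_sum {n : ℕ} {E : Type*} [NormedAddCommGroup E] [NormedSpace ℝ E]
    (g : (Fin n → ℝ) → E) :
    ((n : ℝ) + 1) • ∫ y : Fin n → ℝ, g (fun i => y i + ∑ j, y j) = ∫ y, g y := by
  set M : Matrix (Fin n) (Fin n) ℝ :=
    1 + Matrix.replicateCol Unit (fun _ => (1:ℝ)) * Matrix.replicateRow Unit (fun _ => (1:ℝ)) with hM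
  have hdet : M.det = n + 1 := by
    rw [hM, Matrix.det_one_add_replicateCol_mul_replicateRow]
    simp [dotProduct, add_comm]
  have hn : (0:ℝ) < n + 1 := by positivity
  have happ : ∀ y : Fin n → ℝ, Matrix.toLin' M y = fun i => y i + ∑ j, y j := by
    intro y
    ext i
    simp [hM, Matrix.mulVec, dotProduct, Matrix.mul_apply]
  have hdet' : LinearMap.det (Matrix.toLin' M) ≠ 0 := by
    rw [LinearMap.det_toLin', hdet]; exact hn.ne'
  have hmap := Real.map_linearMap_volume_pi_eq_smul_volume_pi hdet'
  set e := (LinearMap.equivOfDetNeZero _ hdet').toContinuousLinearEquiv with he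
  have hme : MeasurableEmbedding (Matrix.toLin' M) :=
    e.toHomeomorph.measurableEmbedding
  have := hme.integral_map (μ := volume) g
  rw [hmap, integral_smul_measure, LinearMap.det_toLin', hdet] at this
  simp_rw [happ] at this
  rw [← this, abs_of_pos (by positivity), ENNReal.toReal_ofReal (by positivity), smul_smul,
    mul_inv_cancel₀ hn.ne', one_smul]

/-- Translating by the sum of the free coordinates moves the hyperplane of mean zero to the slice
with first coordinate 0; the Jacobian cancels the factor n + 1 that came from the delta function. -/
theorem meanZeroIntegral_of_translation {n : ℕ} {H : (Fin (n + 1) → ℝ) → ℝ}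
    (hH : ∀ x t, H (x + fun _ => t) = H x) :
    meanZeroIntegral n H = ∫ w : Fin n → ℝ, H (Matrix.vecCons 0 w) := by
  rw [meanZeroIntegral, ← integral_comp_add_sum fun w => H (Matrix.vecCons 0 w), smul_eq_mul]
  congr 2 with y
  rw [← hH _ (∑ j, y j)]
  congr 1
  ext i
  refine Fin.cases ?_ (fun i => ?_) i <;> simp

/-- Fubini in the sheared coordinates (τ, xᵢ − τ): slice first, diagonal direction second. -/
theorem integral_integral_vecCons {n : ℕ} {G : (Fin (n + 1) → ℝ) → ℝ} (hG : Continuous G)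
    (hs : HasCompactSupport G) :
    ∫ w : Fin n → ℝ, ∫ τ : ℝ, G (Matrix.vecCons τ fun i => τ + w i) = ∫ x, G x := by
  have hcons : Continuous fun z : (Fin n → ℝ) × ℝ => G (Matrix.vecCons z.2 fun i => z.2 + z.1 i) := by
    refine hG.comp ?_
    refine continuous_pi fun i => ?_
    refine Fin.cases ?_ (fun i => ?_) i
    · simpa using continuous_snd
    · simp only [Matrix.cons_val_succ]; fun_prop
  have hInt : Integrable
      (fun z : (Fin n → ℝ) × ℝ => G (Matrix.vecCons z.2 fun i => z.2 + z.1 i)) := by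
    obtain ⟨R, hR⟩ := hs.isCompact.isBounded.subset_closedBall 0
    refine hcons.integrable_of_hasCompactSupport
      (HasCompactSupport.intro (K := Metric.closedBall 0 (2 * |R|) ×ˢ Metric.closedBall 0 |R|)
        ((isCompact_closedBall _ _).prod (isCompact_closedBall _ _)) fun z hz => ?_)
    by_contra hne
    refine hz ?_
    have hmem := hR (subset_tsupport _ hne)
    rw [mem_closedBall_zero_iff] at hmem
    have h0 : |z.2| ≤ R := by simpa using (norm_le_pi_norm _ 0).trans hmem
    have hi : ∀ i : Fin n, |z.2 + z.1 i| ≤ R := fun i => by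
      simpa using (norm_le_pi_norm _ i.succ).trans hmem
    have hR0 : 0 ≤ R := (abs_nonneg _).trans h0
    rw [abs_of_nonneg hR0]
    refine ⟨?_, by simpa using h0⟩
    rw [mem_closedBall_zero_iff, pi_norm_le_iff_of_nonneg (by positivity)]
    intro i
    rw [Real.norm_eq_abs, show z.1 i = (z.2 + z.1 i) - z.2 by ring]
    exact (abs_sub _ _).trans (by linarith [hi i])
  have hsucc := integral_pi_succ (μ := volume) (f := G)
    (by rw [← volume_pi]; exact hG.integrable_of_hasCompactSupport hs)
  simp only [← volume_pi] at hsucc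
  rw [integral_integral_swap hInt, hsucc]
  congr 1 with τ
  have := integral_add_left_eq_self (μ := (volume : Measure (Fin n → ℝ)))
    (fun w => G (Matrix.vecCons τ w)) (fun _ => τ)
  exact this

/-! ### Diagonal averages as test functions -/

/-- Average of `Φ` along the diagonal; a translation invariant function. -/
def diagonalAverage {n : ℕ} (Φ : (Fin n → ℝ) → ℝ) (x : Fin n → ℝ) : ℝ :=
  ∫ τ : ℝ, Φ fun i => τ - x i

theorem diagonalAverage_add_const {n : ℕ} (Φ : (Fin n → ℝ) → ℝ) (x : Fin n → ℝ) (t : ℝ) :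
    diagonalAverage Φ (x + fun _ => t) = diagonalAverage Φ x := by
  unfold diagonalAverage
  rw [← integral_add_right_eq_self _ t]
  congr 1 with τ
  congr 1 with i
  simp

/-- The hyperplane and the diagonal direction together recover the whole space, and the density is
constant along diagonals. The average evaluates Φ at τ − x, so w is replaced by −w and invariance of
the density under reflection is used. -/
theorem meanZeroIntegral_diagonalAverage {n : ℕ} {Φ : (Fin (n + 1) → ℝ) → ℝ} (hΦ : Continuous Φ)
    (hs : HasCompactSupport Φ) :
    meanZeroIntegral n (fun x => diagonalAverage Φ x * gueDensity x) =
      ∫ x, Φ x * gueDensity x := by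
  rw [meanZeroIntegral_of_translation fun x t => by
    rw [diagonalAverage_add_const, gueDensity_add_const]]
  rw [← integral_integral_vecCons (G := fun x => Φ x * gueDensity x) (hΦ.mul continuous_gueDensity) hs.mul_right,
    ← integral_neg_eq_self]
  congr 1 with w
  rw [diagonalAverage, ← integral_mul_const]
  congr 1 with τ
  have h1 : (fun i => τ - (Matrix.vecCons 0 (-w) : Fin (n + 1) → ℝ) i) =
      Matrix.vecCons τ fun i => τ + w i := by
    ext i
    refine Fin.cases ?_ (fun i => ?_) i <;> simp
  rw [h1, ← gueDensity_const_sub _ τ, h1]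

theorem exists_bound_of_hasCompactSupport {n : ℕ} {Φ : (Fin n → ℝ) → ℝ}
    (hs : HasCompactSupport Φ) : ∃ R : ℝ, 0 ≤ R ∧ ∀ x, Φ x ≠ 0 → ∀ i, |x i| ≤ R := by
  obtain ⟨R, hR⟩ := hs.isCompact.isBounded.subset_closedBall 0
  refine ⟨|R|, abs_nonneg _, fun x hx i => ?_⟩
  have := hR (subset_tsupport _ hx)
  rw [mem_closedBall_zero_iff] at this
  exact ((norm_le_pi_norm x i).trans this).trans (le_abs_self R)

/-- The average is a convolution with the constant 1 depending on the parameter x. Recentring τ at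
the first coordinate makes the support in τ lie in one compact interval for all x, as the parametric
smoothness theorem requires. -/
theorem contDiff_diagonalAverage {n : ℕ} {Φ : (Fin (n + 1) → ℝ) → ℝ} (hΦ : ContDiff ℝ ∞ Φ)
    (hs : HasCompactSupport Φ) : ContDiff ℝ ∞ (diagonalAverage Φ) := by
  obtain ⟨R, hR0, hR⟩ := exists_bound_of_hasCompactSupport hs
  set g : (Fin (n + 1) → ℝ) → ℝ → ℝ := fun p t => Φ fun i => -t - (p i - p 0) with hg
  have h := contDiffOn_convolution_right_with_param (n := ⊤) (μ := volume)
    (ContinuousLinearMap.mul ℝ ℝ) (f := fun _ : ℝ => (1:ℝ)) (g := g)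
    (s := Set.univ) (k := Metric.closedBall 0 R) isOpen_univ (isCompact_closedBall _ _)
    (fun p t _ ht => by
      by_contra hne
      refine ht ?_
      have := hR _ hne 0
      simpa using this)
    (locallyIntegrable_const _)
    (by
      refine ContDiff.contDiffOn ?_
      refine hΦ.comp (f := fun q : (Fin (n + 1) → ℝ) × ℝ => fun i => -q.2 - (q.1 i - q.1 0)) ?_
      fun_prop)
  rw [Set.univ_prod_univ, contDiffOn_univ] at h
  have h2 : ContDiff ℝ ∞ fun x : Fin (n + 1) → ℝ => (x, (0:ℝ)) := by fun_prop
  convert h.comp h2 using 1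
  ext x
  simp only [Function.comp_apply, convolution, ContinuousLinearMap.mul_apply', one_mul, hg,
    diagonalAverage]
  rw [← integral_add_right_eq_self _ (x 0)]
  congr 1 with τ
  congr 1 with i
  ring

theorem isTestFunction_diagonalAverage {n : ℕ} {Φ : (Fin (n + 1) → ℝ) → ℝ} (hΦ : ContDiff ℝ ∞ Φ)
    (hs : HasCompactSupport Φ)
    (hsym : ∀ (σ : Equiv.Perm (Fin (n + 1))) (x : Fin (n + 1) → ℝ), Φ (x ∘ σ) = Φ x) :
    IsTestFunction (diagonalAverage Φ) where
  smooth := contDiff_diagonalAverage hΦ hs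
  symmetric σ x := by
    unfold diagonalAverage
    congr 1 with τ
    exact hsym σ fun i => τ - x i
  translation := diagonalAverage_add_const Φ
  rapid_decay k := by
    obtain ⟨R, hR0, hR⟩ := exists_bound_of_hasCompactSupport hs
    have hc : Continuous fun x => ‖x‖ ^ k * |diagonalAverage Φ x| :=
      (continuous_norm.pow k).mul (contDiff_diagonalAverage hΦ hs).continuous.abs
    obtain ⟨C, hC⟩ := (isCompact_closedBall (0 : Fin (n + 1) → ℝ) (2 * R)).exists_bound_of_continuousOn
      hc.continuousOn
    refine ⟨max C 0, fun x hx => ?_⟩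
    by_cases hb : x ∈ Metric.closedBall 0 (2 * R)
    · exact ((le_abs_self _).trans (hC x hb)).trans (le_max_left _ _)
    · have h0 : diagonalAverage Φ x = 0 := by
        unfold diagonalAverage
        rw [← integral_zero ℝ ℝ]
        congr 1 with τ
        by_contra hne
        refine hb ?_
        have hi := hR _ hne
        -- On the hyperplane, τ is the mean of the coordinates τ − xᵢ, all at most R in modulus.
        -- Hence |xᵢ| ≤ 2R, and the average vanishes outside a ball, which is stronger than rapid
        -- decay.
        have hτ : |τ| ≤ R := by
          have h1 : ∑ i, (τ - x i) = (n + 1) * τ := by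
            rw [Finset.sum_sub_distrib, hx]; simp
          have h2 : |∑ i, (τ - x i)| ≤ (n + 1) * R := by
            refine (Finset.abs_sum_le_sum_abs _ _).trans ?_
            refine (Finset.sum_le_card_nsmul _ _ R fun i _ => hi i).trans ?_
            simp
          have hn : (0:ℝ) < n + 1 := by positivity
          rw [h1, abs_mul, abs_of_pos hn] at h2
          exact le_of_mul_le_mul_left h2 hn
        rw [mem_closedBall_zero_iff, pi_norm_le_iff_of_nonneg (by positivity)]
        intro i
        rw [Real.norm_eq_abs, show x i = τ - (τ - x i) by ring]
        exact (abs_sub _ _).trans (by linarith [hi i])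
      rw [h0]; simp

/-! ### Correlation sums as integrals over t -/

/-- The sum of `Φ` over tuples of distinct zeros, rescaled around `t`. -/
def tupleStat {n : ℕ} (Φ : (Fin n → ℝ) → ℝ) (T t : ℝ) : ℝ :=
  ∑ v : Fin n ↪ zeroIndex T, Φ fun i => Real.log T / (2 * Real.pi) * (t - (v i : ℝ × ℕ).1)

theorem integrable_rescale {n : ℕ} {Φ : (Fin (n + 1) → ℝ) → ℝ} (hΦ : Continuous Φ)
    (hs : HasCompactSupport Φ) {c : ℝ} (hc : 0 < c) (γ : Fin (n + 1) → ℝ) :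
    Integrable fun t : ℝ => Φ fun i => c * (t - γ i) := by
  obtain ⟨R, hR0, hR⟩ := exists_bound_of_hasCompactSupport hs
  refine Continuous.integrable_of_hasCompactSupport (hΦ.comp (by fun_prop))
    (HasCompactSupport.intro (K := Metric.closedBall (γ 0) (R / c)) (isCompact_closedBall _ _)
      fun t ht => ?_)
  by_contra hne
  refine ht ?_
  have := hR _ hne 0
  rw [abs_mul, abs_of_pos hc] at this
  rw [Metric.mem_closedBall, Real.dist_eq, le_div_iff₀ hc]
  linarith

theorem integrable_tupleStat {n : ℕ} {Φ : (Fin (n + 1) → ℝ) → ℝ} (hΦ : Continuous Φ)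
    (hs : HasCompactSupport Φ) {T : ℝ} (hT : 1 < T) : Integrable (tupleStat Φ T) :=
  integrable_finsetSum _ fun v _ => integrable_rescale hΦ hs
    (div_pos (Real.log_pos hT) Real.two_pi_pos) fun i => (v i : ℝ × ℕ).1

/-- For each tuple, substituting τ = (log T/2π) t produces the diagonal average with the factor
2π/log T, which is exactly the normalisation in the correlation hypothesis. Thus GUE computes
integrals over t of sums over tuples of zeros. -/
theorem zeroSum_diagonalAverage {n : ℕ} {Φ : (Fin (n + 1) → ℝ) → ℝ} (hΦ : Continuous Φ)
    (hs : HasCompactSupport Φ) {T : ℝ} (hT : 1 < T) :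
    zeroSum (n + 1) T (diagonalAverage Φ) / (T * Real.log T / (2 * Real.pi)) =
      (∫ t, tupleStat Φ T t) / T := by
  have hc : 0 < Real.log T / (2 * Real.pi) := div_pos (Real.log_pos hT) Real.two_pi_pos
  have h1 : ∫ t, tupleStat Φ T t =
      (Real.log T / (2 * Real.pi))⁻¹ * zeroSum (n + 1) T (diagonalAverage Φ) := by
    unfold tupleStat zeroSum
    rw [integral_finsetSum _ fun v _ => integrable_rescale hΦ hs hc fun i => (v i : ℝ × ℕ).1,
      Finset.mul_sum]
    refine Finset.sum_congr rfl fun v _ => ?_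
    have := Measure.integral_comp_mul_left (fun τ : ℝ => Φ fun i => τ -
      Real.log T / (2 * Real.pi) * (v i : ℝ × ℕ).1) (Real.log T / (2 * Real.pi))
    rw [abs_of_pos (inv_pos.2 hc), smul_eq_mul] at this
    rw [diagonalAverage, ← this]
    simp_rw [mul_sub]
  rw [h1]
  have := Real.log_pos hT
  have := Real.pi_pos
  field_simp

theorem tendsto_integral_tupleStat {n : ℕ} (hn : CorrelationAgrees n)
    {Φ : (Fin (n + 1) → ℝ) → ℝ} (hΦ : ContDiff ℝ ∞ Φ) (hs : HasCompactSupport Φ)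
    (hsym : ∀ (σ : Equiv.Perm (Fin (n + 1))) (x : Fin (n + 1) → ℝ), Φ (x ∘ σ) = Φ x) :
    Tendsto (fun T => (∫ t, tupleStat Φ T t) / T) atTop (𝓝 (∫ x, Φ x * gueDensity x)) := by
  have h := hn _ (isTestFunction_diagonalAverage hΦ hs hsym)
  rw [meanZeroIntegral_diagonalAverage hΦ.continuous hs] at h
  refine h.congr' ?_
  filter_upwards [eventually_gt_atTop 1] with T hT
  exact zeroSum_diagonalAverage hΦ.continuous hs hT

/-- The linear statistic of `φ` over the zeros, rescaled around `t`. -/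
def linStat (φ : ℝ → ℝ) (T t : ℝ) : ℝ :=
  ∑ p ∈ zeroIndex T, φ (Real.log T / (2 * Real.pi) * (t - p.1))

/-- The number of zeros with ordinates in `(0, T)` is asymptotic to `T log T / 2π`. -/
def CountAsymptotic : Prop :=
  Tendsto (fun T : ℝ => ((zeroIndex T).card : ℝ) / (T * Real.log T / (2 * Real.pi))) atTop (𝓝 1)

theorem integrable_linStat {φ : ℝ → ℝ} (hφ : Integrable φ) {T : ℝ} (hT : 1 < T) :
    Integrable (linStat φ T) := by
  refine integrable_finsetSum _ fun p _ => ?_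
  have hc : Real.log T / (2 * Real.pi) ≠ 0 := (div_pos (Real.log_pos hT) Real.two_pi_pos).ne'
  exact (hφ.comp_mul_left' hc).comp_sub_right p.1

theorem integral_linStat {φ : ℝ → ℝ} (hφ : Integrable φ) {T : ℝ} (hT : 1 < T) :
    (∫ t, linStat φ T t) / T =
      ((zeroIndex T).card : ℝ) / (T * Real.log T / (2 * Real.pi)) * ∫ x, φ x := by
  have hc : 0 < Real.log T / (2 * Real.pi) := div_pos (Real.log_pos hT) Real.two_pi_pos
  have h1 : ∀ p : ℝ × ℕ, ∫ t, φ (Real.log T / (2 * Real.pi) * (t - p.1)) =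
      (Real.log T / (2 * Real.pi))⁻¹ * ∫ x, φ x := by
    intro p
    rw [integral_sub_right_eq_self (fun t => φ (Real.log T / (2 * Real.pi) * t)),
      Measure.integral_comp_mul_left φ, abs_of_pos (inv_pos.2 hc), smul_eq_mul]
  unfold linStat
  rw [integral_finsetSum _ fun p _ => (hφ.comp_mul_left' hc.ne').comp_sub_right p.1]
  simp_rw [h1]
  rw [Finset.sum_const, nsmul_eq_mul]
  have := Real.log_pos hT
  have := Real.pi_pos
  field_simp

theorem tendsto_integral_linStat (hN : CountAsymptotic) {φ : ℝ → ℝ} (hφ : Integrable φ) :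
    Tendsto (fun T => (∫ t, linStat φ T t) / T) atTop (𝓝 (∫ x, φ x)) := by
  have h := hN.mul_const (∫ x, φ x)
  rw [one_mul] at h
  refine h.congr' ?_
  filter_upwards [eventually_gt_atTop 1] with T hT
  rw [integral_linStat hφ hT]

theorem hasCompactSupport_prod {n : ℕ} {φ : ℝ → ℝ} (hs : HasCompactSupport φ) :
    HasCompactSupport fun x : Fin n → ℝ => ∏ i, φ (x i) := by
  refine HasCompactSupport.intro (K := Set.univ.pi fun _ => tsupport φ)
    (isCompact_univ_pi fun _ => hs) fun x hx => ?_
  simp only [Set.mem_univ_pi, not_forall] at hx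
  obtain ⟨i, hi⟩ := hx
  exact Finset.prod_eq_zero (Finset.mem_univ i) (image_eq_zero_of_notMem_tsupport hi)

theorem contDiff_prod_comp {n : ℕ} {φ : ℝ → ℝ} (hφ : ContDiff ℝ ∞ φ) :
    ContDiff ℝ ∞ fun x : Fin n → ℝ => ∏ i, φ (x i) :=
  contDiff_prod fun i _ => hφ.comp (contDiff_apply ℝ ℝ i)

theorem linStat_eq (φ : ℝ → ℝ) (T t : ℝ) : linStat φ T t =
    ∑ p : zeroIndex T, φ (Real.log T / (2 * Real.pi) * (t - (p : ℝ × ℕ).1)) :=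
  (Finset.sum_coe_sort (zeroIndex T)
    fun p => φ (Real.log T / (2 * Real.pi) * (t - p.1))).symm

theorem linStat_sq (φ : ℝ → ℝ) (T t : ℝ) :
    linStat φ T t ^ 2 = tupleStat (n := 2) (fun x => ∏ i, φ (x i)) T t +
      linStat (fun x => φ x ^ 2) T t := by
  rw [linStat_eq, linStat_eq, sum_sq_eq]
  rfl

theorem linStat_cube (φ : ℝ → ℝ) (T t : ℝ) :
    linStat φ T t ^ 3 = tupleStat (n := 3) (fun x => ∏ i, φ (x i)) T t +
      3 / 2 * tupleStat (n := 2) (fun x => φ (x 0) ^ 2 * φ (x 1) + φ (x 0) * φ (x 1) ^ 2) T t +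
      linStat (fun x => φ x ^ 3) T t := by
  rw [linStat_eq, linStat_eq, sum_cube_eq]
  rfl

theorem integrable_pow_of_hasCompactSupport {φ : ℝ → ℝ} (hφ : Continuous φ)
    (hs : HasCompactSupport φ) {k : ℕ} (hk : k ≠ 0) : Integrable fun x => φ x ^ k :=
  (hφ.pow k).integrable_of_hasCompactSupport
    (hs.comp_left (g := fun y : ℝ => y ^ k) (zero_pow hk))

theorem tendsto_integral_linStat_sq (hN : CountAsymptotic) (hc : CorrelationAgrees 1)
    {φ : ℝ → ℝ} (hφ : ContDiff ℝ ∞ φ) (hs : HasCompactSupport φ) :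
    Tendsto (fun T => (∫ t, linStat φ T t ^ 2) / T) atTop (𝓝 (gueSecondMoment φ)) := by
  have h1 := tendsto_integral_linStat hN
    (integrable_pow_of_hasCompactSupport hφ.continuous hs two_ne_zero)
  have h2 := tendsto_integral_tupleStat hc (Φ := fun x => ∏ i, φ (x i)) (contDiff_prod_comp hφ)
    (hasCompactSupport_prod hs) (fun σ x => Equiv.prod_comp σ fun i => φ (x i))
  refine (h1.add h2).congr' ?_
  filter_upwards [eventually_gt_atTop 1] with T hT
  rw [← add_div, add_comm, ← integral_add (integrable_tupleStat (contDiff_prod_comp hφ).continuous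
    (hasCompactSupport_prod hs) hT) (integrable_linStat
      (integrable_pow_of_hasCompactSupport hφ.continuous hs two_ne_zero) hT)]
  simp_rw [linStat_sq]

theorem tendsto_integral_linStat_cube (hN : CountAsymptotic) (hc : CorrelationAgrees 1)
    (hc' : CorrelationAgrees 2) {φ : ℝ → ℝ} (hφ : ContDiff ℝ ∞ φ) (hs : HasCompactSupport φ) :
    Tendsto (fun T => (∫ t, linStat φ T t ^ 3) / T) atTop (𝓝 (gueThirdMoment φ)) := by
  have i1 := integrable_pow_of_hasCompactSupport hφ.continuous hs three_ne_zero
  set Ψ : (Fin 2 → ℝ) → ℝ := fun x => φ (x 0) ^ 2 * φ (x 1) + φ (x 0) * φ (x 1) ^ 2 with hΨ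
  have hΨ' : Ψ = fun x => (∏ i, φ (x i)) * (φ (x 0) + φ (x 1)) := by
    ext x; simp only [hΨ, Fin.prod_univ_two]; ring
  have c2 : ContDiff ℝ ∞ Ψ := by
    rw [hΨ']
    exact (contDiff_prod_comp hφ).mul ((hφ.comp (contDiff_apply ℝ ℝ 0)).add
      (hφ.comp (contDiff_apply ℝ ℝ 1)))
  have s2 : HasCompactSupport Ψ := by
    rw [hΨ']
    exact (hasCompactSupport_prod hs).mul_right
  have h1 := tendsto_integral_linStat hN i1
  have h2 := tendsto_integral_tupleStat hc c2 s2 (fun σ x => by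
    have hu : (Finset.univ : Finset (Equiv.Perm (Fin 2))) = {1, Equiv.swap 0 1} := by decide
    have := Finset.mem_univ σ
    rw [hu, Finset.mem_insert, Finset.mem_singleton] at this
    rcases this with rfl | rfl
    · rfl
    · simp only [hΨ, Function.comp_apply, Equiv.swap_apply_left, Equiv.swap_apply_right]
      ring)
  have h3 := tendsto_integral_tupleStat hc' (Φ := fun x => ∏ i, φ (x i)) (contDiff_prod_comp hφ)
    (hasCompactSupport_prod hs) (fun σ x => Equiv.prod_comp σ fun i => φ (x i))
  refine ((h1.add (h2.const_mul (3 / 2))).add h3).congr' ?_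
  filter_upwards [eventually_gt_atTop 1] with T hT
  have j3 := integrable_tupleStat (contDiff_prod_comp (n := 3) hφ).continuous
    (hasCompactSupport_prod hs) hT
  have j2 := (integrable_tupleStat c2.continuous s2 hT).const_mul (3 / 2)
  have j1 := integrable_linStat i1 hT
  have j32 : Integrable fun t => tupleStat (n := 3) (fun x => ∏ i, φ (x i)) T t +
      3 / 2 * tupleStat Ψ T t := j3.add j2
  simp_rw [linStat_cube]
  rw [integral_add j32 j1, integral_add j3 j2, integral_const_mul]
  ring

/-! ### Counting zeros through the Poisson formula -/

/-- The real part of `ζ'/ζ` to the right of the critical line as a Poisson sum over zeros. -/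
theorem exists_abs_re_sub_sum_poisson_le (hRH : RiemannHypothesis) :
    ∃ K : ℝ, 0 < K ∧ ∀ x T t : ℝ, 0 < x → x ≤ 1 / 4 → 1 ≤ t → t ≤ T - 1 →
      |(logDeriv riemannZeta (1 / 2 + x + t * I)).re -
        (∑ p ∈ zeroIndex T, poisson x (t - p.1) - Real.log t / 2)| ≤
      24 + K * (x * Real.log (T + 2)) := by
  obtain ⟨K, hK, h⟩ := exists_norm_logDeriv_xi_le hRH
  refine ⟨3 * K, by positivity, fun x T t hx hx' ht htT => ?_⟩
  have h1 := abs_re_logDeriv_riemannZeta_sub_le hRH hx (by linarith) ht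
  have h2 := sum_poisson_le hRH hx t (zeroIndex T) fun p hp => mem_zeroIndexAbs_of_mem_zeroIndex hp
  have h3 := re_logDeriv_xi_sub_sum_le hRH hx ht htT
  have h4 := (Complex.re_le_norm _).trans (h t)
  have h5 : Real.log (|t| + 2) ≤ Real.log (T + 2) := by
    rw [abs_of_nonneg (by linarith)]
    exact Real.log_le_log (by linarith) (by linarith)
  have h6 : 3 * x * (logDeriv xi ((5 / 2 : ℝ) + t * I)).re ≤ 3 * K * (x * Real.log (T + 2)) := by
    calc _ ≤ 3 * x * (K * Real.log (T + 2)) := by gcongr; exact h4.trans (by gcongr)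
      _ = _ := by ring
  rw [abs_le] at h1 ⊢
  constructor <;> linarith [h1.1, h1.2]

theorem continuous_poisson_sub {x : ℝ} (hx : 0 < x) (γ : ℝ) :
    Continuous fun t => poisson x (t - γ) :=
  (continuous_poisson hx).comp (continuous_id.sub continuous_const)

theorem integral_poisson_sub {x : ℝ} (hx : 0 < x) (γ s r : ℝ) :
    ∫ t in s..r, poisson x (t - γ) = Real.arctan ((r - γ) / x) - Real.arctan ((s - γ) / x) := by
  rw [intervalIntegral.integral_eq_sub_of_hasDerivAt
    (f := fun t => Real.arctan ((t - γ) / x)) (fun t _ => ?_)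
    ((continuous_poisson_sub hx γ).intervalIntegrable _ _)]
  have h1 : HasDerivAt (fun t : ℝ => (t - γ) / x) (1 / x) t :=
    ((hasDerivAt_id t).sub_const γ).div_const x
  refine h1.arctan.congr_deriv ?_
  unfold poisson
  field_simp

theorem integral_poisson_sub_le {x : ℝ} (hx : 0 < x) (γ s r : ℝ) :
    ∫ t in s..r, poisson x (t - γ) ≤ Real.pi := by
  rw [integral_poisson_sub hx]
  linarith [Real.arctan_lt_pi_div_two ((r - γ) / x), Real.neg_pi_div_two_lt_arctan ((s - γ) / x)]

theorem pi_div_two_sub_inv_le_arctan {y : ℝ} (hy : 0 < y) : Real.pi / 2 - y⁻¹ ≤ Real.arctan y := by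
  have h1 := Real.arctan_inv_of_pos hy
  have h2 : Real.arctan y⁻¹ ≤ y⁻¹ := by
    have h0 : 0 ≤ Real.arctan y⁻¹ := Real.arctan_nonneg.2 (inv_nonneg.2 hy.le)
    simpa [Real.tan_arctan] using Real.le_tan h0 (Real.arctan_lt_pi_div_two _)
  linarith

theorem le_integral_poisson_sub {x γ s r : ℝ} (hx : 0 < x) (hs : s + 1 ≤ γ) (hr : γ + 1 ≤ r) :
    Real.pi - 2 * x ≤ ∫ t in s..r, poisson x (t - γ) := by
  rw [integral_poisson_sub hx]
  have h1 : Real.pi / 2 - x ≤ Real.arctan ((r - γ) / x) := by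
    have := pi_div_two_sub_inv_le_arctan (y := (r - γ) / x) (div_pos (by linarith) hx)
    rw [inv_div] at this
    have : x / (r - γ) ≤ x := div_le_self hx.le (by linarith)
    linarith
  have h2 : Real.pi / 2 - x ≤ -Real.arctan ((s - γ) / x) := by
    have := pi_div_two_sub_inv_le_arctan (y := (γ - s) / x) (div_pos (by linarith) hx)
    rw [inv_div] at this
    have : x / (γ - s) ≤ x := div_le_self hx.le (by linarith)
    rw [← Real.arctan_neg, ← neg_div, neg_sub]
    linarith
  linarith

theorem integral_re_logDeriv (hRH : RiemannHypothesis) {x : ℝ} (hx : 0 < x) (hx' : x < 1 / 2)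
    (s r : ℝ) : ∫ t in s..r, (logDeriv riemannZeta (1 / 2 + x + t * I)).re =
      (∫ t in s..r, logDeriv riemannZeta (1 / 2 + x + t * I)).re := by
  have hc := continuous_logDeriv_riemannZeta_line hRH hx hx'
  exact Complex.reCLM.intervalIntegral_comp_comm (hc.intervalIntegrable _ _)

theorem continuous_sum_poisson {x : ℝ} (hx : 0 < x) (Q : Finset (ℝ × ℕ)) :
    Continuous fun t : ℝ => ∑ p ∈ Q, poisson x (t - p.1) :=
  continuous_finsetSum _ fun p _ => continuous_poisson_sub hx p.1

theorem log_sub_one_ge {T : ℝ} (hT : 3 ≤ T) : Real.log T - 1 ≤ Real.log (T - 1) := by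
  have h1 : Real.log T = Real.log (T - 1) + Real.log (T / (T - 1)) := by
    rw [← Real.log_mul (by linarith) (div_ne_zero (by linarith) (by linarith))]
    congr 1
    have : T - 1 ≠ 0 := by linarith
    field_simp
  have h2 : Real.log (T / (T - 1)) ≤ T / (T - 1) - 1 :=
    Real.log_le_sub_one_of_pos (div_pos (by linarith) (by linarith))
  have h3 : T / (T - 1) - 1 ≤ 1 := by
    rw [div_sub_one (by linarith), div_le_one (by linarith)]; linarith
  linarith

/-- Integrate the Poisson formula with x = 1/log T, which keeps its error bounded. The integral of
Re ζ'/ζ is O(T) by the contour shift, so what remains is the integral of (log t)/2. Since a zero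
inside the range contributes mass about π, this counts zeros. -/
theorem exists_abs_integral_sum_poisson_sub_le (hRH : RiemannHypothesis) :
    ∃ K : ℝ, 0 < K ∧ ∀ᶠ T in atTop,
      |(∫ t in (1:ℝ)..(T - 1), ∑ p ∈ zeroIndex T, poisson (1 / Real.log T) (t - p.1)) -
        T * Real.log T / 2| ≤ K * T := by
  obtain ⟨K₁, hK₁, h₁⟩ := exists_abs_re_sub_sum_poisson_le hRH
  obtain ⟨K₂, hK₂, h₂⟩ := exists_norm_integral_logDeriv_pow_le hRH 1
  refine ⟨24 + 2 * K₁ + 5 * K₂ + 2, by positivity, ?_⟩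
  filter_upwards [eventually_ge_atTop 3, Real.tendsto_log_atTop.eventually_ge_atTop 4,
    (Real.isLittleO_pow_log_id_atTop (n := 2)).bound (c := 1) one_pos] with T hT hL hL2
  simp only [id, Real.norm_eq_abs, one_mul] at hL2
  rw [abs_of_nonneg (by positivity), abs_of_nonneg (by linarith)] at hL2
  set L := Real.log T with hLdef
  have hL0 : 0 < L := by linarith
  set x := 1 / L with hx
  have hx0 : 0 < x := by positivity
  have hx4 : x ≤ 1 / 4 := by rw [hx]; gcongr
  have hxL : x * L = 1 := by rw [hx]; field_simp
  have hlog2 : Real.log (T + 2) ≤ 2 * L := by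
    have : Real.log (T + 2) ≤ Real.log (T ^ 2) := Real.log_le_log (by linarith) (by nlinarith)
    rwa [Real.log_pow, Nat.cast_ofNat] at this
  have hT1 : (1:ℝ) ≤ T - 1 := by linarith
  have hLT : L ≤ T := by nlinarith
  have hc := continuous_logDeriv_riemannZeta_line hRH hx0 (by linarith)
  have hu : Continuous fun t : ℝ => (logDeriv riemannZeta (1 / 2 + x + t * I)).re :=
    Complex.continuous_re.comp hc
  have hlogi : IntervalIntegrable (fun t => Real.log t / 2) volume 1 (T - 1) :=
    intervalIntegral.intervalIntegrable_log'.div_const 2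
  have hSc := continuous_sum_poisson hx0 (zeroIndex T)
  have e1 : |∫ t in (1:ℝ)..(T - 1), ((logDeriv riemannZeta (1 / 2 + x + t * I)).re -
      (∑ p ∈ zeroIndex T, poisson x (t - p.1) - Real.log t / 2))| ≤ (24 + 2 * K₁) * T := by
    have := intervalIntegral.norm_integral_le_of_norm_le_const (a := 1) (b := T - 1)
      (C := 24 + 2 * K₁) (f := fun t => (logDeriv riemannZeta (1 / 2 + x + t * I)).re -
      (∑ p ∈ zeroIndex T, poisson x (t - p.1) - Real.log t / 2)) (fun t ht => by
        rw [Set.uIoc_of_le hT1] at ht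
        refine (h₁ x T t hx0 hx4 ht.1.le ht.2).trans ?_
        have : x * Real.log (T + 2) ≤ 2 := by
          calc _ ≤ x * (2 * L) := by gcongr
            _ = 2 := by linarith
        nlinarith)
    rw [Real.norm_eq_abs] at this
    refine this.trans ?_
    rw [abs_of_nonneg (by linarith)]
    gcongr
    linarith
  rw [intervalIntegral.integral_sub (hu.intervalIntegrable _ _)
    ((hSc.intervalIntegrable _ _).sub hlogi),
    intervalIntegral.integral_sub (hSc.intervalIntegrable _ _) hlogi,
    integral_re_logDeriv hRH hx0 (by linarith), intervalIntegral.integral_div, integral_log] at e1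
  have e2 : |(∫ t in (1:ℝ)..(T - 1), logDeriv riemannZeta (1 / 2 + x + t * I)).re| ≤
      5 * K₂ * T := by
    have := h₂ x (T - 1) hx0 hx4 hT1
    simp only [pow_one] at this
    refine ((Complex.abs_re_le_norm _).trans this).trans ?_
    have hl : Real.log (T - 1 + 2) ≤ 2 * L := (Real.log_le_log (by linarith) (by linarith)).trans hlog2
    have : (1 + 1 / x) * Real.log (T - 1 + 2) ≤ 4 * T := by
      have h1x : 1 / x = L := by rw [hx]; field_simp
      rw [h1x]
      calc _ ≤ (1 + L) * (2 * L) := by gcongr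
        _ ≤ 4 * T := by nlinarith
    nlinarith
  have e3 : |((T - 1) * Real.log (T - 1) - 1 * Real.log 1 - (T - 1) + 1) - T * L| ≤ 4 * T := by
    have h1 := log_sub_one_ge hT
    have h2 : Real.log (T - 1) ≤ L := Real.log_le_log (by linarith) (by linarith)
    rw [Real.log_one, abs_le]
    constructor <;> nlinarith
  rw [abs_le] at e1 e2 e3 ⊢
  constructor <;> linarith [e1.1, e1.2, e2.1, e2.2, e3.1, e3.2]

theorem zeroIndex_mono {T T' : ℝ} (h : T ≤ T') : zeroIndex T ⊆ zeroIndex T' := fun p hp => by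
  rw [mem_zeroIndex] at hp ⊢
  exact ⟨hp.1, hp.2.1.trans_le h, hp.2.2⟩

/-- The Riemann–von Mangoldt asymptotics. -/
theorem countAsymptotic (hRH : RiemannHypothesis) : CountAsymptotic := by
  obtain ⟨K, hK, h⟩ := exists_abs_integral_sum_poisson_sub_le hRH
  have hshift : Tendsto (fun T : ℝ => T + 2) atTop atTop := tendsto_atTop_add_const_right _ _ tendsto_id
  have hinv : Tendsto (fun T : ℝ => (Real.log T)⁻¹) atTop (𝓝 0) :=
    tendsto_inv_atTop_zero.comp Real.tendsto_log_atTop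
  have hTinv : Tendsto (fun T : ℝ => T⁻¹) atTop (𝓝 0) := tendsto_inv_atTop_zero
  have hlow : Tendsto (fun T : ℝ => 1 - 2 * K * (Real.log T)⁻¹) atTop (𝓝 1) := by
    simpa using (hinv.const_mul (2 * K)).const_sub 1
  set N₂ : ℝ := ((zeroIndex 2).card : ℝ) with hN₂
  have hup : Tendsto (fun T : ℝ => (1 + (8 + 6 * K) * (Real.log T)⁻¹) *
      (Real.pi / (Real.pi - 2 * (Real.log (T + 2))⁻¹)) +
      N₂ * (2 * Real.pi) * (T⁻¹ * (Real.log T)⁻¹)) atTop (𝓝 1) := by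
    have h1 := (hinv.const_mul (8 + 6 * K)).const_add 1
    have h2 : Tendsto (fun T : ℝ => Real.pi / (Real.pi - 2 * (Real.log (T + 2))⁻¹)) atTop
        (𝓝 (Real.pi / (Real.pi - 2 * 0))) :=
      tendsto_const_nhds.div (((hinv.comp hshift).const_mul 2).const_sub Real.pi)
        (by simp [Real.pi_ne_zero])
    have h3 := (hTinv.mul hinv).const_mul (N₂ * (2 * Real.pi))
    have := (h1.mul h2).add h3
    simpa [Real.pi_ne_zero] using this
  refine tendsto_of_tendsto_of_tendsto_of_le_of_le' hlow hup ?_ ?_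
  · filter_upwards [h, eventually_ge_atTop 3, Real.tendsto_log_atTop.eventually_ge_atTop 4]
      with T hT hT3 hL
    have hL0 : 0 < Real.log T := by linarith
    have hx0 : 0 < 1 / Real.log T := by positivity
    -- Each zero contributes at most π, which gives the lower bound for the count.
    have hle : (∫ t in (1:ℝ)..(T - 1), ∑ p ∈ zeroIndex T, poisson (1 / Real.log T) (t - p.1)) ≤
        (zeroIndex T).card * Real.pi := by
      rw [intervalIntegral.integral_finsetSum fun p _ =>
        (continuous_poisson_sub hx0 p.1).intervalIntegrable _ _]
      refine (Finset.sum_le_card_nsmul _ _ Real.pi fun p _ => integral_poisson_sub_le hx0 _ _ _).trans ?_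
      simp
    have hpi := Real.pi_pos
    rw [le_div_iff₀ (by positivity)]
    have h1 := (abs_le.1 hT).1
    have : (1 - 2 * K * (Real.log T)⁻¹) * (T * Real.log T / (2 * Real.pi)) =
        (T * Real.log T / 2 - K * T) / Real.pi := by
      field_simp
    rw [this, div_le_iff₀ hpi]
    linarith
  · filter_upwards [hshift.eventually h, eventually_ge_atTop 3,
      Real.tendsto_log_atTop.eventually_ge_atTop 4] with T hT hT3 hL
    have hL0 : 0 < Real.log T := by linarith
    have hlog2 : Real.log (T + 2) ≤ Real.log T + 1 := by
      have : Real.log (T + 2) = Real.log T + Real.log ((T + 2) / T) := by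
        rw [← Real.log_mul (by linarith) (by positivity)]
        congr 1
        field_simp
      have h2 : Real.log ((T + 2) / T) ≤ (T + 2) / T - 1 := Real.log_le_sub_one_of_pos (by positivity)
      have h3 : (T + 2) / T - 1 ≤ 1 := by
        rw [div_sub_one (by linarith), div_le_one (by linarith)]; linarith
      linarith
    have hLle : Real.log T ≤ Real.log (T + 2) := Real.log_le_log (by linarith) (by linarith)
    have hLT : Real.log T ≤ T := (Real.log_le_sub_one_of_pos (by linarith)).trans (by linarith)
    have hx0 : 0 < 1 / Real.log (T + 2) := one_div_pos.2 (by linarith)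
    have hx4 : 1 / Real.log (T + 2) ≤ 1 / 4 := by gcongr; linarith
    have hpi := Real.pi_gt_three
    have hpix : 0 < Real.pi - 2 * (1 / Real.log (T + 2)) := by linarith
    -- For the upper bound the estimate is used at T + 2: zeros with 2 ≤ γ < T lie at distance at
    -- least 1 from both ends of [1, T + 1] and contribute nearly π. The finitely many zeros below 2
    -- are discarded.
    have hge : (((zeroIndex T).card : ℝ) - N₂) * (Real.pi - 2 * (1 / Real.log (T + 2))) ≤
        ∫ t in (1:ℝ)..(T + 2 - 1), ∑ p ∈ zeroIndex (T + 2),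
          poisson (1 / Real.log (T + 2)) (t - p.1) := by
      rw [intervalIntegral.integral_finsetSum fun p _ =>
        (continuous_poisson_sub hx0 p.1).intervalIntegrable _ _]
      have hsub : zeroIndex T \ zeroIndex 2 ⊆ zeroIndex (T + 2) :=
        Finset.sdiff_subset.trans (zeroIndex_mono (by linarith))
      refine le_trans ?_ (Finset.sum_le_sum_of_subset_of_nonneg hsub fun p _ _ =>
        intervalIntegral.integral_nonneg (by linarith) fun t _ => poisson_nonneg hx0.le _)
      refine le_trans ?_ (Finset.card_nsmul_le_sum _ _ (Real.pi - 2 * (1 / Real.log (T + 2)))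
        fun p hp => le_integral_poisson_sub hx0 ?_ ?_)
      · rw [nsmul_eq_mul]
        gcongr
        rw [Finset.card_sdiff_of_subset (zeroIndex_mono (by linarith)),
          Nat.cast_sub (Finset.card_le_card (zeroIndex_mono (by linarith)))]
      · rw [Finset.mem_sdiff, mem_zeroIndex, mem_zeroIndex] at hp
        by_contra hlt
        exact hp.2 ⟨hp.1.1, by linarith, hp.1.2.2⟩
      · rw [Finset.mem_sdiff, mem_zeroIndex] at hp
        linarith [hp.1.2.1]
    have hub : (∫ t in (1:ℝ)..(T + 2 - 1), ∑ p ∈ zeroIndex (T + 2),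
          poisson (1 / Real.log (T + 2)) (t - p.1)) ≤ T * Real.log T / 2 + (4 + 3 * K) * T := by
      have h1 := (abs_le.1 hT).2
      nlinarith
    have hN : ((zeroIndex T).card : ℝ) ≤ N₂ + (T * Real.log T / 2 + (4 + 3 * K) * T) /
        (Real.pi - 2 * (1 / Real.log (T + 2))) := by
      rw [← sub_le_iff_le_add', le_div_iff₀ hpix]
      exact hge.trans hub
    rw [div_le_iff₀ (by positivity)]
    refine hN.trans (le_of_eq ?_)
    rw [one_div] at hpix ⊢
    field_simp
    ring

/-- The kernel of width 5/2 is at least 1/3 at distance at most 1, so Re ξ'/ξ at 5/2 + it dominates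
a third of the count. -/
theorem exists_card_zeros_near_le (hRH : RiemannHypothesis) :
    ∃ K : ℝ, 0 < K ∧ ∀ T t : ℝ,
      (((zeroIndex T).filter fun p => |t - p.1| ≤ 1).card : ℝ) ≤ K * Real.log (|t| + 2) := by
  obtain ⟨K, hK, h⟩ := exists_norm_logDeriv_xi_le hRH
  refine ⟨3 * K, by positivity, fun T t => ?_⟩
  have h2 := sum_poisson_le hRH (x := 5 / 2) (by norm_num) t
    ((zeroIndex T).filter fun p => |t - p.1| ≤ 1)
    fun p hp => mem_zeroIndexAbs_of_mem_zeroIndex (Finset.mem_filter.1 hp).1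
  have h3 := Finset.card_nsmul_le_sum ((zeroIndex T).filter fun p => |t - p.1| ≤ 1)
    (fun p => poisson (5 / 2) (t - p.1)) (1 / 3) fun p hp => by
      have hp := (Finset.mem_filter.1 hp).2
      have : (t - p.1) ^ 2 ≤ 1 := by rw [← sq_abs]; exact pow_le_one₀ (abs_nonneg _) hp
      unfold poisson
      rw [div_le_div_iff₀ (by norm_num) (by positivity)]
      linarith
  rw [nsmul_eq_mul] at h3
  have h4 := (Complex.re_le_norm _).trans (h t)
  linarith

/-! ### Third moment of a slowly decaying majorant -/

/-- An integrable majorant of the Poisson kernels. -/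
def window (x : ℝ) : ℝ := (1 + x ^ 2) ^ (-(3 / 4) : ℝ)

theorem window_pos (x : ℝ) : 0 < window x := Real.rpow_pos_of_pos (by positivity) _

theorem window_le_one (x : ℝ) : window x ≤ 1 :=
  Real.rpow_le_one_of_one_le_of_nonpos (by nlinarith [sq_nonneg x]) (by norm_num)

theorem continuous_window : Continuous window :=
  Continuous.rpow_const (by fun_prop) fun x => Or.inl (by positivity)

theorem integrable_window : Integrable window := by
  have := integrable_rpow_neg_one_add_norm_sq (E := ℝ) (μ := volume) (r := 3 / 2) (by simp; norm_num)
  refine this.congr (Eventually.of_forall fun x => ?_)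
  simp only [window, Real.norm_eq_abs, sq_abs]
  norm_num

theorem window_le_three_mul {x y : ℝ} (h : |x - y| ≤ 1) : window x ≤ 3 * window y := by
  have h1 : 1 + y ^ 2 ≤ 3 * (1 + x ^ 2) := by
    have : (x - y) ^ 2 ≤ 1 := by rw [← sq_abs]; exact pow_le_one₀ (abs_nonneg _) h
    nlinarith [sq_nonneg (x + (x - y)), sq_nonneg (2 * x - y)]
  have h2 : (3 * (1 + x ^ 2)) ^ (-(3 / 4) : ℝ) ≤ window y :=
    Real.rpow_le_rpow_of_nonpos (by positivity) h1 (by norm_num)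
  rw [Real.mul_rpow (by norm_num) (by positivity)] at h2
  have h3 : (1 / 3 : ℝ) ≤ 3 ^ (-(3 / 4) : ℝ) := by
    have : (3:ℝ) ^ (-1 : ℝ) ≤ 3 ^ (-(3 / 4) : ℝ) :=
      Real.rpow_le_rpow_of_exponent_le (by norm_num) (by norm_num)
    rwa [Real.rpow_neg_one, ← one_div] at this
  have := window_pos x
  unfold window at *
  nlinarith

/-- A continuous compactly supported function dominating the indicator of `[-1, 1]`. -/
structure IsBump (ψ : ℝ → ℝ) : Prop where
  continuous : Continuous ψ
  hasCompactSupport : HasCompactSupport ψ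
  nonneg : ∀ x, 0 ≤ ψ x
  one_le : ∀ x, |x| ≤ 1 → 1 ≤ ψ x

theorem integrable_mul_comp_sub {w h : ℝ → ℝ} (hw : Integrable w) (hh : Continuous h) {B : ℝ}
    (hB : ∀ x, |h x| ≤ B) (τ : ℝ) : Integrable fun y => w y * h (τ - y) :=
  hw.mul_bdd (c := B) (hh.comp (continuous_const.sub continuous_id)).aestronglyMeasurable
    (Eventually.of_forall fun _ => hB _)

/-- The window varies slowly: on [z − 1, z + 1] it is at least a third of its value at z, and ψ ≥ 1
on the corresponding differences. An interval of length 2 gives the factor 3/2. -/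
theorem window_le_convolution {ψ : ℝ → ℝ} (hψ : IsBump ψ) (z : ℝ) :
    window z ≤ 3 / 2 * ∫ y, window y * ψ (z - y) := by
  obtain ⟨B, hB⟩ := hψ.hasCompactSupport.exists_bound_of_continuous hψ.continuous
  have hInt := integrable_mul_comp_sub integrable_window hψ.continuous hB z
  have h1 : ∫ y in Set.Icc (z - 1) (z + 1), window z / 3 ≤
      ∫ y in Set.Icc (z - 1) (z + 1), window y * ψ (z - y) := by
    refine setIntegral_mono_on (integrableOn_const (by simp)) hInt.integrableOn
      measurableSet_Icc fun y hy => ?_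
    have habs : |z - y| ≤ 1 := by rw [abs_le]; constructor <;> linarith [hy.1, hy.2]
    have h2 := window_le_three_mul habs
    have h3 := hψ.one_le _ habs
    have := window_pos y
    nlinarith
  have h2 : ∫ y in Set.Icc (z - 1) (z + 1), window y * ψ (z - y) ≤ ∫ y, window y * ψ (z - y) :=
    setIntegral_le_integral hInt (Eventually.of_forall fun y =>
      mul_nonneg (window_pos y).le (hψ.nonneg _))
  rw [setIntegral_const, smul_eq_mul, measureReal_def, Real.volume_Icc,
    ENNReal.toReal_ofReal (by linarith)] at h1
  linarith

/-- Jensen's inequality for the cube, via the tangent line h³ ≥ 3m²h − 2m³ at the weighted mean m.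
-/
theorem cube_integral_le {w h : ℝ → ℝ} (hw : Integrable w) (hw0 : ∀ x, 0 ≤ w x)
    (hc : 0 < ∫ x, w x) (hh : Continuous h) (hh0 : ∀ x, 0 ≤ h x) {B : ℝ} (hB : ∀ x, |h x| ≤ B)
    (τ : ℝ) :
    (∫ y, w y * h (τ - y)) ^ 3 ≤ (∫ x, w x) ^ 2 * ∫ y, w y * h (τ - y) ^ 3 := by
  have i1 := integrable_mul_comp_sub hw hh hB τ
  have i3 := integrable_mul_comp_sub hw (hh.pow 3) (B := B ^ 3) (fun x => by
    rw [Pi.pow_apply, abs_pow]; exact pow_le_pow_left₀ (abs_nonneg _) (hB x) 3) τ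
  set c := ∫ x, w x
  set g := ∫ y, w y * h (τ - y) with hg
  have hg0 : 0 ≤ g := integral_nonneg fun y => mul_nonneg (hw0 y) (hh0 _)
  set m := g / c with hm
  have hm0 : 0 ≤ m := by positivity
  have key : 3 * m ^ 2 * g - 2 * m ^ 3 * c ≤ ∫ y, w y * h (τ - y) ^ 3 := by
    rw [hg, ← integral_const_mul, ← integral_const_mul,
      ← integral_sub (i1.const_mul _) (hw.const_mul _)]
    refine integral_mono ((i1.const_mul _).sub (hw.const_mul _)) i3 fun y => ?_
    simp only
    have h1 : 3 * m ^ 2 * h (τ - y) - 2 * m ^ 3 ≤ h (τ - y) ^ 3 := by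
      have := hh0 (τ - y)
      nlinarith [mul_nonneg (add_nonneg this (mul_nonneg (by norm_num : (0:ℝ) ≤ 2) hm0))
        (sq_nonneg (h (τ - y) - m))]
    nlinarith [mul_le_mul_of_nonneg_left h1 (hw0 y)]
  have e : 3 * m ^ 2 * g - 2 * m ^ 3 * c = g ^ 3 / c ^ 2 := by
    rw [hm]; field_simp; ring
  rw [e, div_le_iff₀ (by positivity)] at key
  linarith

/-- The window sum is at most 3/2 times the convolution of the window with the bump sum; apply
Jensen and then Fubini. This passes from a kernel without compact support to one to which the
correlation hypothesis applies. -/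
theorem integral_sum_window_cube_le {ψ : ℝ → ℝ} (hψ : IsBump ψ) {ι : Type*} (s : Finset ι)
    (x : ι → ℝ) :
    ∫ τ, (∑ i ∈ s, window (τ - x i)) ^ 3 ≤
      27 / 8 * (∫ y, window y) ^ 3 * ∫ τ, (∑ i ∈ s, ψ (τ - x i)) ^ 3 := by
  set h : ℝ → ℝ := fun τ => ∑ i ∈ s, ψ (τ - x i) with hh
  have hhc : Continuous h := continuous_finsetSum _ fun i _ =>
    hψ.continuous.comp (continuous_id.sub continuous_const)
  obtain ⟨B, hB⟩ := hψ.hasCompactSupport.exists_bound_of_continuous hψ.continuous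
  have hBh : ∀ τ, |h τ| ≤ s.card * B := fun τ => by
    refine (Finset.abs_sum_le_sum_abs _ _).trans ?_
    refine (Finset.sum_le_card_nsmul _ _ B fun i _ => hB _).trans ?_
    simp
  have hh0 : ∀ τ, 0 ≤ h τ := fun τ => Finset.sum_nonneg fun i _ => hψ.nonneg _
  have hBh3 : ∀ τ, |h τ ^ 3| ≤ (s.card * B) ^ 3 := fun τ => by
    rw [abs_pow]; exact pow_le_pow_left₀ (abs_nonneg _) (hBh τ) 3
  have hhi : Integrable h := integrable_finsetSum _ fun i _ =>
    (hψ.continuous.integrable_of_hasCompactSupport hψ.hasCompactSupport).comp_sub_right (x i)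
  have hh3 : Integrable fun τ => h τ ^ 3 := by
    have := hhi.mul_bdd (c := (s.card * B) ^ 2) (g := fun τ => h τ ^ 2)
      (hhc.pow 2).aestronglyMeasurable (Eventually.of_forall fun τ => by
        rw [norm_pow]; exact pow_le_pow_left₀ (norm_nonneg _) (hBh τ) 2)
    refine this.congr (Eventually.of_forall fun τ => ?_)
    simp only; ring
  have hc : 0 < ∫ y, window y := by
    rw [integral_pos_iff_support_of_nonneg (fun y => (window_pos y).le) integrable_window]
    have : Function.support window = Set.univ := by
      ext y; simp [(window_pos y).ne']
    rw [this]; simp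
  have hle : ∀ τ, ∑ i ∈ s, window (τ - x i) ≤ 3 / 2 * ∫ y, window y * h (τ - y) := by
    intro τ
    have : ∫ y, window y * h (τ - y) = ∑ i ∈ s, ∫ y, window y * ψ (τ - x i - y) := by
      rw [← integral_finsetSum _ fun i _ =>
        integrable_mul_comp_sub integrable_window hψ.continuous hB (τ - x i)]
      congr 1 with y
      rw [hh, Finset.mul_sum]
      refine Finset.sum_congr rfl fun i _ => ?_
      congr 2; ring
    rw [this, Finset.mul_sum]
    exact Finset.sum_le_sum fun i _ => window_le_convolution hψ _
  have hconv := integrable_window.integrable_convolution (ContinuousLinearMap.mul ℝ ℝ) hh3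
  have hci := integral_convolution (ContinuousLinearMap.mul ℝ ℝ) integrable_window hh3
  simp only [convolution_def, ContinuousLinearMap.mul_apply'] at hci
  have hconv' : Integrable fun τ => ∫ y, window y * h (τ - y) ^ 3 := hconv
  calc ∫ τ, (∑ i ∈ s, window (τ - x i)) ^ 3
      ≤ ∫ τ, 27 / 8 * (∫ y, window y) ^ 2 * ∫ y, window y * h (τ - y) ^ 3 := by
        refine integral_mono_of_nonneg (Eventually.of_forall fun τ => ?_) (hconv'.const_mul _)
          (Eventually.of_forall fun τ => ?_)
        · exact pow_nonneg (Finset.sum_nonneg fun i _ => (window_pos _).le) 3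
        · have h1 := pow_le_pow_left₀ (Finset.sum_nonneg fun i _ => (window_pos _).le) (hle τ) 3
          have h2 := cube_integral_le integrable_window (fun x => (window_pos x).le) hc hhc hh0 hBh τ
          simp only at h1 ⊢
          rw [mul_pow] at h1
          linarith
    _ = _ := by
        rw [integral_const_mul, hci]; ring

theorem continuous_linStat {φ : ℝ → ℝ} (hφ : Continuous φ) (T : ℝ) : Continuous (linStat φ T) :=
  continuous_finsetSum _ fun p _ => hφ.comp (by fun_prop)

theorem integrable_linStat_pow {φ : ℝ → ℝ} (hφ : Continuous φ) (hφi : Integrable φ) {B : ℝ}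
    (hB : ∀ x, |φ x| ≤ B) {T : ℝ} (hT : 1 < T) {k : ℕ} (hk : k ≠ 0) :
    Integrable fun t => linStat φ T t ^ k := by
  obtain ⟨m, rfl⟩ := Nat.exists_eq_succ_of_ne_zero hk
  have hb : ∀ t, |linStat φ T t| ≤ (zeroIndex T).card * B := fun t => by
    refine (Finset.abs_sum_le_sum_abs _ _).trans ?_
    refine (Finset.sum_le_card_nsmul _ _ B fun i _ => hB _).trans ?_
    simp
  have := (integrable_linStat hφi hT).mul_bdd (c := ((zeroIndex T).card * B) ^ m)
    (g := fun t => linStat φ T t ^ m)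
    ((continuous_linStat hφ T).pow m).aestronglyMeasurable (Eventually.of_forall fun τ => by
      rw [norm_pow]; exact pow_le_pow_left₀ (norm_nonneg _) (hb τ) m)
  refine this.congr (Eventually.of_forall fun t => ?_)
  simp only [pow_succ]; ring

theorem exists_isBump : ∃ ψ : ℝ → ℝ, ContDiff ℝ ∞ ψ ∧ IsBump ψ := by
  let b : ContDiffBump (0:ℝ) := ⟨1, 2, one_pos, one_lt_two⟩
  refine ⟨b, b.contDiff, b.continuous, b.hasCompactSupport, fun x => b.nonneg, fun x hx => ?_⟩
  rw [b.one_of_mem_closedBall (by simpa using hx)]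

/-- The third moment of the linear statistic of the window is bounded. -/
theorem exists_integral_linStat_window_cube_le (hN : CountAsymptotic) (hc : CorrelationAgrees 1)
    (hc' : CorrelationAgrees 2) :
    ∃ B : ℝ, 0 < B ∧ ∀ᶠ T in atTop, ∫ t, linStat window T t ^ 3 ≤ B * T := by
  obtain ⟨ψ, hψs, hψ⟩ := exists_isBump
  have h := tendsto_integral_linStat_cube hN hc hc' hψs hψ.hasCompactSupport
  set M := |gueThirdMoment ψ| + 1 with hM
  have hM0 : 0 < M := by positivity
  have hw0 : 0 ≤ ∫ y, window y := integral_nonneg fun y => (window_pos y).le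
  refine ⟨27 / 8 * (∫ y, window y) ^ 3 * M + 1, by positivity, ?_⟩
  filter_upwards [h.eventually_lt_const (u := M) (by rw [hM]; linarith [le_abs_self (gueThirdMoment ψ)]),
    eventually_gt_atTop 1] with T hT hT1
  rw [div_lt_iff₀ (by linarith)] at hT
  have hcpos : 0 < Real.log T / (2 * Real.pi) := div_pos (Real.log_pos hT1) Real.two_pi_pos
  set κ := Real.log T / (2 * Real.pi) with hκ
  -- Substitute τ = κt; the same factor appears on both sides and drops out.
  have hscale : ∀ φ : ℝ → ℝ, ∫ t, linStat φ T t ^ 3 =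
      κ⁻¹ * ∫ τ, (∑ p ∈ zeroIndex T, φ (τ - κ * p.1)) ^ 3 := by
    intro φ
    have := Measure.integral_comp_mul_left
      (fun τ : ℝ => (∑ p ∈ zeroIndex T, φ (τ - κ * p.1)) ^ 3) κ
    rw [abs_of_pos (inv_pos.2 hcpos), smul_eq_mul] at this
    rw [← this]
    simp only [linStat, ← hκ, mul_sub]
  have h1 := integral_sum_window_cube_le hψ (zeroIndex T) fun p => κ * p.1
  calc ∫ t, linStat window T t ^ 3
      = κ⁻¹ * ∫ τ, (∑ p ∈ zeroIndex T, window (τ - κ * p.1)) ^ 3 := hscale _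
    _ ≤ κ⁻¹ * (27 / 8 * (∫ y, window y) ^ 3 * ∫ τ, (∑ p ∈ zeroIndex T, ψ (τ - κ * p.1)) ^ 3) := by
        gcongr
    _ = 27 / 8 * (∫ y, window y) ^ 3 * ∫ t, linStat ψ T t ^ 3 := by rw [hscale]; ring
    _ ≤ 27 / 8 * (∫ y, window y) ^ 3 * (M * T) := by gcongr
    _ ≤ _ := by nlinarith

/-! ### Moments of linear statistics over the interval of zeros -/

/-- Once log T/2π exceeds the radius of the support, only zeros within distance 1 of t contribute,
and there are O(log(|t| + 2)) of them. -/
theorem exists_abs_linStat_le (hRH : RiemannHypothesis) {φ : ℝ → ℝ} (hφ : Continuous φ)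
    (hs : HasCompactSupport φ) :
    ∃ K : ℝ, 0 < K ∧ ∀ᶠ T in atTop, ∀ t,
      |linStat φ T t| ≤ K * Real.log (|t| + 2) ∧ (linStat φ T t ≠ 0 → -1 ≤ t ∧ t ≤ T + 1) := by
  obtain ⟨K, hK, h⟩ := exists_card_zeros_near_le hRH
  obtain ⟨M, hM⟩ := hs.exists_bound_of_continuous hφ
  have hM0 : 0 ≤ M := (norm_nonneg _).trans (hM 0)
  obtain ⟨R, hR⟩ := hs.isCompact.isBounded.subset_closedBall 0
  refine ⟨(M + 1) * K, by positivity, ?_⟩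
  have hlim : Tendsto (fun T : ℝ => Real.log T / (2 * Real.pi)) atTop atTop :=
    Real.tendsto_log_atTop.atTop_div_const Real.two_pi_pos
  filter_upwards [hlim.eventually_gt_atTop 0, hlim.eventually_ge_atTop R] with T hpos hRT t
  set κ := Real.log T / (2 * Real.pi)
  have hnear : ∀ p : ℝ × ℕ, φ (κ * (t - p.1)) ≠ 0 → |t - p.1| ≤ 1 := by
    intro p hp
    have := hR (subset_tsupport _ hp)
    rw [mem_closedBall_zero_iff, norm_mul, Real.norm_of_nonneg hpos.le, Real.norm_eq_abs] at this
    by_contra hlt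
    push Not at hlt
    nlinarith
  constructor
  · have hfil : linStat φ T t = ∑ p ∈ (zeroIndex T).filter fun p => |t - p.1| ≤ 1,
        φ (κ * (t - p.1)) := by
      rw [Finset.sum_filter_of_ne fun p _ hp => hnear p hp]; rfl
    rw [hfil]
    refine (Finset.abs_sum_le_sum_abs _ _).trans ?_
    refine (Finset.sum_le_card_nsmul _ _ M fun p _ => hM _).trans ?_
    rw [nsmul_eq_mul]
    have h1 := h T t
    have h2 := log_abs_add_two_pos t
    calc _ ≤ K * Real.log (|t| + 2) * M := by gcongr
      _ ≤ (M + 1) * K * Real.log (|t| + 2) := by nlinarith [mul_pos hK (by linarith : 0 < Real.log (|t| + 2))]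
  · intro hne
    obtain ⟨p, hp, hpne⟩ := Finset.exists_ne_zero_of_sum_ne_zero hne
    have h1 := abs_le.1 (hnear p hpne)
    rw [mem_zeroIndex] at hp
    constructor <;> linarith [h1.1, h1.2, hp.1, hp.2.1]

theorem tendsto_log_pow_div (k : ℕ) : Tendsto (fun T : ℝ => Real.log T ^ k / T) atTop (𝓝 0) :=
  (Real.isLittleO_pow_log_id_atTop (n := k)).tendsto_div_nhds_zero

theorem log_add_four_le {T : ℝ} (hT : 4 ≤ T) : Real.log (T + 4) ≤ 2 * Real.log T := by
  have : Real.log (T + 4) ≤ Real.log (T ^ 2) := Real.log_le_log (by linarith) (by nlinarith)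
  rwa [Real.log_pow, Nat.cast_ofNat] at this

/-- The integrand lives on (−2, T + 2], so only two intervals of length 3 are lost, and there it is
O(logᵏ T). -/
theorem tendsto_integral_linStat_pow_interval (hRH : RiemannHypothesis) {φ : ℝ → ℝ}
    (hφ : Continuous φ) (hs : HasCompactSupport φ) {k : ℕ} (hk : k ≠ 0) {M : ℝ}
    (h : Tendsto (fun T => (∫ t, linStat φ T t ^ k) / T) atTop (𝓝 M)) :
    Tendsto (fun T => (∫ t in (1:ℝ)..(T - 1), linStat φ T t ^ k) / T) atTop (𝓝 M) := by
  obtain ⟨K, hK, hb⟩ := exists_abs_linStat_le hRH hφ hs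
  have hz : Tendsto (fun T : ℝ => 6 * (2 * K) ^ k * (Real.log T ^ k / T)) atTop (𝓝 0) := by
    simpa using (tendsto_log_pow_div k).const_mul (6 * (2 * K) ^ k)
  have hdiff : Tendsto (fun T => (∫ t in (1:ℝ)..(T - 1), linStat φ T t ^ k) / T -
      (∫ t, linStat φ T t ^ k) / T) atTop (𝓝 0) := by
    refine squeeze_zero_norm' ?_ hz
    filter_upwards [hb, eventually_ge_atTop 4] with T hT hT4
    have hT0 : 0 < T := by linarith
    have hL0 : 0 < Real.log T := Real.log_pos (by linarith)
    have hc : Continuous fun t => linStat φ T t ^ k := (continuous_linStat hφ T).pow k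
    have hsupp : Function.support (fun t => linStat φ T t ^ k) ⊆ Set.Ioc (-2) (T + 2) := by
      intro t ht
      have := (hT t).2 fun h0 => ht (by simp [h0, hk])
      exact ⟨by linarith [this.1], by linarith [this.2]⟩
    have hsplit₁ := intervalIntegral.integral_add_adjacent_intervals
      (hc.intervalIntegrable (μ := volume) (-2) 1) (hc.intervalIntegrable 1 (T - 1))
    have hsplit₂ := intervalIntegral.integral_add_adjacent_intervals
      (hc.intervalIntegrable (μ := volume) (-2) (T - 1)) (hc.intervalIntegrable (T - 1) (T + 2))
    rw [← intervalIntegral.integral_eq_integral_of_support_subset hsupp, ← hsplit₂, ← hsplit₁]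
    have hbd : ∀ t, -2 ≤ t → t ≤ T + 2 → ‖linStat φ T t ^ k‖ ≤ (2 * K) ^ k * Real.log T ^ k := by
      intro t h1 h2
      rw [norm_pow, ← mul_pow]
      refine pow_le_pow_left₀ (norm_nonneg _) (((hT t).1).trans ?_) k
      have : Real.log (|t| + 2) ≤ Real.log (T + 4) := by
        refine Real.log_le_log (by positivity) ?_
        have : |t| ≤ T + 2 := abs_le.2 ⟨by linarith, h2⟩
        linarith
      have := log_add_four_le hT4
      nlinarith
    have e1 := intervalIntegral.norm_integral_le_of_norm_le_const (a := -2) (b := 1)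
      (f := fun t => linStat φ T t ^ k) fun t ht => by
        rw [Set.uIoc_of_le (by norm_num)] at ht
        exact hbd t ht.1.le (by linarith [ht.2])
    have e2 := intervalIntegral.norm_integral_le_of_norm_le_const (a := T - 1) (b := T + 2)
      (f := fun t => linStat φ T t ^ k) fun t ht => by
        rw [Set.uIoc_of_le (by linarith)] at ht
        exact hbd t (by linarith [ht.1]) ht.2
    rw [show |(1:ℝ) - -2| = 3 by norm_num] at e1
    rw [show T + 2 - (T - 1) = (3:ℝ) by ring, abs_of_pos (by norm_num : (0:ℝ) < 3)] at e2
    rw [← sub_div, norm_div, Real.norm_of_nonneg hT0.le, ← mul_div_assoc]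
    refine div_le_div_of_nonneg_right ?_ hT0.le
    rw [Real.norm_eq_abs] at *
    rw [abs_le] at *
    constructor <;> linarith [e1.1, e1.2, e2.1, e2.2]
  simpa using hdiff.add h

theorem tendsto_integral_linStat_sub_cube (hRH : RiemannHypothesis) (hc : CorrelationAgrees 1)
    (hc' : CorrelationAgrees 2) {φ : ℝ → ℝ} (hφ : ContDiff ℝ ∞ φ) (hs : HasCompactSupport φ) :
    Tendsto (fun T => (∫ t in (1:ℝ)..(T - 1), (linStat φ T t - 1 / 2) ^ 3) / T) atTop
      (𝓝 (gueThirdMoment φ - 3 / 2 * gueSecondMoment φ + 3 / 4 * (∫ x, φ x) - 1 / 8)) := by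
  have hN := countAsymptotic hRH
  have h3 := tendsto_integral_linStat_pow_interval hRH hφ.continuous hs three_ne_zero
    (tendsto_integral_linStat_cube hN hc hc' hφ hs)
  have h2 := tendsto_integral_linStat_pow_interval hRH hφ.continuous hs two_ne_zero
    (tendsto_integral_linStat_sq hN hc hφ hs)
  have h1 := tendsto_integral_linStat_pow_interval hRH hφ.continuous hs one_ne_zero
    (M := ∫ x, φ x) (by
      simpa using tendsto_integral_linStat hN (hφ.continuous.integrable_of_hasCompactSupport hs))
  have h0 : Tendsto (fun T : ℝ => 1 / 8 - 1 / 4 * T⁻¹) atTop (𝓝 (1 / 8)) := by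
    have := ((tendsto_inv_atTop_zero (𝕜 := ℝ)).const_mul (1 / 4)).const_sub (1 / 8)
    rwa [mul_zero, sub_zero] at this
  refine (((h3.sub (h2.const_mul (3 / 2))).add (h1.const_mul (3 / 4))).sub h0).congr' ?_
  filter_upwards [eventually_gt_atTop 0] with T hT
  have hk : ∀ (k : ℕ) (a : ℝ), IntervalIntegrable (fun t => a * linStat φ T t ^ k) volume 1 (T - 1) :=
    fun k a => (((continuous_linStat hφ.continuous T).pow k).const_mul a).intervalIntegrable _ _
  have e : ∀ t, (linStat φ T t - 1 / 2) ^ 3 = 1 * linStat φ T t ^ 3 -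
      3 / 2 * linStat φ T t ^ 2 + 3 / 4 * linStat φ T t ^ 1 - 1 / 8 := by
    intro t; ring
  simp_rw [e]
  rw [intervalIntegral.integral_sub (((hk 3 1).sub (hk 2 (3 / 2))).add (hk 1 (3 / 4)))
      intervalIntegrable_const,
    intervalIntegral.integral_add ((hk 3 1).sub (hk 2 (3 / 2))) (hk 1 (3 / 4)),
    intervalIntegral.integral_sub (hk 3 1) (hk 2 (3 / 2)),
    intervalIntegral.integral_const_mul, intervalIntegral.integral_const_mul,
    intervalIntegral.integral_const_mul, intervalIntegral.integral_const]
  simp only [smul_eq_mul]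
  field_simp
  ring

/-! ### Truncated Poisson kernels -/

/-- A smooth cutoff, equal to `1` on `[-1, 1]` and vanishing off `[-2, 2]`. -/
def cutoff : ContDiffBump (0:ℝ) := ⟨1, 2, one_pos, one_lt_two⟩

/-- The rescaled Poisson kernel, smoothly truncated at height about `n + 1`. -/
def truncPoisson (α : ℝ) (n : ℕ) (x : ℝ) : ℝ :=
  cutoff (x / (n + 1)) * poisson α (2 * Real.pi * x)

theorem contDiff_truncPoisson {α : ℝ} (hα : 0 < α) (n : ℕ) : ContDiff ℝ ∞ (truncPoisson α n) := by
  refine ContDiff.mul (cutoff.contDiff.comp (by fun_prop)) ?_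
  unfold poisson
  exact ContDiff.div contDiff_const (by fun_prop) fun x => by positivity

theorem hasCompactSupport_truncPoisson (α : ℝ) (n : ℕ) : HasCompactSupport (truncPoisson α n) := by
  refine HasCompactSupport.mul_right (f := fun x : ℝ => cutoff (x / (n + 1)))
    (HasCompactSupport.intro (K := Metric.closedBall 0 (2 * (n + 1))) (isCompact_closedBall _ _)
      fun x hx => ?_)
  refine cutoff.zero_of_le_dist ?_
  rw [mem_closedBall_zero_iff, not_le] at hx
  have hn : (0:ℝ) < n + 1 := by positivity
  rw [dist_zero_right, norm_div, Real.norm_of_nonneg hn.le, le_div_iff₀ hn]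
  exact hx.le

theorem truncPoisson_nonneg {α : ℝ} (hα : 0 < α) (n : ℕ) (x : ℝ) : 0 ≤ truncPoisson α n x :=
  mul_nonneg cutoff.nonneg (poisson_nonneg hα.le _)

theorem truncPoisson_le {α : ℝ} (hα : 0 < α) (n : ℕ) (x : ℝ) :
    truncPoisson α n x ≤ poisson α (2 * Real.pi * x) :=
  mul_le_of_le_one_left (poisson_nonneg hα.le _) cutoff.le_one

theorem truncPoisson_eq {α : ℝ} {n : ℕ} {x : ℝ} (hx : |x| ≤ n + 1) :
    truncPoisson α n x = poisson α (2 * Real.pi * x) := by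
  rw [truncPoisson, cutoff.one_of_mem_closedBall, one_mul]
  have hn : (0:ℝ) < n + 1 := by positivity
  rw [mem_closedBall_zero_iff, norm_div, Real.norm_of_nonneg hn.le, div_le_iff₀ hn, Real.norm_eq_abs]
  change |x| ≤ 1 * (n + 1)
  linarith

theorem tendsto_truncPoisson (α x : ℝ) :
    Tendsto (fun n => truncPoisson α n x) atTop (𝓝 (poisson α (2 * Real.pi * x))) := by
  refine tendsto_const_nhds.congr' ?_
  filter_upwards [eventually_ge_atTop ⌈|x|⌉₊] with n hn
  rw [truncPoisson_eq]
  have := (Nat.le_ceil |x|).trans (Nat.cast_le.2 hn)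
  linarith

/-- Dominated convergence: the truncations increase to at most the Poisson kernel, and the
determinantal density is bounded by a factorial. -/
theorem tendsto_moments_truncPoisson {α : ℝ} (hα : 0 < α) :
    Tendsto (fun n => gueThirdMoment (truncPoisson α n) - 3 / 2 * gueSecondMoment (truncPoisson α n) +
      3 / 4 * (∫ x, truncPoisson α n x) - 1 / 8) atTop
      (𝓝 (3 * Real.exp (-(2 * α)) / (16 * α ^ 2))) := by
  rw [← gue_cumulant_poisson hα]
  set p : ℝ → ℝ := fun x => poisson α (2 * Real.pi * x) with hp
  have hp0 : ∀ x, 0 ≤ p x := fun x => poisson_nonneg hα.le _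
  have hcont : ∀ n, Continuous (truncPoisson α n) := fun n => (contDiff_truncPoisson hα n).continuous
  have i1 : Integrable p := integrable_poisson hα
  have i2 : Integrable fun x => p x ^ 2 := integrable_poisson_sq hα
  have i3 : Integrable fun x => p x ^ 3 := (integral_poisson_cube hα).1
  have hle : ∀ n x, |truncPoisson α n x| ≤ p x := fun n x => by
    rw [abs_of_nonneg (truncPoisson_nonneg hα n x)]; exact truncPoisson_le hα n x
  have t1 : Tendsto (fun n => ∫ x, truncPoisson α n x) atTop (𝓝 (∫ x, p x)) :=
    tendsto_integral_of_dominated_convergence p (fun n => (hcont n).aestronglyMeasurable) i1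
      (fun n => Eventually.of_forall (hle n)) (Eventually.of_forall (tendsto_truncPoisson α))
  have tk : ∀ k : ℕ, (Integrable fun x => p x ^ k) →
      Tendsto (fun n => ∫ x, truncPoisson α n x ^ k) atTop (𝓝 (∫ x, p x ^ k)) := fun k hk =>
    tendsto_integral_of_dominated_convergence (fun x => p x ^ k)
      (fun n => ((hcont n).pow k).aestronglyMeasurable) hk
      (fun n => Eventually.of_forall fun x => by
        rw [norm_pow]; exact pow_le_pow_left₀ (norm_nonneg _) (hle n x) k)
      (Eventually.of_forall fun x => (tendsto_truncPoisson α x).pow k)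
  have tprod : ∀ m : ℕ, Tendsto (fun n => ∫ x : Fin m → ℝ, (∏ i, truncPoisson α n (x i)) * gueDensity x)
      atTop (𝓝 (∫ x : Fin m → ℝ, (∏ i, p (x i)) * gueDensity x)) := by
    intro m
    refine tendsto_integral_of_dominated_convergence
      (fun x : Fin m → ℝ => (∏ i, p (x i)) * m.factorial)
      (fun n => Continuous.aestronglyMeasurable (Continuous.mul
        (continuous_finsetProd _ fun i _ => (hcont n).comp (continuous_apply i))
        continuous_gueDensity))
      ((Integrable.fintype_prod (f := fun _ : Fin m => p) (fun _ => i1)).mul_const _)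
      (fun n => Eventually.of_forall fun x => ?_) (Eventually.of_forall fun x => ?_)
    · rw [norm_mul, norm_prod]
      exact mul_le_mul (Finset.prod_le_prod (fun _ _ => norm_nonneg _) fun i _ => hle n _)
        (abs_gueDensity_le x) (norm_nonneg _) (Finset.prod_nonneg fun i _ => hp0 _)
    · exact (tendsto_finsetProd _ fun i _ => tendsto_truncPoisson α (x i)).mul_const _
  have j21 := (Integrable.fintype_prod (f := ![fun x => p x ^ 2, p])
    (μ := fun _ => volume) (by intro j; fin_cases j <;> assumption))
  have j12 := (Integrable.fintype_prod (f := ![p, fun x => p x ^ 2])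
    (μ := fun _ => volume) (by intro j; fin_cases j <;> assumption))
  simp only [Fin.prod_univ_two, Matrix.cons_val_zero, Matrix.cons_val_one] at j21 j12
  have t2 : Tendsto (fun n => ∫ x : Fin 2 → ℝ, (truncPoisson α n (x 0) ^ 2 * truncPoisson α n (x 1) +
      truncPoisson α n (x 0) * truncPoisson α n (x 1) ^ 2) * gueDensity x) atTop
      (𝓝 (∫ x : Fin 2 → ℝ, (p (x 0) ^ 2 * p (x 1) + p (x 0) * p (x 1) ^ 2) * gueDensity x)) := by
    refine tendsto_integral_of_dominated_convergence
      (fun x : Fin 2 → ℝ => (p (x 0) ^ 2 * p (x 1) + p (x 0) * p (x 1) ^ 2) * Nat.factorial 2)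
      (fun n => ?_) ((j21.add j12).mul_const _)
      (fun n => Eventually.of_forall fun x => ?_) (Eventually.of_forall fun x => ?_)
    · have c0 : Continuous fun x : Fin 2 → ℝ => truncPoisson α n (x 0) :=
        (hcont n).comp (continuous_apply 0)
      have c1 : Continuous fun x : Fin 2 → ℝ => truncPoisson α n (x 1) :=
        (hcont n).comp (continuous_apply 1)
      exact ((((c0.pow 2).mul c1).add (c0.mul (c1.pow 2))).mul
        continuous_gueDensity).aestronglyMeasurable
    · have n0 := truncPoisson_nonneg hα n (x 0)
      have n1 := truncPoisson_nonneg hα n (x 1)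
      have l0 := truncPoisson_le hα n (x 0)
      have l1 := truncPoisson_le hα n (x 1)
      rw [norm_mul, Real.norm_of_nonneg (by positivity)]
      have q0 := hp0 (x 0)
      have q1 := hp0 (x 1)
      gcongr
      exact abs_gueDensity_le x
    · have h0 := tendsto_truncPoisson α (x 0)
      have h1 := tendsto_truncPoisson α (x 1)
      exact (((h0.pow 2).mul h1).add (h0.mul (h1.pow 2))).mul_const _
  exact (((((tk 3 i3).add (t2.const_mul (3 / 2))).add (tprod 3)).sub
    (((tk 2 i2).add (tprod 2)).const_mul (3 / 2))).add (t1.const_mul (3 / 4))).sub_const _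

/-- The rate of approximation of the Poisson kernel by its truncation. -/
def truncRate (n : ℕ) : ℝ := (1 + ((n : ℝ) + 1) ^ 2) ^ (-(1 / 4) : ℝ)

theorem truncRate_pos (n : ℕ) : 0 < truncRate n := Real.rpow_pos_of_pos (by positivity) _

theorem truncRate_le_one (n : ℕ) : truncRate n ≤ 1 :=
  Real.rpow_le_one_of_one_le_of_nonpos (by nlinarith [sq_nonneg ((n : ℝ) + 1)]) (by norm_num)

theorem tendsto_truncRate : Tendsto truncRate atTop (𝓝 0) := by
  refine (tendsto_rpow_neg_atTop (by norm_num : (0:ℝ) < 1 / 4)).comp ?_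
  refine tendsto_atTop_mono (fun n => ?_) tendsto_natCast_atTop_atTop
  nlinarith [sq_nonneg (n : ℝ)]

/-- The window decays slower than the Poisson kernel by a factor (1 + x²)^{1/4}, yet is still
integrable. The spare factor is what makes the truncated tail small relative to the window. -/
theorem inv_one_add_sq_eq (x : ℝ) :
    (1 + x ^ 2)⁻¹ = (1 + x ^ 2) ^ (-(1 / 4) : ℝ) * window x := by
  rw [window, ← Real.rpow_add (by positivity), ← Real.rpow_neg_one]
  norm_num

theorem inv_one_add_sq_le_window (x : ℝ) : (1 + x ^ 2)⁻¹ ≤ window x := by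
  rw [inv_one_add_sq_eq]
  exact mul_le_of_le_one_left (window_pos x).le
    (Real.rpow_le_one_of_one_le_of_nonpos (by nlinarith [sq_nonneg x]) (by norm_num))

/-- Two errors are combined: the kernel is Lipschitz in its width relative to 1/(1 + x²), and the
truncation acts only for |x| > n + 1, where the spare decay is at most `truncRate n`. The constant
is uniform for widths in [c, C]. -/
theorem exists_abs_poisson_sub_truncPoisson_le {c C : ℝ} (hc : 0 < c) :
    ∃ D : ℝ, 0 < D ∧ ∀ α α₀ : ℝ, c ≤ α → α ≤ C → c ≤ α₀ → α₀ ≤ C → ∀ (n : ℕ) (x : ℝ),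
      |poisson α (2 * Real.pi * x) - truncPoisson α₀ n x| ≤
        D * (|α - α₀| + truncRate n) * window x ∧ truncPoisson α₀ n x ≤ D * window x := by
  set m := min (c ^ 2) 1 with hm
  have hm0 : 0 < m := lt_min (by positivity) one_pos
  set D := (1 + C ^ 2 / c ^ 2 + |C|) / m with hD
  have hD0 : 0 < D := by positivity
  refine ⟨D, hD0, fun α α₀ h1 h2 h3 h4 n x => ?_⟩
  have hα : 0 < α := by linarith
  have hα₀ : 0 < α₀ := by linarith
  have hC : 0 < C := by linarith
  set y := (2 * Real.pi * x) ^ 2 with hy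
  have hy0 : 0 ≤ y := sq_nonneg _
  have hyx : x ^ 2 ≤ y := by
    rw [hy, mul_pow]
    have : 1 ≤ (2 * Real.pi) ^ 2 := by nlinarith [Real.pi_gt_three]
    nlinarith [sq_nonneg x]
  have hden : ∀ β, c ≤ β → m * (1 + x ^ 2) ≤ β ^ 2 + y := by
    intro β hβ
    have e1 : m ≤ c ^ 2 := min_le_left _ _
    have e2 : m ≤ 1 := min_le_right _ _
    nlinarith [sq_nonneg x]
  have hinv : ∀ β, c ≤ β → 1 / (β ^ 2 + y) ≤ (1 / m) * (1 + x ^ 2)⁻¹ := by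
    intro β hβ
    have hpos : 0 < m * (1 + x ^ 2) := by positivity
    calc 1 / (β ^ 2 + y) ≤ 1 / (m * (1 + x ^ 2)) := one_div_le_one_div_of_le hpos (hden β hβ)
      _ = _ := by field_simp
  have hpo : poisson α₀ (2 * Real.pi * x) ≤ D * (1 + x ^ 2)⁻¹ := by
    have : poisson α₀ (2 * Real.pi * x) = α₀ * (1 / (α₀ ^ 2 + y)) := by
      unfold poisson; rw [← hy]; ring
    rw [this]
    calc _ ≤ C * ((1 / m) * (1 + x ^ 2)⁻¹) := by
          gcongr
          exact hinv α₀ h3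
      _ ≤ D * (1 + x ^ 2)⁻¹ := by
          rw [← mul_assoc]
          gcongr
          rw [hD, mul_one_div, abs_of_pos hC]
          gcongr
          have : 0 ≤ C ^ 2 / c ^ 2 := by positivity
          linarith
  have hdiff : |poisson α (2 * Real.pi * x) - poisson α₀ (2 * Real.pi * x)| ≤
      D * |α - α₀| * (1 + x ^ 2)⁻¹ := by
    have hp1 : 0 < α ^ 2 + y := by positivity
    have hp2 : 0 < α₀ ^ 2 + y := by positivity
    -- The middle quotient is bounded by 1 + C²/c² and the last factor by a multiple of 1/(1 + x²).
    have e : poisson α (2 * Real.pi * x) - poisson α₀ (2 * Real.pi * x) =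
        (α - α₀) * ((y - α * α₀) / (α₀ ^ 2 + y)) * (1 / (α ^ 2 + y)) := by
      unfold poisson
      rw [← hy]
      field_simp
      ring
    have hq : |(y - α * α₀) / (α₀ ^ 2 + y)| ≤ 1 + C ^ 2 / c ^ 2 := by
      rw [abs_div, abs_of_pos hp2, div_le_iff₀ hp2]
      have h5 : α * α₀ ≤ C ^ 2 / c ^ 2 * α₀ ^ 2 := by
        have : α * α₀ ≤ C ^ 2 := by nlinarith
        have h6 : c ^ 2 ≤ α₀ ^ 2 := by gcongr
        calc _ ≤ C ^ 2 / c ^ 2 * c ^ 2 := by rwa [div_mul_cancel₀ _ (by positivity)]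
          _ ≤ _ := by gcongr
      have h7 : 0 ≤ C ^ 2 / c ^ 2 * y := by positivity
      have h8 : 0 < α * α₀ := by positivity
      rw [abs_le]
      constructor <;> nlinarith
    rw [e, abs_mul, abs_mul, abs_of_pos (by positivity : 0 < 1 / (α ^ 2 + y))]
    calc _ ≤ |α - α₀| * (1 + C ^ 2 / c ^ 2) * ((1 / m) * (1 + x ^ 2)⁻¹) := by
          gcongr
          exact hinv α h1
      _ = (1 + C ^ 2 / c ^ 2) / m * |α - α₀| * (1 + x ^ 2)⁻¹ := by ring
      _ ≤ _ := by
          gcongr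
          rw [hD]
          exact div_le_div_of_nonneg_right (by linarith [abs_nonneg C]) hm0.le
  have hw := inv_one_add_sq_le_window x
  have hw0 := window_pos x
  have htr : |poisson α₀ (2 * Real.pi * x) - truncPoisson α₀ n x| ≤ D * truncRate n * window x := by
    by_cases hx : |x| ≤ n + 1
    · rw [truncPoisson_eq hx, sub_self, abs_zero]
      have := truncRate_pos n
      positivity
    · rw [abs_of_nonneg (sub_nonneg.2 (truncPoisson_le hα₀ n x))]
      have hr : (1 + x ^ 2) ^ (-(1 / 4) : ℝ) ≤ truncRate n := by
        refine Real.rpow_le_rpow_of_nonpos (by positivity) ?_ (by norm_num)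
        have : ((n : ℝ) + 1) ^ 2 ≤ |x| ^ 2 := by gcongr; linarith
        rw [sq_abs] at this
        linarith
      calc _ ≤ poisson α₀ (2 * Real.pi * x) := by linarith [truncPoisson_nonneg hα₀ n x]
        _ ≤ D * ((1 + x ^ 2) ^ (-(1 / 4) : ℝ) * window x) := by rwa [← inv_one_add_sq_eq]
        _ ≤ D * (truncRate n * window x) := by gcongr
        _ = _ := by ring
  constructor
  · calc _ ≤ |poisson α (2 * Real.pi * x) - poisson α₀ (2 * Real.pi * x)| +
          |poisson α₀ (2 * Real.pi * x) - truncPoisson α₀ n x| := abs_sub_le _ _ _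
      _ ≤ D * |α - α₀| * window x + D * truncRate n * window x := by
          refine add_le_add (hdiff.trans ?_) htr
          gcongr
      _ = _ := by ring
  · exact ((truncPoisson_le hα₀ n x).trans hpo).trans (by gcongr)

/-! ### Comparing the third moments -/

theorem add_cube_le {x y : ℝ} (hx : 0 ≤ x) (hy : 0 ≤ y) : (x + y) ^ 3 ≤ 4 * x ^ 3 + 4 * y ^ 3 := by
  nlinarith [mul_nonneg (add_nonneg hx hy) (sq_nonneg (x - y))]

/-- Split according to whether |A − B| ≤ η|B|; the three terms of the binomial expansion have
coefficients adding to 7. The first term needs only a bounded third moment of B, the second a small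
third moment of the error. -/
theorem abs_cube_sub_cube_le {η A B : ℝ} (hη : 0 < η) (hη' : η ≤ 1) :
    |A ^ 3 - B ^ 3| ≤ 7 * η * |B| ^ 3 + 7 / η ^ 2 * |A - B| ^ 3 := by
  set d := |A - B| with hd
  set b := |B| with hb
  have hd0 : 0 ≤ d := abs_nonneg _
  have hb0 : 0 ≤ b := abs_nonneg _
  have h1 : |A ^ 3 - B ^ 3| ≤ 3 * b ^ 2 * d + 3 * b * d ^ 2 + d ^ 3 := by
    have e : A ^ 3 - B ^ 3 = 3 * B ^ 2 * (A - B) + 3 * B * (A - B) ^ 2 + (A - B) ^ 3 := by ring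
    rw [e]
    refine (abs_add_le _ _).trans (add_le_add ((abs_add_le _ _).trans (le_of_eq ?_)) (le_of_eq ?_))
    · rw [abs_mul, abs_mul, abs_mul, abs_mul, abs_pow, abs_pow, abs_of_pos (by norm_num : (0:ℝ) < 3)]
    · rw [abs_pow]
  refine h1.trans ?_
  rcases le_total d (η * b) with h | h
  · have hdb : d ≤ b := h.trans (mul_le_of_le_one_left hb0 hη')
    have h2 : d * b ^ 2 ≤ η * b ^ 3 := by nlinarith [mul_le_mul_of_nonneg_right h (sq_nonneg b)]
    have h3 : d ^ 2 * b ≤ d * b ^ 2 := by nlinarith [mul_nonneg hd0 hb0]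
    have h4 : d ^ 3 ≤ d ^ 2 * b := by nlinarith [sq_nonneg d]
    have : 0 ≤ 7 / η ^ 2 * d ^ 3 := by positivity
    linarith
  · have hbd : b ≤ d / η := by rw [le_div_iff₀ hη]; linarith
    have hinv : 1 ≤ 1 / η := by rw [le_div_iff₀ hη]; linarith
    have h2 : b ^ 2 * d ≤ 1 / η ^ 2 * d ^ 3 := by
      calc b ^ 2 * d ≤ (d / η) ^ 2 * d := by gcongr
        _ = _ := by field_simp
    have hinv2 : 1 / η ≤ 1 / η ^ 2 := by
      rw [show 1 / η ^ 2 = (1 / η) * (1 / η) by field_simp]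
      nlinarith
    have h3 : b * d ^ 2 ≤ 1 / η ^ 2 * d ^ 3 := by
      calc b * d ^ 2 ≤ (d / η) * d ^ 2 := by gcongr
        _ = 1 / η * d ^ 3 := by field_simp
        _ ≤ _ := by gcongr
    have h4 : d ^ 3 ≤ 1 / η ^ 2 * d ^ 3 :=
      le_mul_of_one_le_left (by positivity) (hinv.trans hinv2)
    have h5 : 0 ≤ 7 * η * b ^ 3 := by positivity
    have e : 7 / η ^ 2 * d ^ 3 = 7 * (1 / η ^ 2 * d ^ 3) := by ring
    rw [e]
    linarith

/-- This is u³/6 ≤ eᵘ at u = log(T/t). Integrated over t it gives O(T log T), so replacing log t by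
log T is harmless after division by log³ T. -/
theorem log_sub_log_cube_le {T t : ℝ} (ht : 0 < t) (htT : t ≤ T) :
    (Real.log T - Real.log t) ^ 3 ≤ 6 * T * t⁻¹ := by
  have hT : 0 < T := ht.trans_le htT
  have h0 : 0 ≤ Real.log T - Real.log t := sub_nonneg.2 (Real.log_le_log ht htT)
  have h := Real.pow_div_factorial_le_exp (x := Real.log T - Real.log t) h0 3
  rw [Real.exp_sub, Real.exp_log hT, Real.exp_log ht] at h
  norm_num [Nat.factorial] at h
  rw [div_le_iff₀ (by norm_num)] at h
  calc _ ≤ T / t * 6 := h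
    _ = _ := by rw [div_eq_mul_inv]; ring

/-- The Poisson kernel is homogeneous of degree −1, so rescaling by log T turns width x into width α
= x log T. -/
theorem sum_poisson_eq_linStat {x T : ℝ} (hL : 0 < Real.log T) (t : ℝ) :
    (∑ p ∈ zeroIndex T, poisson x (t - p.1)) / Real.log T =
      linStat (fun y => poisson (x * Real.log T) (2 * Real.pi * y)) T t := by
  unfold linStat
  rw [Finset.sum_div]
  refine Finset.sum_congr rfl fun p _ => ?_
  have hpi := Real.pi_pos
  have e : 2 * Real.pi * (Real.log T / (2 * Real.pi) * (t - p.1)) = Real.log T * (t - p.1) := by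
    field_simp
  beta_reduce
  rw [e]
  unfold poisson
  rw [mul_pow, mul_pow, mul_comm (x ^ 2), ← mul_add, div_div, mul_comm x,
    show Real.log T ^ 2 * (x ^ 2 + (t - p.1) ^ 2) =
      Real.log T * ((x ^ 2 + (t - p.1) ^ 2) * Real.log T) by ring,
    mul_div_mul_left _ _ hL.ne']

theorem abs_linStat_sub_le {φ ψ w : ℝ → ℝ} {δ : ℝ} (h : ∀ x, |φ x - ψ x| ≤ δ * w x) (T t : ℝ) :
    |linStat φ T t - linStat ψ T t| ≤ δ * linStat w T t := by
  unfold linStat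
  rw [← Finset.sum_sub_distrib, Finset.mul_sum]
  exact (Finset.abs_sum_le_sum_abs _ _).trans (Finset.sum_le_sum fun p _ => h _)

theorem linStat_mono {φ ψ : ℝ → ℝ} (h : ∀ x, φ x ≤ ψ x) (T t : ℝ) :
    linStat φ T t ≤ linStat ψ T t := Finset.sum_le_sum fun _ _ => h _

theorem linStat_nonneg {φ : ℝ → ℝ} (h : ∀ x, 0 ≤ φ x) (T t : ℝ) : 0 ≤ linStat φ T t :=
  Finset.sum_nonneg fun _ _ => h _

theorem linStat_const_mul (b : ℝ) (φ : ℝ → ℝ) (T t : ℝ) :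
    linStat (fun x => b * φ x) T t = b * linStat φ T t := by
  unfold linStat; rw [Finset.mul_sum]

/-- Comparison of the third moment of `Re ζ'/ζ` with that of a linear statistic, for one `T`. -/
theorem abs_integral_cube_sub_le (hRH : RiemannHypothesis) {c C : ℝ} (hc : 0 < c) (hcC : c ≤ C)
    {W : ℝ} (hW : 0 < W) :
    ∃ D K : ℝ, 0 < D ∧ 0 < K ∧ ∀ (T x α₀ : ℝ) (n : ℕ), 4 ≤ T → 0 < Real.log T → 0 < x → x ≤ 1 / 4 →
      c ≤ x * Real.log T → x * Real.log T ≤ C → c ≤ α₀ → α₀ ≤ C →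
      ∫ t, linStat window T t ^ 3 ≤ W * T → |x * Real.log T - α₀| ≤ truncRate n →
      |(∫ t in (1:ℝ)..(T - 1), ((logDeriv riemannZeta (1 / 2 + x + t * I)).re / Real.log T) ^ 3) -
        ∫ t in (1:ℝ)..(T - 1), (linStat (truncPoisson α₀ n) T t - 1 / 2) ^ 3| ≤
      D * truncRate n * T + K / truncRate n ^ 2 * T / Real.log T ^ 2 +
        K / truncRate n ^ 2 * T / Real.log T ^ 3 := by
  obtain ⟨K₁, hK₁, h₁⟩ := exists_abs_re_sub_sum_poisson_le hRH
  obtain ⟨D, hD, h₂⟩ := exists_abs_poisson_sub_truncPoisson_le (C := C) hc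
  have hC : 0 < C := hc.trans_le hcC
  set K' := 24 + K₁ * (2 * C) with hK'
  have hK'0 : 0 < K' := by positivity
  -- The constants are those of the cube inequality at η = ε: 252 = 7 · 4 + 7 · 32, 112 = 7 · 16 and
  -- 84 = 7 · 12.
  refine ⟨252 * D ^ 3 * W + 7 / 2, 112 * K' ^ 3 + 84, by positivity, by positivity, ?_⟩
  intro T x α₀ n hT hL hx hx' hcx hxC hcα hαC hwin hαα
  set L := Real.log T with hLdef
  set ε := truncRate n with hε
  have hε0 : 0 < ε := truncRate_pos n
  have hε1 : ε ≤ 1 := truncRate_le_one n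
  set S : ℝ → ℝ := linStat window T with hS
  have hS0 : ∀ t, 0 ≤ S t := linStat_nonneg (fun x => (window_pos x).le) T
  set A : ℝ → ℝ := fun t => (logDeriv riemannZeta (1 / 2 + x + t * I)).re / L with hA
  set B : ℝ → ℝ := fun t => linStat (truncPoisson α₀ n) T t - 1 / 2 with hB
  have hα₀ : 0 < α₀ := hc.trans_le hcα
  have hT1 : (1:ℝ) ≤ T - 1 := by linarith
  have hlog2 : Real.log (T + 2) ≤ 2 * L :=
    (Real.log_le_log (by linarith) (by linarith)).trans (log_add_four_le hT)
  -- The first term is the error in the kernel, from changing its width and truncating it, each at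
  -- rate ε. The others are the bounded error of the Poisson formula and the replacement of log t by
  -- L.
  have hAB : ∀ t, 1 ≤ t → t ≤ T - 1 →
      |A t - B t| ≤ 2 * D * ε * S t + (K' / L + (L - Real.log t) / (2 * L)) := by
    intro t ht htT
    have h3 := h₁ x T t hx hx' ht htT
    have h4 := abs_linStat_sub_le (fun y => (h₂ (x * L) α₀ hcx hxC hcα hαC n y).1) T t
    rw [← sum_poisson_eq_linStat hL] at h4
    set P := ∑ p ∈ zeroIndex T, poisson x (t - p.1)
    have hlt : Real.log t ≤ L := Real.log_le_log (by linarith) (by linarith)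
    have h5 : |A t - (P / L - Real.log t / (2 * L))| ≤ K' / L := by
      have : A t - (P / L - Real.log t / (2 * L)) =
          ((logDeriv riemannZeta (1 / 2 + x + t * I)).re - (P - Real.log t / 2)) / L := by
        simp only [hA]; field_simp
      rw [this, abs_div, abs_of_pos hL]
      refine div_le_div_of_nonneg_right (h3.trans ?_) hL.le
      rw [hK']
      have : x * Real.log (T + 2) ≤ 2 * C := by nlinarith
      nlinarith
    have h6 : |P / L - linStat (truncPoisson α₀ n) T t| ≤ 2 * D * ε * S t := by
      refine h4.trans ?_
      refine mul_le_mul_of_nonneg_right ?_ (hS0 t)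
      nlinarith
    have h7 : (L - Real.log t) / (2 * L) = 1 / 2 - Real.log t / (2 * L) := by field_simp
    have h8 : 0 ≤ (L - Real.log t) / (2 * L) := div_nonneg (by linarith) (by linarith)
    rw [h7] at h8 ⊢
    rw [abs_le] at h5 h6 ⊢
    simp only [hB]
    constructor <;> linarith [h5.1, h5.2, h6.1, h6.2]
  have hBS : ∀ t, |B t| ≤ D * S t + 1 / 2 := by
    intro t
    have h3 : linStat (truncPoisson α₀ n) T t ≤ D * S t := by
      rw [hS, ← linStat_const_mul]
      exact linStat_mono (fun y => (h₂ α₀ α₀ hcα hαC hcα hαC n y).2) T t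
    have h4 := linStat_nonneg (truncPoisson_nonneg hα₀ n) T t
    rw [abs_le]
    simp only [hB]
    constructor <;> linarith [mul_nonneg hD.le (hS0 t)]
  have hpt : ∀ t, 1 ≤ t → t ≤ T - 1 → |A t ^ 3 - B t ^ 3| ≤
      252 * D ^ 3 * ε * S t ^ 3 + (7 / 2 * ε + 112 * K' ^ 3 / ε ^ 2 / L ^ 3) +
        84 / ε ^ 2 * T / L ^ 3 * t⁻¹ := by
    intro t ht htT
    have hlt : 0 ≤ L - Real.log t := sub_nonneg.2 (Real.log_le_log (by linarith) (by linarith))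
    have hSt := hS0 t
    have b1 : |B t| ^ 3 ≤ 4 * D ^ 3 * S t ^ 3 + 1 / 2 := by
      refine (pow_le_pow_left₀ (abs_nonneg _) (hBS t) 3).trans
        ((add_cube_le (mul_nonneg hD.le hSt) (by norm_num)).trans (le_of_eq (by ring)))
    have b2 : |A t - B t| ^ 3 ≤ 32 * D ^ 3 * ε ^ 3 * S t ^ 3 + 16 * K' ^ 3 / L ^ 3 +
        12 * T / L ^ 3 * t⁻¹ := by
      have e1 : 0 ≤ K' / L := by positivity
      have e2 : 0 ≤ (L - Real.log t) / (2 * L) := div_nonneg hlt (by positivity)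
      have e3 : ((L - Real.log t) / (2 * L)) ^ 3 ≤ 3 / 4 * T / L ^ 3 * t⁻¹ := by
        rw [div_pow, div_le_iff₀ (by positivity)]
        calc _ ≤ 6 * T * t⁻¹ := log_sub_log_cube_le (by linarith) (by linarith)
          _ = _ := by field_simp; ring
      have e4 : (K' / L) ^ 3 = K' ^ 3 / L ^ 3 := div_pow _ _ _
      calc _ ≤ (2 * D * ε * S t + (K' / L + (L - Real.log t) / (2 * L))) ^ 3 :=
            pow_le_pow_left₀ (abs_nonneg _) (hAB t ht htT) 3
        _ ≤ 4 * (2 * D * ε * S t) ^ 3 + 4 * (K' / L + (L - Real.log t) / (2 * L)) ^ 3 :=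
            add_cube_le (by positivity) (by positivity)
        _ ≤ 4 * (2 * D * ε * S t) ^ 3 +
            4 * (4 * (K' / L) ^ 3 + 4 * ((L - Real.log t) / (2 * L)) ^ 3) := by
            gcongr; exact add_cube_le e1 e2
        _ ≤ 4 * (2 * D * ε * S t) ^ 3 +
            4 * (4 * (K' ^ 3 / L ^ 3) + 4 * (3 / 4 * T / L ^ 3 * t⁻¹)) := by
            rw [e4]; gcongr
        _ = _ := by ring
    calc _ ≤ 7 * ε * |B t| ^ 3 + 7 / ε ^ 2 * |A t - B t| ^ 3 := abs_cube_sub_cube_le hε0 hε1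
      _ ≤ 7 * ε * (4 * D ^ 3 * S t ^ 3 + 1 / 2) + 7 / ε ^ 2 *
          (32 * D ^ 3 * ε ^ 3 * S t ^ 3 + 16 * K' ^ 3 / L ^ 3 + 12 * T / L ^ 3 * t⁻¹) := by gcongr
      _ = _ := by field_simp; ring
  have hAc : Continuous A :=
    (Complex.continuous_re.comp (continuous_logDeriv_riemannZeta_line hRH hx (by linarith))).div_const L
  have hBc : Continuous B :=
    (continuous_linStat (contDiff_truncPoisson hα₀ n).continuous T).sub continuous_const
  have hSc : Continuous S := continuous_linStat continuous_window T
  have hinvi : IntervalIntegrable (fun t : ℝ => t⁻¹) volume 1 (T - 1) :=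
    intervalIntegral.intervalIntegrable_inv (fun t ht => by
      rw [Set.uIcc_of_le hT1] at ht; linarith [ht.1]) continuousOn_id
  have hS3 : ∫ t in (1:ℝ)..(T - 1), S t ^ 3 ≤ W * T := by
    rw [intervalIntegral.integral_of_le hT1]
    refine (setIntegral_le_integral (integrable_linStat_pow continuous_window integrable_window
      (B := 1) (fun x => by rw [abs_of_pos (window_pos x)]; exact window_le_one x) (by linarith)
      three_ne_zero) (Eventually.of_forall fun t => pow_nonneg (hS0 t) 3)).trans hwin
  have hInt : ∫ t in (1:ℝ)..(T - 1), t⁻¹ ≤ L := by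
    rw [integral_inv_of_pos one_pos (by linarith), div_one]
    exact Real.log_le_log (by linarith) (by linarith)
  have hsub := intervalIntegral.integral_sub (f := fun t => A t ^ 3) (g := fun t => B t ^ 3)
    ((hAc.pow 3).intervalIntegrable (μ := volume) 1 (T - 1))
    ((hBc.pow 3).intervalIntegrable (μ := volume) 1 (T - 1))
  change |(∫ t in (1:ℝ)..(T - 1), A t ^ 3) - ∫ t in (1:ℝ)..(T - 1), B t ^ 3| ≤ _
  rw [← hsub]
  have i1 : IntervalIntegrable (fun t => 252 * D ^ 3 * ε * S t ^ 3) volume 1 (T - 1) :=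
    ((hSc.pow 3).const_mul _).intervalIntegrable _ _
  have i2 : IntervalIntegrable (fun t => 252 * D ^ 3 * ε * S t ^ 3 +
      (7 / 2 * ε + 112 * K' ^ 3 / ε ^ 2 / L ^ 3)) volume 1 (T - 1) :=
    i1.add intervalIntegrable_const
  have i3 : IntervalIntegrable (fun t : ℝ => 84 / ε ^ 2 * T / L ^ 3 * t⁻¹) volume 1 (T - 1) :=
    hinvi.const_mul _
  have hnorm := intervalIntegral.norm_integral_le_of_norm_le (f := fun t => A t ^ 3 - B t ^ 3) hT1
    (Eventually.of_forall fun t ht => hpt t ht.1.le ht.2) (i2.add i3)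
  rw [Real.norm_eq_abs] at hnorm
  refine hnorm.trans ?_
  rw [intervalIntegral.integral_add i2 i3, intervalIntegral.integral_add i1 intervalIntegrable_const,
    intervalIntegral.integral_const_mul, intervalIntegral.integral_const_mul,
    intervalIntegral.integral_const, smul_eq_mul]
  have hq0 : 0 ≤ 7 / 2 * ε + 112 * K' ^ 3 / ε ^ 2 / L ^ 3 := by positivity
  calc _ ≤ 252 * D ^ 3 * ε * (W * T) + T * (7 / 2 * ε + 112 * K' ^ 3 / ε ^ 2 / L ^ 3) +
        84 / ε ^ 2 * T / L ^ 3 * L := by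
        gcongr
        linarith
    _ = (252 * D ^ 3 * W + 7 / 2) * ε * T + 84 / ε ^ 2 * T / L ^ 2 +
        112 * K' ^ 3 / ε ^ 2 * T / L ^ 3 := by field_simp; ring
    _ ≤ _ := by
        gcongr
        · have : 0 < K' ^ 3 := by positivity
          linarith
        · linarith

/-- An ε/3 argument exchanging the two limits; how far along the filter one must go may depend on n.
-/
theorem tendsto_of_forall_eventually_abs_sub_le {ι : Type*} {l : Filter ι} {X : ι → ℝ}
    {Y : ℕ → ι → ℝ} {M ε : ℕ → ℝ} {κ D : ℝ} (hY : ∀ n, Tendsto (Y n) l (𝓝 (M n)))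
    (hM : Tendsto M atTop (𝓝 κ)) (hε : Tendsto ε atTop (𝓝 0))
    (h : ∀ n, ∀ᶠ i in l, |X i - Y n i| ≤ D * ε n) : Tendsto X l (𝓝 κ) := by
  rw [Metric.tendsto_nhds]
  intro δ hδ
  have h1 : Tendsto (fun n => D * ε n) atTop (𝓝 0) := by simpa using hε.const_mul D
  obtain ⟨n, hn1, hn2⟩ := ((h1.eventually_lt_const (u := δ / 3) (by linarith)).and
    (Metric.tendsto_nhds.1 hM (δ / 3) (by linarith))).exists
  filter_upwards [h n, Metric.tendsto_nhds.1 (hY n) (δ / 3) (by linarith)] with i h2 h3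
  rw [Real.dist_eq] at *
  rw [abs_lt] at *
  rw [abs_le] at h2
  constructor <;> linarith [h2.1, h2.2, h3.1, h3.2, hn2.1, hn2.2]

/-! ### Limits of the third moment and the conclusion -/

/-- For fixed n the terms carrying `truncRate n` in the denominator vanish as T grows, so the error
is eventually O(`truncRate n`); then n tends to infinity. The filter l is general so that a log T
may be assumed convergent along it. -/
theorem tendsto_integral_re_cube_interval (hRH : RiemannHypothesis) (h1 : CorrelationAgrees 1)
    (h2 : CorrelationAgrees 2) {l : Filter ℝ} (hl : l ≤ atTop) {a : ℝ → ℝ} {c C α₀ : ℝ}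
    (hc : 0 < c) (ha : ∀ᶠ T in l, c ≤ a T * Real.log T ∧ a T * Real.log T ≤ C)
    (hα : Tendsto (fun T => a T * Real.log T) l (𝓝 α₀)) (hcα : c ≤ α₀) (hαC : α₀ ≤ C) :
    Tendsto (fun T => (∫ t in (1:ℝ)..(T - 1),
      ((logDeriv riemannZeta (1 / 2 + a T + t * I)).re / Real.log T) ^ 3) / T) l
      (𝓝 (3 * Real.exp (-(2 * α₀)) / (16 * α₀ ^ 2))) := by
  obtain ⟨W, hW, hwin⟩ := exists_integral_linStat_window_cube_le (countAsymptotic hRH) h1 h2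
  obtain ⟨D, K, hD, hK, hmain⟩ := abs_integral_cube_sub_le hRH hc (hcα.trans hαC) hW
  have hα₀ : 0 < α₀ := hc.trans_le hcα
  refine tendsto_of_forall_eventually_abs_sub_le (ε := truncRate) (D := D + 1) (fun n =>
    (tendsto_integral_linStat_sub_cube hRH h1 h2 (contDiff_truncPoisson hα₀ n)
      (hasCompactSupport_truncPoisson α₀ n)).mono_left hl) (tendsto_moments_truncPoisson hα₀)
    tendsto_truncRate fun n => ?_
  have hε0 := truncRate_pos n
  have hinv : Tendsto (fun T : ℝ => (Real.log T)⁻¹) atTop (𝓝 0) :=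
    tendsto_inv_atTop_zero.comp Real.tendsto_log_atTop
  have hsmall : Tendsto (fun T : ℝ => K / truncRate n ^ 2 * (Real.log T)⁻¹ ^ 2 +
      K / truncRate n ^ 2 * (Real.log T)⁻¹ ^ 3) l (𝓝 0) := by
    simpa using (((hinv.pow 2).const_mul (K / truncRate n ^ 2)).add
      ((hinv.pow 3).const_mul (K / truncRate n ^ 2))).mono_left hl
  have hdist : ∀ᶠ T in l, |a T * Real.log T - α₀| ≤ truncRate n := by
    filter_upwards [Metric.tendsto_nhds.1 hα _ hε0] with T hT
    exact (Real.dist_eq _ _ ▸ hT).le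
  filter_upwards [hwin.filter_mono hl, (eventually_ge_atTop (4:ℝ)).filter_mono hl, ha, hdist,
    (Real.tendsto_log_atTop.eventually_ge_atTop (1 + 4 * C)).filter_mono hl,
    hsmall.eventually_le_const hε0] with T hwT hT4 haT hdT hLT hsT
  have hC : 0 < C := hα₀.trans_le hαC
  have hL : 0 < Real.log T := by linarith
  have hT0 : 0 < T := by linarith
  have hx : 0 < a T := pos_of_mul_pos_left (hc.trans_le haT.1) hL.le
  have hx' : a T ≤ 1 / 4 := by nlinarith [haT.2]
  have := hmain T (a T) α₀ n hT4 hL hx hx' haT.1 haT.2 hcα hαC hwT hdT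
  rw [← sub_div, abs_div, abs_of_pos hT0, div_le_iff₀ hT0]
  refine this.trans ?_
  calc _ = (D * truncRate n + (K / truncRate n ^ 2 * (Real.log T)⁻¹ ^ 2 +
      K / truncRate n ^ 2 * (Real.log T)⁻¹ ^ 3)) * T := by field_simp; ring
    _ ≤ (D * truncRate n + truncRate n) * T := by gcongr
    _ = _ := by ring

theorem one_add_inv_mul_log_le {c : ℝ} (hc : 0 < c) {x T : ℝ} (hT : 4 ≤ T)
    (hL : 1 ≤ Real.log T) (hx : 0 < x) (hcx : c ≤ x * Real.log T) :
    (1 + 1 / x) * Real.log (T + 2) ≤ 2 * (1 + 1 / c) * Real.log T ^ 2 := by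
  have hlog2 : Real.log (T + 2) ≤ 2 * Real.log T :=
    (Real.log_le_log (by linarith) (by linarith)).trans (log_add_four_le hT)
  have h1 : 1 / x ≤ Real.log T / c := by
    rw [div_le_div_iff₀ hx hc]; linarith
  have h0 : 0 ≤ Real.log (T + 2) := Real.log_nonneg (by linarith)
  calc (1 + 1 / x) * Real.log (T + 2) ≤ (Real.log T + Real.log T / c) * (2 * Real.log T) := by
        gcongr
    _ = _ := by field_simp

theorem exists_norm_logDeriv_le_log_sq (hRH : RiemannHypothesis) {c : ℝ} (hc : 0 < c) :
    ∃ K : ℝ, 0 < K ∧ ∀ T x t : ℝ, 4 ≤ T → 1 ≤ Real.log T → 0 < x → x ≤ 1 / 4 →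
      c ≤ x * Real.log T → |t| ≤ T →
      ‖logDeriv riemannZeta (1 / 2 + x + t * I)‖ ≤ K * Real.log T ^ 2 := by
  obtain ⟨K, hK, h⟩ := exists_norm_logDeriv_riemannZeta_le_log hRH
  refine ⟨K * (2 * (1 + 1 / c)), by positivity, fun T x t hT hL hx hx' hcx ht => ?_⟩
  refine (h x t hx (by linarith) (Or.inl hx')).trans ?_
  have h1 := one_add_inv_mul_log_le hc hT hL hx hcx
  have h2 : Real.log (|t| + 2) ≤ Real.log (T + 2) :=
    Real.log_le_log (by positivity) (by linarith)
  calc _ ≤ K * (1 + 1 / x) * Real.log (T + 2) := by gcongr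
    _ = K * ((1 + 1 / x) * Real.log (T + 2)) := by ring
    _ ≤ K * (2 * (1 + 1 / c) * Real.log T ^ 2) := by gcongr
    _ = _ := by ring

/-- The third moment of `Re ζ'/ζ`. -/
theorem tendsto_integral_re_cube (hRH : RiemannHypothesis) (h1 : CorrelationAgrees 1)
    (h2 : CorrelationAgrees 2) {l : Filter ℝ} (hl : l ≤ atTop) {a : ℝ → ℝ} {c C α₀ : ℝ}
    (hc : 0 < c) (ha : ∀ᶠ T in l, c ≤ a T * Real.log T ∧ a T * Real.log T ≤ C)
    (hα : Tendsto (fun T => a T * Real.log T) l (𝓝 α₀)) (hcα : c ≤ α₀) (hαC : α₀ ≤ C) :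
    Tendsto (fun T => (∫ t in (0:ℝ)..T, (logDeriv riemannZeta (1 / 2 + a T + t * I)).re ^ 3) /
      (T * Real.log T ^ 3)) l (𝓝 (3 * Real.exp (-(2 * α₀)) / (16 * α₀ ^ 2))) := by
  obtain ⟨K, hK, hb⟩ := exists_norm_logDeriv_le_log_sq hRH hc
  have hmain := tendsto_integral_re_cube_interval hRH h1 h2 hl hc ha hα hcα hαC
  have hz : Tendsto (fun T : ℝ => 2 * K ^ 3 * (Real.log T ^ 3 / T)) l (𝓝 0) := by
    simpa using ((tendsto_log_pow_div 3).const_mul (2 * K ^ 3)).mono_left hl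
  have hdiff : Tendsto (fun T =>
      (∫ t in (0:ℝ)..T, (logDeriv riemannZeta (1 / 2 + a T + t * I)).re ^ 3) / (T * Real.log T ^ 3) -
      (∫ t in (1:ℝ)..(T - 1),
        ((logDeriv riemannZeta (1 / 2 + a T + t * I)).re / Real.log T) ^ 3) / T) l (𝓝 0) := by
    refine squeeze_zero_norm' ?_ hz
    filter_upwards [ha, (eventually_ge_atTop (4:ℝ)).filter_mono hl,
      (Real.tendsto_log_atTop.eventually_ge_atTop (1 + 4 * C)).filter_mono hl] with T haT hT4 hLT
    have hC : 0 < C := hc.trans_le (hcα.trans hαC)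
    have hL : 0 < Real.log T := by linarith
    have hT0 : 0 < T := by linarith
    have hx : 0 < a T := pos_of_mul_pos_left (hc.trans_le haT.1) hL.le
    have hx' : a T ≤ 1 / 4 := by nlinarith [haT.2]
    set u : ℝ → ℝ := fun t => (logDeriv riemannZeta (1 / 2 + a T + t * I)).re with hu
    have huc : Continuous fun t => u t ^ 3 :=
      (Complex.continuous_re.comp (continuous_logDeriv_riemannZeta_line hRH hx (by linarith))).pow 3
    -- The unit intervals at both ends thus cost O(log⁶ T), negligible against T log³ T.
    have hbd : ∀ t, 0 ≤ t → t ≤ T → ‖u t ^ 3‖ ≤ K ^ 3 * Real.log T ^ 6 := by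
      intro t ht0 htT
      have := (Complex.abs_re_le_norm _).trans
        (hb T (a T) t hT4 (by linarith) hx hx' haT.1 (by rwa [abs_of_nonneg ht0]))
      rw [norm_pow]
      refine (pow_le_pow_left₀ (norm_nonneg _) this 3).trans (le_of_eq (by ring))
    have e1 := intervalIntegral.norm_integral_le_of_norm_le_const (a := 0) (b := 1)
      (f := fun t => u t ^ 3) fun t ht => by
        rw [Set.uIoc_of_le zero_le_one] at ht
        exact hbd t ht.1.le (by linarith [ht.2])
    have e2 := intervalIntegral.norm_integral_le_of_norm_le_const (a := T - 1) (b := T)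
      (f := fun t => u t ^ 3) fun t ht => by
        rw [Set.uIoc_of_le (by linarith)] at ht
        exact hbd t (by linarith [ht.1]) ht.2
    have hsplit₁ := intervalIntegral.integral_add_adjacent_intervals
      (huc.intervalIntegrable (μ := volume) 0 1) (huc.intervalIntegrable 1 (T - 1))
    have hsplit₂ := intervalIntegral.integral_add_adjacent_intervals
      (huc.intervalIntegrable (μ := volume) 0 (T - 1)) (huc.intervalIntegrable (T - 1) T)
    have e3 : ∫ t in (1:ℝ)..(T - 1), (u t / Real.log T) ^ 3 =
        (∫ t in (1:ℝ)..(T - 1), u t ^ 3) / Real.log T ^ 3 := by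
      rw [← intervalIntegral.integral_div]
      simp_rw [div_pow]
    change ‖(∫ t in (0:ℝ)..T, u t ^ 3) / (T * Real.log T ^ 3) -
      (∫ t in (1:ℝ)..(T - 1), (u t / Real.log T) ^ 3) / T‖ ≤ _
    rw [e3, ← hsplit₂, ← hsplit₁]
    have e4 : ((∫ t in (0:ℝ)..1, u t ^ 3) + (∫ t in (1:ℝ)..(T - 1), u t ^ 3) +
        ∫ t in (T - 1)..T, u t ^ 3) / (T * Real.log T ^ 3) -
        (∫ t in (1:ℝ)..(T - 1), u t ^ 3) / Real.log T ^ 3 / T =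
        ((∫ t in (0:ℝ)..1, u t ^ 3) + ∫ t in (T - 1)..T, u t ^ 3) / (T * Real.log T ^ 3) := by
      field_simp; ring
    rw [e4, norm_div, Real.norm_of_nonneg (by positivity : 0 ≤ T * Real.log T ^ 3),
      div_le_iff₀ (by positivity)]
    refine (norm_add_le _ _).trans ((add_le_add e1 e2).trans (le_of_eq ?_))
    rw [show |(1:ℝ) - 0| = 1 by norm_num, show T - (T - 1) = (1:ℝ) by ring, abs_one]
    field_simp
    ring
  simpa using hdiff.add hmain

/-- The contribution of the cube of `ζ'/ζ` is negligible. -/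
theorem tendsto_integral_logDeriv_cube (hRH : RiemannHypothesis) {a : ℝ → ℝ} {c C : ℝ}
    (hc : 0 < c) (ha : ∀ᶠ T in atTop, c ≤ a T * Real.log T ∧ a T * Real.log T ≤ C) :
    Tendsto (fun T => (∫ t in (0:ℝ)..T, logDeriv riemannZeta (1 / 2 + a T + t * I) ^ 3).re /
      (T * Real.log T ^ 3)) atTop (𝓝 0) := by
  obtain ⟨K, hK, hb⟩ := exists_norm_logDeriv_le_log_sq hRH hc
  obtain ⟨K₃, hK₃, hb₃⟩ := exists_norm_integral_logDeriv_pow_le hRH 3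
  have hinv : Tendsto (fun T : ℝ => (Real.log T)⁻¹) atTop (𝓝 0) :=
    tendsto_inv_atTop_zero.comp Real.tendsto_log_atTop
  set M := K ^ 3 + K₃ * (2 * (1 + 1 / c)) ^ 3 with hM
  have hz : Tendsto (fun T : ℝ => M * (Real.log T ^ 3 / T) + K₃ * (Real.log T)⁻¹ ^ 3) atTop (𝓝 0) := by
    simpa using ((tendsto_log_pow_div 3).const_mul M).add ((hinv.pow 3).const_mul K₃)
  refine squeeze_zero_norm' ?_ hz
  filter_upwards [ha, eventually_ge_atTop (4:ℝ),
    Real.tendsto_log_atTop.eventually_ge_atTop (1 + 4 * |C|)] with T haT hT4 hLT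
  have hCC := le_abs_self C
  have hC0 := abs_nonneg C
  have hL : 0 < Real.log T := by linarith
  have hT0 : 0 < T := by linarith
  have hx : 0 < a T := pos_of_mul_pos_left (hc.trans_le haT.1) hL.le
  have hx' : a T ≤ 1 / 4 := by nlinarith [haT.2]
  have hFc : Continuous fun t : ℝ => logDeriv riemannZeta (1 / 2 + a T + t * I) ^ 3 :=
    (continuous_logDeriv_riemannZeta_line hRH hx (by linarith)).pow 3
  have e1 := intervalIntegral.norm_integral_le_of_norm_le_const (a := 0) (b := 1)
    (C := K ^ 3 * Real.log T ^ 6)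
    (f := fun t : ℝ => logDeriv riemannZeta (1 / 2 + a T + t * I) ^ 3) fun t ht => by
      rw [Set.uIoc_of_le zero_le_one] at ht
      have := hb T (a T) t hT4 (by linarith) hx hx' haT.1
        (by rw [abs_of_nonneg ht.1.le]; linarith [ht.2])
      rw [norm_pow]
      exact (pow_le_pow_left₀ (norm_nonneg _) this 3).trans (le_of_eq (by ring))
  rw [show |(1:ℝ) - 0| = 1 by norm_num, mul_one] at e1
  have e2 := hb₃ (a T) T hx hx' (by linarith)
  have e3 : ((1 + 1 / a T) * Real.log (T + 2)) ^ 3 ≤ (2 * (1 + 1 / c) * Real.log T ^ 2) ^ 3 :=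
    pow_le_pow_left₀ (mul_nonneg (by positivity) (Real.log_nonneg (by linarith)))
      (one_add_inv_mul_log_le hc hT4 (by linarith) hx haT.1) 3
  rw [norm_div, Real.norm_of_nonneg (by positivity : 0 ≤ T * Real.log T ^ 3),
    div_le_iff₀ (by positivity), Real.norm_eq_abs]
  refine (Complex.abs_re_le_norm _).trans ?_
  rw [← intervalIntegral.integral_add_adjacent_intervals (b := 1) (hFc.intervalIntegrable _ _)
    (hFc.intervalIntegrable _ _)]
  refine (norm_add_le _ _).trans ?_
  calc _ ≤ K ^ 3 * Real.log T ^ 6 + K₃ * (T + (2 * (1 + 1 / c) * Real.log T ^ 2) ^ 3) := by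
        refine add_le_add e1 (e2.trans ?_)
        gcongr
    _ = _ := by
        rw [hM]
        field_simp
        ring

/-- The third moment of `ζ'/ζ`, normalized by its asymptotic value. -/
theorem tendsto_moment_div (hRH : RiemannHypothesis) (h1 : CorrelationAgrees 1)
    (h2 : CorrelationAgrees 2) {a : ℝ → ℝ} {c C : ℝ} (hc : 0 < c)
    (ha : ∀ᶠ T in atTop, c ≤ a T * Real.log T ∧ a T * Real.log T ≤ C) :
    Tendsto (fun T => (8 / 3 * (∫ t in (0:ℝ)..T, (logDeriv riemannZeta (1 / 2 + a T + t * I)).re ^ 3) -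
        2 / 3 * (∫ t in (0:ℝ)..T, logDeriv riemannZeta (1 / 2 + a T + t * I) ^ 3).re) /
      (T * Real.log T * (T ^ (-2 * a T) / (2 * a T ^ 2)))) atTop (𝓝 1) := by
  -- The product a(T) log T is only known to stay in [c, C]. Along an ultrafilter compactness
  -- supplies a limit α₀, and the limit of the ratio will not depend on it.
  rw [tendsto_iff_ultrafilter]
  intro g hg
  have hag := ha.filter_mono hg
  obtain ⟨α₀, hα₀, hlim⟩ := isCompact_Icc.ultrafilter_le_nhds (g.map fun T => a T * Real.log T)
    (s := Set.Icc c C) (by rw [le_principal_iff]; exact hag)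
  have hα : Tendsto (fun T => a T * Real.log T) g (𝓝 α₀) := hlim
  have hα0 : 0 < α₀ := hc.trans_le hα₀.1
  have hU := tendsto_integral_re_cube hRH h1 h2 hg hc hag hα hα₀.1 hα₀.2
  have hV := (tendsto_integral_logDeriv_cube hRH hc ha).mono_left hg
  have hden : Tendsto (fun T => Real.exp (-(2 * (a T * Real.log T))) / (2 * (a T * Real.log T) ^ 2))
      g (𝓝 (Real.exp (-(2 * α₀)) / (2 * α₀ ^ 2))) :=
    ((Real.continuous_exp.tendsto _).comp (hα.const_mul 2).neg).div ((hα.pow 2).const_mul 2)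
      (by positivity)
  have hquot := ((hU.const_mul (8 / 3)).sub (hV.const_mul (2 / 3))).div hden (by positivity)
  -- Here (8/3) · (3/16) = 1/2 matches the denominator 2α₀².
  have hone : (8 / 3 * (3 * Real.exp (-(2 * α₀)) / (16 * α₀ ^ 2)) - 2 / 3 * 0) /
      (Real.exp (-(2 * α₀)) / (2 * α₀ ^ 2)) = 1 := by
    have := Real.exp_pos (-(2 * α₀))
    field_simp
    ring
  rw [hone] at hquot
  refine hquot.congr' ?_
  filter_upwards [hag, (eventually_gt_atTop (1:ℝ)).filter_mono hg] with T haT hT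
  have hL : 0 < Real.log T := Real.log_pos hT
  have hx : 0 < a T := pos_of_mul_pos_left (hc.trans_le haT.1) hL.le
  have e : T ^ (-2 * a T) = Real.exp (-(2 * (a T * Real.log T))) := by
    rw [Real.rpow_def_of_pos (by linarith)]
    congr 1; ring
  have hexp := Real.exp_pos (-(2 * (a T * Real.log T)))
  simp only [Pi.div_apply]
  rw [e]
  generalize (∫ t in (0:ℝ)..T, (logDeriv riemannZeta (1 / 2 + a T + t * I)).re ^ 3) = U
  generalize (∫ t in (0:ℝ)..T, logDeriv riemannZeta (1 / 2 + a T + t * I) ^ 3).re = V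
  field_simp

end ZetaGUE

end

theorem theorem1 (hRH : RiemannHypothesis) (hGUE : ZetaGUE.GUE 3)
    (a : ℝ → ℝ) (c C : ℝ) (hc : 0 < c)
    (ha : ∀ᶠ T in atTop, c / Real.log T ≤ a T ∧ a T ≤ C / Real.log T) :
    (fun T : ℝ => ∫ t in (-T)..T,
        ((‖logDeriv riemannZeta (1 / 2 + a T + t * I)‖ ^ 2 : ℝ) : ℂ) *
          logDeriv riemannZeta (1 / 2 + a T + t * I))
      ~[atTop]
    (fun T : ℝ => ((T * Real.log T * (T ^ (-2 * a T) / (2 * a T ^ 2)) : ℝ) : ℂ)) := by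
  have ha' : ∀ᶠ T in atTop, c ≤ a T * Real.log T ∧ a T * Real.log T ≤ C := by
    filter_upwards [ha, eventually_gt_atTop 1] with T hT hT1
    have hL := Real.log_pos hT1
    rwa [div_le_iff₀ hL, le_div_iff₀ hL] at hT
  have hlim := ZetaGUE.tendsto_moment_div hRH (hGUE 1 le_rfl (by norm_num))
    (hGUE 2 (by norm_num) le_rfl) hc ha'
  -- Below 1/2 the line of integration stays to the left of the pole at s = 1; positivity of a(T)
  -- makes the comparison function nonzero.
  have hev : ∀ᶠ T in atTop, 1 < T ∧ 0 < a T ∧ a T < 1 / 2 := by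
    filter_upwards [ha', eventually_gt_atTop 1,
      Real.tendsto_log_atTop.eventually_gt_atTop (2 * |C|)] with T hT hT1 hLC
    have hL := Real.log_pos hT1
    have hx : 0 < a T := pos_of_mul_pos_left (hc.trans_le hT.1) hL.le
    exact ⟨hT1, hx, by nlinarith [le_abs_self C, hT.2]⟩
  rw [isEquivalent_iff_tendsto_one]
  · refine ((continuous_ofReal.tendsto 1).comp hlim).congr' ?_
    filter_upwards [hev] with T hT
    simp only [Function.comp_apply, Pi.div_apply]
    rw [ZetaGUE.integral_normSq_mul_logDeriv hRH hT.2.1 hT.2.2, ofReal_div]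
  · filter_upwards [hev] with T hT
    have hT0 : 0 < T := by linarith
    have hL := Real.log_pos hT.1
    have hx := hT.2.1
    have hp : 0 < T ^ (-2 * a T) := Real.rpow_pos_of_pos hT0 _
    exact ofReal_ne_zero.2 (by positivity)
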